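/- Let $k$ be an algebraically closed field, $n\ge 1$, and let $F$ be an $(s,t)$-Steiner bundle on $\mathbb P^n$ with $s\ge 2$, i.e. a vector bundle with a resolution $0\to S\otimes\mathcal O(-1)\to T\otimes\mathcal O\to F\to 0$, $\dim S=s$, $\dim T=t$. Assume moreover that $s\ge 3$ or $n=1$. Write $\mathbb P(W)$ for the space of lines of $W^*$, let $V=H^0(\mathcal O_{\mathbb P^n}(1))^*$, so that $\mathbb P^n$ is the space of lines of $V$, and let $\varphi:T^*\to S^*\otimes V^*$ be the map induced by the dual of the resolution, $T_0^*$ its image. A jumping pair of $F$ is a pair $([a],H)\in\mathbb P(S)\times{\mathbb P^n}^*$ such that, for an equation $h\in V^*$ of $H$, the tensor $a\otimes h$ maps to zero in $H^1(F^*)=\operatorname{coker}\varphi$, that is, $a\otimes h\in T_0^*$. Let $\tilde J(F)$ be the set of jumping pairs, regarded through the Segre embedding as an algebraic subset of $\mathbb P(T_0)$, with projections $\pi_1,\pi_2$ to $\mathbb P(S)$ and ${\mathbb P^n}^*$, and let $\Sigma(F)=\pi_1(\tilde J(F))$, $J(F)=\pi_2(\tilde J(F))$. Assume $\dim\tilde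 J(F)=t-n-s+1$. Let $\tilde J_0$ be an irreducible component of $\tilde J(F)$ of maximal dimension and $(\alpha,H)\in\tilde J_0$, $\alpha=[a]$, $H=\{h=0\}$, and let $\tau\in T^*$ with $\varphi(\tau)=a\otimes h$. Let $F'$ be the elementary transform, i.e. the kernel of the map $F\to\mathcal O_H$ defined by $\tau$; it is the $(s-1,t-1)$-Steiner bundle with resolution $0\to S'\otimes\mathcal O(-1)\to T'\otimes\mathcal O\to F'\to 0$, $S'=\ker a$, $T'=\ker\tau$. Let $T_0'\subset T'$ be the image of $S'\otimes V\to T'$, and $F_0'$ the reduced summand of $F'$, with resolution $0\to S'\otimes\mathcal O(-1)\to T'_0\otimes\mathcal O\to F'_0\to0$. Let $pr_{(\alpha,H)}:\mathbb P(T_0)\dashrightarrow\mathbb P(T_0')$ be the linear projection induced by restriction of forms $T^*\to T'^*\to T_0'^*$; it is the projection with centre $\pi_1^{-1}(\alpha)$. Let $pr_\alpha:\mathbb P(S)\dashrightarrow\mathbb P(S')$ be the projection from $\alpha$. The image of a set under such a projection means the Zariski closure of the image of its points outside the centre. Then: 1. The images of $\tilde J_0$ and of $\tilde J(F)$ under $pr_{(\alpha,H)}$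 both have dimension $t-n-s+1-\dim\pi_1^{-1}(\alpha)$. 2. $\dim\tilde J(F_0')=t-n-s+1-\dim\pi_1^{-1}(\alpha)$, which equals $\dim T'_0-n-(s-1)+1$, the maximal value for $F_0'$. 3. If $\tilde J(F'_0)$ is irreducible, then: (a) $\tilde J(F_0')$ is the image of $\tilde J(F)$ under $pr_{(\alpha,H)}$; (b) $\tilde J(F)$ is irreducible; (c) $J(F)=J(F_0')$; (d) $\Sigma(F_0')$ is the image of $\Sigma(F)$ under $pr_\alpha$. -/

import Mathlib

open Module
open scoped LinearAlgebra.Projectivization TensorProduct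

noncomputable section

/-! ### Zariski topology on the projective space of lines of a vector space -/

section Zariski

variable {k : Type*} [Field k] {W : Type*} [AddCommGroup W] [Module k W]

/-- The value at `w` of a polynomial expression in linear forms. For a finite dimensional space `W`
these are exactly the polynomial functions on `W`; the formal variables are the linear forms, so
that no basis is chosen. -/
def polyEval (p : MvPolynomial (Dual k W) k) (w : W) : k :=
  MvPolynomial.eval (fun f : Dual k W => f w) p

/-- The hypersurface of the set `ℙ k W` of lines of `W` defined by a polynomial `p`. It is used for
homogeneous `p` only, when it does not depend on the representatives. -/
def projHypersurface (p : MvPolynomial (Dual k W) k) : Set (ℙ k W) :=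
  {x | polyEval p x.rep = 0}

/-- The Zariski topology on `ℙ k W`: the closed sets are the intersections of finite unions of
hypersurfaces, i.e. the common zero loci of sets of homogeneous polynomials. -/
instance zariskiTopology : TopologicalSpace (ℙ k W) :=
  TopologicalSpace.generateFrom
    {U | ∃ (d : ℕ) (p : MvPolynomial (Dual k W) k), p.IsHomogeneous d ∧ U = (projHypersurface p)ᶜ}

/-- The dimension of a subset of a topological space, with the induced topology. -/
def zdim {X : Type*} [TopologicalSpace X] (Y : Set X) : WithBot ℕ∞ :=
  topologicalKrullDim Y

/-- `Z` is an irreducible component of `Y`: a maximal irreducible subset. -/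
def IsIrredComponent {X : Type*} [TopologicalSpace X] (Z Y : Set X) : Prop :=
  Maximal (fun A : Set X => IsIrreducible A ∧ A ⊆ Y) Z

variable {W' : Type*} [AddCommGroup W'] [Module k W']

/-- The image of `X ⊆ ℙ k W` under the linear projection `ℙ k W ⇢ ℙ k W'` induced by a linear map
`f : W → W'`, whose centre is the projective space of the kernel of `f`: the Zariski closure of the
set of images of the points of `X` that are not in the centre. -/
def projImage (f : W →ₗ[k] W') (X : Set (ℙ k W)) : Set (ℙ k W') :=
  closure {y | ∃ x ∈ X, ∃ hx : f x.rep ≠ 0, y = Projectivization.mk k (f x.rep) hx}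

end Zariski

/-! ### Steiner bundles -/

/-- A Steiner bundle `F` with its resolution `0 → S ⊗ O(-1) → T ⊗ O → F → 0` on the projective
space `ℙⁿ` of lines of `V`, so that `V = H⁰(O(1))*` and `dim V = n + 1`.

A morphism `S ⊗ O(-1) → T ⊗ O` is a bilinear map `S × V → T`: over the point `[u]`, the fibre of
`O(-1)` is the line spanned by `u`, and `s ⊗ u` goes to `mul s u`. Its cokernel `F` is a vector
bundle, and the sequence is exact on the left, exactly when the morphism is injective on the fibre
over every point. With `dim S = s` and `dim T = t`, this is an `(s, t)`-Steiner bundle. -/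
structure SteinerBundle (k S T V : Type*) [Field k] [AddCommGroup S] [Module k S]
    [AddCommGroup T] [Module k T] [AddCommGroup V] [Module k V] where
  /-- The morphism `S ⊗ O(-1) → T ⊗ O`. -/
  mul : S →ₗ[k] V →ₗ[k] T
  /-- The morphism is injective on all fibres. -/
  fibre_injective : ∀ u : V, u ≠ 0 → Function.Injective fun s : S => mul s u

section Segre

variable {k S V : Type*} [Field k] [AddCommGroup S] [Module k S] [AddCommGroup V] [Module k V]

/-- The pure tensor `a ⊗ h` in `S* ⊗ V* = (S ⊗ V)*`, i.e. the form `s ⊗ u ↦ a(s) h(u)`. -/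
def pureTensor (a : Dual k S) (h : Dual k V) : Dual k (S ⊗[k] V) :=
  TensorProduct.dualDistrib k S V (a ⊗ₜ[k] h)

@[simp] theorem pureTensor_tmul (a : Dual k S) (h : Dual k V) (s : S) (u : V) :
    pureTensor a h (s ⊗ₜ[k] u) = a s * h u :=
  TensorProduct.dualDistrib_apply a h s u

theorem pureTensor_ne_zero {a : Dual k S} {h : Dual k V} (ha : a ≠ 0) (hh : h ≠ 0) :
    pureTensor a h ≠ 0 := by
  intro h0
  apply hh
  ext u
  by_contra hu
  apply ha
  ext s
  have h1 : a s * h u = 0 := by rw [← pureTensor_tmul, h0]; rfl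
  exact (mul_eq_zero.mp h1).resolve_right hu

/-- The Segre embedding of `ℙ(S) × ℙⁿ*` into the projective space `ℙ(S ⊗ V)` of lines of
`S* ⊗ V* = (S ⊗ V)*`. Here `ℙ(S)` is the set of lines of `S*`, and a hyperplane `H` of `ℙⁿ` is
the line of `V*` spanned by an equation of `H`. -/
def segre (x : ℙ k (Dual k S) × ℙ k (Dual k V)) : ℙ k (Dual k (S ⊗[k] V)) :=
  Projectivization.mk k (pureTensor x.1.rep x.2.rep)
    (pureTensor_ne_zero x.1.rep_nonzero x.2.rep_nonzero)

end Segre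

namespace SteinerBundle

variable {k S T V : Type*} [Field k] [AddCommGroup S] [Module k S]
  [AddCommGroup T] [Module k T] [AddCommGroup V] [Module k V]

/-- The linear map `S ⊗ V → T` that corresponds to the morphism in the resolution. -/
def mulMap (F : SteinerBundle k S T V) : S ⊗[k] V →ₗ[k] T :=
  TensorProduct.lift F.mul

/-- The linear map `φ : T* → S* ⊗ H⁰(O(1)) = (S ⊗ V)*` induced on global sections by the dual
`T* ⊗ O → S* ⊗ O(1)` of the morphism in the resolution. -/
def phi (F : SteinerBundle k S T V) : Dual k T →ₗ[k] Dual k (S ⊗[k] V) :=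
  F.mulMap.dualMap

@[simp] theorem phi_tmul (F : SteinerBundle k S T V) (τ : Dual k T) (s : S) (u : V) :
    F.phi τ (s ⊗ₜ[k] u) = τ (F.mul s u) := rfl

/-- The image `T₀*` of `φ`. -/
abbrev imPhi (F : SteinerBundle k S T V) : Submodule k (Dual k (S ⊗[k] V)) :=
  LinearMap.range F.phi

/-- `H¹(F*)`: as `H¹(T* ⊗ O) = 0`, the sequence `0 → F* → T* ⊗ O → S* ⊗ O(1) → 0` identifies it
with the cokernel of `φ`. -/
abbrev H1Dual (F : SteinerBundle k S T V) : Type _ := Dual k (S ⊗[k] V) ⧸ F.imPhi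

/-- The connecting map `S* ⊗ H⁰(O(1)) → H¹(F*)`. -/
def connecting (F : SteinerBundle k S T V) : Dual k (S ⊗[k] V) →ₗ[k] F.H1Dual :=
  F.imPhi.mkQ

/-- Let `A ⊆ S*`, and let `B = H⁰(J_Λ(1)) ⊆ V*` be the linear forms that vanish on a linear
subspace `Λ` of `ℙⁿ`. Then `(A, Λ)` is a jumping pair when `A ⊗ B`, as a subspace of
`H¹(F* ⊗ J_Λ) = S* ⊗ B`, is in the kernel of `H¹(F* ⊗ J_Λ) → H¹(F*)`. -/
def IsJumpingPair (F : SteinerBundle k S T V) (A : Submodule k (Dual k S))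
    (B : Submodule k (Dual k V)) : Prop :=
  ∀ a ∈ A, ∀ h ∈ B, F.connecting (pureTensor a h) = 0

/-- The set of `(1,1)`-jumping pairs `(α, H)` of `F`, in `ℙ(S) × ℙⁿ*`. -/
def jumpingPairs (F : SteinerBundle k S T V) : Set (ℙ k (Dual k S) × ℙ k (Dual k V)) :=
  {x | F.IsJumpingPair x.1.submodule x.2.submodule}

/-- The set `J(F)` of jumping hyperplanes, in `ℙⁿ*`. -/
def jumpingHyperplanes (F : SteinerBundle k S T V) : Set (ℙ k (Dual k V)) :=
  Prod.snd '' F.jumpingPairs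

/-- The set `Σ(F)`, in `ℙ(S)`. -/
def sigmaSet (F : SteinerBundle k S T V) : Set (ℙ k (Dual k S)) :=
  Prod.fst '' F.jumpingPairs

/-- For a set of pairs in `ℙ(S) × ℙⁿ*`, the set of the points of `ℙ(T₀)` (the lines of `T₀*`) that
the Segre embedding attaches to these pairs. -/
def inPT0 (F : SteinerBundle k S T V) (P : Set (ℙ k (Dual k S) × ℙ k (Dual k V))) :
    Set (ℙ k F.imPhi) :=
  {x | Projectivization.map F.imPhi.subtype F.imPhi.injective_subtype x ∈ segre '' P}

/-- The set of jumping pairs as an algebraic subset `J̃(F)` of the projective space `ℙ(T₀)`. -/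
def jumpingVariety (F : SteinerBundle k S T V) : Set (ℙ k F.imPhi) :=
  F.inPT0 F.jumpingPairs

/-- The fibre `π₁⁻¹(α)` of the projection `π₁ : J̃(F) → ℙ(S)`, as a subset of `ℙ(T₀)`. -/
def firstFibre (F : SteinerBundle k S T V) (α : ℙ k (Dual k S)) : Set (ℙ k F.imPhi) :=
  F.inPT0 {x | x ∈ F.jumpingPairs ∧ x.1 = α}

/-! #### The reduced summand -/

/-- The subspace `T₀` of `T`, i.e. the image of `S ⊗ V → T`; its dual is the image `T₀*` of `φ`. -/
def T0 (F : SteinerBundle k S T V) : Submodule k T :=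
  LinearMap.range F.mulMap

theorem mul_mem_T0 (F : SteinerBundle k S T V) (s : S) (u : V) : F.mul s u ∈ F.T0 :=
  ⟨s ⊗ₜ[k] u, rfl⟩

/-- The reduced summand `F₀`, with resolution `0 → S ⊗ O(-1) → T₀ ⊗ O → F₀ → 0`; one has
`F = F₀ ⊕ (T / T₀) ⊗ O`. -/
def reducedSummand (F : SteinerBundle k S T V) : SteinerBundle k S F.T0 V where
  mul := LinearMap.mk₂ k (fun s u => (⟨F.mul s u, F.mul_mem_T0 s u⟩ : F.T0))
    (fun _ _ _ => Subtype.ext (by simp)) (fun _ _ _ => Subtype.ext (by simp))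
    (fun _ _ _ => Subtype.ext (by simp)) (fun _ _ _ => Subtype.ext (by simp))
  fibre_injective u hu s s' h := F.fibre_injective u hu (congrArg Subtype.val h)

/-! #### The elementary transform -/

/-- The elementary transform `F'` of `F` at a jumping pair `(α, H)`, where `α = [a]`, `H` has the
equation `h` and `τ ∈ T*` maps to `a ⊗ h`, so that `[τ]` is the point of `ℙ(T)` given by `(α, H)`.
The equality `φ(τ) = a ⊗ h` says that `τ : T ⊗ O → O` and `a : S ⊗ O(-1) → O(-1)` are compatible
with `h : O(-1) → O`, hence induce `F → O_H`. The kernel `F'` of `F → O_H` has the resolution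
`0 → S' ⊗ O(-1) → T' ⊗ O → F' → 0` with `S' = ker a` and `T' = ker τ`. -/
def elementaryTransform (F : SteinerBundle k S T V) {a : Dual k S} {h : Dual k V} {τ : Dual k T}
    (hτ : F.phi τ = pureTensor a h) :
    SteinerBundle k (LinearMap.ker a) (LinearMap.ker τ) V where
  mul := LinearMap.mk₂ k
    (fun s u => (⟨F.mul s u, by
      have h1 : τ (F.mul s u) = a s * h u := by
        rw [← F.phi_tmul, hτ, pureTensor_tmul]
      have h2 : a s = 0 := s.2
      rw [LinearMap.mem_ker, h1, h2, zero_mul]⟩ : LinearMap.ker τ))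
    (fun _ _ _ => Subtype.ext (by simp)) (fun _ _ _ => Subtype.ext (by simp))
    (fun _ _ _ => Subtype.ext (by simp)) (fun _ _ _ => Subtype.ext (by simp))
  fibre_injective u hu s s' h :=
    Subtype.ext (F.fibre_injective u hu (congrArg Subtype.val h))

/-- The reduced part `F'₀` of the elementary transform `F'`. -/
abbrev reducedTransform (F : SteinerBundle k S T V) {a : Dual k S} {h : Dual k V} {τ : Dual k T}
    (hτ : F.phi τ = pureTensor a h) :
    SteinerBundle k (LinearMap.ker a) (F.elementaryTransform hτ).T0 V :=
  (F.elementaryTransform hτ).reducedSummand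

/-- The map `j* : T* → T'*` followed by `T'* → T'₀*`: restriction of linear forms. -/
def restrictForm (F : SteinerBundle k S T V) {a : Dual k S} {h : Dual k V} {τ : Dual k T}
    (hτ : F.phi τ = pureTensor a h) : Dual k T →ₗ[k] Dual k (F.elementaryTransform hτ).T0 :=
  (F.elementaryTransform hτ).T0.subtype.dualMap ∘ₗ (LinearMap.ker τ).subtype.dualMap

/-- The map `i* ⊗ id : S* ⊗ V* → S'* ⊗ V*`, where `i : S' → S` is the inclusion of `ker a`. -/
def restrictTensor (a : Dual k S) :
    Dual k (S ⊗[k] V) →ₗ[k] Dual k (LinearMap.ker a ⊗[k] V) :=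
  ((LinearMap.ker a).subtype.rTensor V).dualMap

/-- The diagram that relates `φ` to the map `φ'` of `F'₀`. -/
theorem restrictTensor_phi (F : SteinerBundle k S T V) {a : Dual k S} {h : Dual k V}
    {τ : Dual k T} (hτ : F.phi τ = pureTensor a h) (σ : Dual k T) :
    restrictTensor a (F.phi σ) = (F.reducedTransform hτ).phi (F.restrictForm hτ σ) := by
  apply TensorProduct.ext'
  intro s u
  rfl

/-- The linear map `T₀* → T'₀*` that induces the projection `pr_{(α,H)}` from `ℙ(T₀)` to `ℙ(T'₀)`.
By `restrictTensor_phi` it is the map induced by the composition `T* → T'* → T'₀*`. -/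
def prMap (F : SteinerBundle k S T V) {a : Dual k S} {h : Dual k V} {τ : Dual k T}
    (hτ : F.phi τ = pureTensor a h) : F.imPhi →ₗ[k] (F.reducedTransform hτ).imPhi :=
  (restrictTensor a).restrict (by
    rintro _ ⟨σ, rfl⟩
    exact ⟨F.restrictForm hτ σ, (F.restrictTensor_phi hτ σ).symm⟩)

/-- The image in `ℙ(T'₀)` of a subset of `ℙ(T₀)` under the projection `pr_{(α,H)}`. -/
def prImage (F : SteinerBundle k S T V) {a : Dual k S} {h : Dual k V} {τ : Dual k T}
    (hτ : F.phi τ = pureTensor a h) (X : Set (ℙ k F.imPhi)) :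
    Set (ℙ k (F.reducedTransform hτ).imPhi) :=
  projImage (W' := (F.reducedTransform hτ).imPhi) (F.prMap hτ) X

/-- The linear map `i* : S* → S'*` that induces the projection `pr_α` from `ℙ(S)` to `ℙ(S')`. -/
def prAlpha (a : Dual k S) : Dual k S →ₗ[k] Dual k (LinearMap.ker a) :=
  (LinearMap.ker a).subtype.dualMap

end SteinerBundle

end

/-! The space `T₀*` is a space `U` of bilinear forms on `S × V`. Fibrewise injectivity says that no
pair of nonzero vectors is isotropic for all of them, and `J̃(F)` is the set of lines of forms of
rank one `b ⊗ g` (`jumpingVariety_eq`). The elementary transform restricts the forms to `ker a × V`.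
The kernel `K` of this restriction consists of all `a ⊗ g` in `U`; with `κ = dim K` one has `dim
π₁⁻¹(α) = κ - 1`.

Dimensions are measured on cones, by the transcendence degree `coneDim` of the homogeneous
coordinate ring; it exceeds the Krull dimension by one. Two estimates carry the numerical part. The
first is Hopf's inequality `dim S + dim V ≤ dim U + 1` (`IsSteinerForm.add_le`): the Segre cone has
dimension at least `dim S + dim V - 1`, and the `dim U` bilinear equations have no common zero on
it. The second concerns the projection from `K`. A form of rank one is recovered from its
restriction to `ker a × V` and one further entry, so at most one dimension is lost; none is lost
unless every second factor in the family vanishes at all common zeros of the `g` with `a ⊗ g ∈ U`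
(`IsFirstProjection.coneDim_le_or`). Induction then gives the bound `coneDim Z + dim S + dim V ≤ dim
U + 3` for irreducible closed sets of forms of rank one (`IsSteinerForm.coneDim_le`). The assumption
`s ≥ 3` or `n = 1` makes the bound available for `F'₀` too.

For a component `J` attaining the bound, loss at most one and the bound for the target leave two
possibilities (`IsMaxFamily.dim_projImage`): `κ = 1`, without loss, or `κ = 2`, where one dimension
is lost and every second factor `g` in `J` satisfies `a ⊗ g ∈ U`. In both cases the image has the
dimension of the target, which gives the first two claims.

If the target is irreducible, it equals the image of `J`. Elimination (`isClosed_incidence`) lifts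
each of its points to a point of `J` with the same second factor. For `κ = 1` the lift is unique
except over the second factor of the chosen point, where a limiting argument applies. For `κ = 2`
the forms `b ⊗ g` can be translated along `a ⊗ g`, and the component `J` is stable under these
translations. Either way `J` contains all forms of rank one, and the statements on `J(F)` and `Σ(F)`
follow by elimination. -/

noncomputable section

/-! ### Vanishing ideals and the Zariski topology -/

section VanishingIdeal

variable {k : Type*} [Field k] {W : Type*} [AddCommGroup W] [Module k W]

/-- The nonzero vectors on the lines of a set of lines. -/
def cone (Z : Set (ℙ k W)) : Set W :=
  {w | ∃ hw : w ≠ 0, Projectivization.mk k w hw ∈ Z}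

theorem mk_mem_iff_mem_cone {Z : Set (ℙ k W)} {w : W} (hw : w ≠ 0) :
    Projectivization.mk k w hw ∈ Z ↔ w ∈ cone Z :=
  ⟨fun h => ⟨hw, h⟩, fun h => h.2⟩

theorem rep_mem_cone {Z : Set (ℙ k W)} {x : ℙ k W} : x.rep ∈ cone Z ↔ x ∈ Z := by
  rw [← mk_mem_iff_mem_cone x.rep_nonzero, Projectivization.mk_rep]

theorem ne_zero_of_mem_cone {Z : Set (ℙ k W)} {w : W} (h : w ∈ cone Z) : w ≠ 0 := h.1

theorem smul_mem_cone {Z : Set (ℙ k W)} {w : W} (h : w ∈ cone Z) {c : k} (hc : c ≠ 0) :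
    c • w ∈ cone Z := by
  refine ⟨smul_ne_zero hc h.1, ?_⟩
  convert h.2 using 1
  rw [Projectivization.mk_eq_mk_iff']
  exact ⟨c, rfl⟩

theorem cone_mono {Z Y : Set (ℙ k W)} (h : Z ⊆ Y) : cone Z ⊆ cone Y :=
  fun _ hw => ⟨hw.1, h hw.2⟩

theorem cone_subset_cone {Z Y : Set (ℙ k W)} : cone Z ⊆ cone Y ↔ Z ⊆ Y :=
  ⟨fun h _ hx => rep_mem_cone.1 (h (rep_mem_cone.2 hx)), cone_mono⟩

theorem exists_smul_rep_mk {w : W} (hw : w ≠ 0) :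
    ∃ c : k, c ≠ 0 ∧ (Projectivization.mk k w hw).rep = c • w := by
  obtain ⟨c, hc⟩ := Projectivization.exists_smul_eq_mk_rep k w hw
  exact ⟨c, c.ne_zero, hc.symm⟩

@[simp] theorem polyEval_X (f : Dual k W) (w : W) : polyEval (MvPolynomial.X f) w = f w := by
  simp [polyEval]

@[simp] theorem polyEval_C (c : k) (w : W) : polyEval (MvPolynomial.C c) w = c := by
  simp [polyEval]

@[simp] theorem polyEval_mul (p q : MvPolynomial (Dual k W) k) (w : W) :
    polyEval (p * q) w = polyEval p w * polyEval q w := by simp [polyEval]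

@[simp] theorem polyEval_add (p q : MvPolynomial (Dual k W) k) (w : W) :
    polyEval (p + q) w = polyEval p w + polyEval q w := by simp [polyEval]

@[simp] theorem polyEval_sub (p q : MvPolynomial (Dual k W) k) (w : W) :
    polyEval (p - q) w = polyEval p w - polyEval q w := by simp [polyEval]

@[simp] theorem polyEval_zero (w : W) : polyEval (0 : MvPolynomial (Dual k W) k) w = 0 := by
  simp [polyEval]

@[simp] theorem polyEval_one (w : W) : polyEval (1 : MvPolynomial (Dual k W) k) w = 1 := by
  simp [polyEval]

@[simp] theorem polyEval_pow (p : MvPolynomial (Dual k W) k) (n : ℕ) (w : W) :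
    polyEval (p ^ n) w = polyEval p w ^ n := by simp [polyEval]

theorem polyEval_sum {ι : Type*} (s : Finset ι) (p : ι → MvPolynomial (Dual k W) k) (w : W) :
    polyEval (∑ i ∈ s, p i) w = ∑ i ∈ s, polyEval (p i) w := by simp [polyEval]

theorem polyEval_prod {ι : Type*} (s : Finset ι) (p : ι → MvPolynomial (Dual k W) k) (w : W) :
    polyEval (∏ i ∈ s, p i) w = ∏ i ∈ s, polyEval (p i) w := by
  simp [polyEval]

theorem polyEval_smul_of_isHomogeneous {p : MvPolynomial (Dual k W) k} {d : ℕ}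
    (hp : p.IsHomogeneous d) (c : k) (w : W) :
    polyEval p (c • w) = c ^ d * polyEval p w := by
  unfold polyEval
  rw [MvPolynomial.eval_eq, MvPolynomial.eval_eq, Finset.mul_sum]
  refine Finset.sum_congr rfl fun m hm => ?_
  have h1 : ∑ i ∈ m.support, m i = d := by
    have := hp (MvPolynomial.mem_support_iff.1 hm)
    simpa [Finsupp.weight_apply, Finsupp.sum] using this
  simp only [map_smul, smul_eq_mul, mul_pow, Finset.prod_mul_distrib, Finset.prod_pow_eq_pow_sum,
    h1]
  ring

theorem polyEval_smul (p : MvPolynomial (Dual k W) k) (c : k) (w : W) :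
    polyEval p (c • w) = ∑ i ∈ Finset.range (p.totalDegree + 1),
      c ^ i * polyEval (MvPolynomial.homogeneousComponent i p) w := by
  conv_lhs => rw [← MvPolynomial.sum_homogeneousComponent p]
  rw [polyEval_sum]
  exact Finset.sum_congr rfl fun i _ =>
    polyEval_smul_of_isHomogeneous (MvPolynomial.homogeneousComponent_isHomogeneous i p) c w

/-- The ideal of the polynomials that vanish on a set of lines. -/
def vanI (Z : Set (ℙ k W)) : Ideal (MvPolynomial (Dual k W) k) where
  carrier := {p | ∀ w ∈ cone Z, polyEval p w = 0}
  add_mem' hp hq w hw := by simp [hp w hw, hq w hw]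
  zero_mem' w _ := polyEval_zero w
  smul_mem' c p hp w hw := by simp [hp w hw]

theorem vanI_anti {Z Y : Set (ℙ k W)} (h : Z ⊆ Y) : vanI Y ≤ vanI Z :=
  fun _ hp w hw => hp w (cone_mono h hw)

/-- At a fixed `w` in the cone, `p (c • w)` is a polynomial in `c` whose coefficients are the values
of the homogeneous components. It vanishes for all `c ≠ 0`, hence identically over an infinite
field. -/
theorem homogeneousComponent_mem_vanI [Infinite k] {Z : Set (ℙ k W)}
    {p : MvPolynomial (Dual k W) k} (hp : p ∈ vanI Z) (i : ℕ) :
    MvPolynomial.homogeneousComponent i p ∈ vanI Z := by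
  intro w hw
  by_cases hi : i ∈ Finset.range (p.totalDegree + 1)
  swap
  · rw [MvPolynomial.homogeneousComponent_eq_zero _ _ (by simpa [Nat.lt_succ_iff] using hi)]
    exact polyEval_zero w
  let P : Polynomial k := ∑ j ∈ Finset.range (p.totalDegree + 1),
    Polynomial.monomial j (polyEval (MvPolynomial.homogeneousComponent j p) w)
  have hP : P = 0 := by
    refine Polynomial.eq_zero_of_infinite_isRoot P (Set.Infinite.mono (s := {c : k | c ≠ 0}) ?_ ?_)
    · intro c hc
      have := hp _ (smul_mem_cone hw hc)
      rw [polyEval_smul] at this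
      simp only [Set.mem_ofPred_eq, Polynomial.IsRoot, P, Polynomial.eval_finsetSum,
        Polynomial.eval_monomial]
      rw [← this]
      exact Finset.sum_congr rfl fun _ _ => mul_comm _ _
    · exact (Set.finite_singleton (0 : k)).infinite_compl
  have := congrArg (fun Q => Polynomial.coeff Q i) hP
  simp only [P, Polynomial.finsetSum_coeff, Polynomial.coeff_monomial, Polynomial.coeff_zero] at this
  rw [Finset.sum_ite_eq' , if_pos hi] at this
  exact this

/-- Finite intersections of complements of hypersurfaces form a basis of the topology. If a basic
neighbourhood of `x` misses `Z`, the product of its equations vanishes on `Z` but not at `x`. -/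
theorem mem_closure_iff_vanI [Infinite k] {Z : Set (ℙ k W)} {x : ℙ k W} :
    x ∈ closure Z ↔ ∀ p ∈ vanI Z, polyEval p x.rep = 0 := by
  constructor
  · intro hx p hp
    rw [← MvPolynomial.sum_homogeneousComponent p, polyEval_sum]
    refine Finset.sum_eq_zero fun i _ => ?_
    have hcl : IsClosed (projHypersurface (MvPolynomial.homogeneousComponent i p)) := by
      rw [← isOpen_compl_iff]
      exact TopologicalSpace.isOpen_generateFrom_of_mem
        ⟨i, _, MvPolynomial.homogeneousComponent_isHomogeneous i p, rfl⟩
    exact closure_minimal (t := projHypersurface (MvPolynomial.homogeneousComponent i p))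
      (fun y hy => homogeneousComponent_mem_vanI hp i _ (rep_mem_cone.2 hy)) hcl hx
  · intro h
    by_contra hx
    have hb := TopologicalSpace.isTopologicalBasis_of_subbasis (α := ℙ k W)
      (s := {U | ∃ (d : ℕ) (p : MvPolynomial (Dual k W) k), p.IsHomogeneous d ∧
        U = (projHypersurface p)ᶜ}) rfl
    obtain ⟨U, hU, hxU, hUZ⟩ := hb.exists_subset_of_mem_open (show x ∈ (closure Z)ᶜ from hx)
      isClosed_closure.isOpen_compl
    obtain ⟨F, ⟨hFfin, hF⟩, rfl⟩ := hU
    have hF' : ∀ V ∈ F, ∃ p : MvPolynomial (Dual k W) k, (∃ d, p.IsHomogeneous d) ∧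
        V = (projHypersurface p)ᶜ := fun V hV => by
      obtain ⟨d, p, hp, h⟩ := hF hV
      exact ⟨p, ⟨d, hp⟩, h⟩
    choose! p hp hpU using hF'
    let q := ∏ V ∈ hFfin.toFinset, p V
    have hqx : polyEval q x.rep ≠ 0 := by
      rw [polyEval_prod, Finset.prod_ne_zero_iff]
      intro V hV
      have hV' := hFfin.mem_toFinset.1 hV
      have := hxU V hV'
      rw [hpU V hV'] at this
      exact this
    refine hqx (h q ?_)
    intro w hw
    by_contra hne
    rw [polyEval_prod, ← ne_eq, Finset.prod_ne_zero_iff] at hne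
    obtain ⟨c, hc, hrep⟩ := exists_smul_rep_mk (k := k) hw.1
    refine (hUZ (a := Projectivization.mk k w hw.1) ?_) (subset_closure hw.2)
    intro V hV
    rw [hpU V hV]
    show polyEval (p V) _ ≠ 0
    obtain ⟨d, hd⟩ := hp V hV
    rw [hrep, polyEval_smul_of_isHomogeneous hd]
    exact mul_ne_zero (pow_ne_zero _ hc) (hne V (hFfin.mem_toFinset.2 hV))

theorem vanI_closure [Infinite k] (Z : Set (ℙ k W)) : vanI (closure Z) = vanI Z := by
  refine le_antisymm (vanI_anti subset_closure) fun p hp w hw => ?_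
  obtain ⟨c, hc, hrep⟩ := exists_smul_rep_mk (k := k) hw.1
  rw [← MvPolynomial.sum_homogeneousComponent p, polyEval_sum]
  refine Finset.sum_eq_zero fun i _ => ?_
  have h1 := mem_closure_iff_vanI.1 hw.2 _ (homogeneousComponent_mem_vanI hp i)
  rw [hrep, polyEval_smul_of_isHomogeneous
    (MvPolynomial.homogeneousComponent_isHomogeneous i p)] at h1
  exact (mul_eq_zero.1 h1).resolve_left (pow_ne_zero _ hc)

theorem mem_cone_closure [Infinite k] {Z : Set (ℙ k W)} {w : W} (hw : w ≠ 0) :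
    w ∈ cone (closure Z) ↔ ∀ p ∈ vanI Z, polyEval p w = 0 := by
  constructor
  · intro h p hp
    rw [← vanI_closure] at hp
    exact hp w h
  · intro h
    refine ⟨hw, mem_closure_iff_vanI.2 fun p hp => ?_⟩
    obtain ⟨c, hc, hrep⟩ := exists_smul_rep_mk (k := k) hw
    rw [hrep, polyEval_smul]
    exact Finset.sum_eq_zero fun i _ => by
      rw [h _ (homogeneousComponent_mem_vanI hp i), mul_zero]

theorem mem_cone_of_isClosed [Infinite k] {Z : Set (ℙ k W)} (hZ : IsClosed Z) {w : W}
    (hw : w ≠ 0) : w ∈ cone Z ↔ ∀ p ∈ vanI Z, polyEval p w = 0 := by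
  conv_lhs => rw [← hZ.closure_eq]
  exact mem_cone_closure hw

theorem exists_vanI_of_notMem [Infinite k] {Z : Set (ℙ k W)} (hZ : IsClosed Z) {w : W}
    (hw : w ≠ 0) (h : w ∉ cone Z) : ∃ p ∈ vanI Z, polyEval p w ≠ 0 := by
  by_contra! hcon
  exact h ((mem_cone_of_isClosed hZ hw).2 hcon)

/-- A set of lines that is the zero locus of homogeneous polynomials is closed. -/
theorem isClosed_of_polys {Z : Set (ℙ k W)} (P : Set (MvPolynomial (Dual k W) k))
    (hP : ∀ p ∈ P, ∃ d, p.IsHomogeneous d)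
    (h : ∀ x : ℙ k W, x ∈ Z ↔ ∀ p ∈ P, polyEval p x.rep = 0) : IsClosed Z := by
  have : Z = ⋂ p ∈ P, projHypersurface p := by
    ext x
    simp [h, projHypersurface]
  rw [this]
  refine isClosed_biInter fun p hp => ?_
  obtain ⟨d, hd⟩ := hP p hp
  rw [← isOpen_compl_iff]
  exact TopologicalSpace.isOpen_generateFrom_of_mem ⟨d, p, hd, rfl⟩

theorem eq_of_vanI_eq [Infinite k] {Z Y : Set (ℙ k W)} (hZ : IsClosed Z) (hY : IsClosed Y)
    (h : vanI Z = vanI Y) : Z = Y := by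
  refine Set.Subset.antisymm ?_ ?_
  · rw [← cone_subset_cone]
    intro w hw
    rw [mem_cone_of_isClosed hY hw.1, ← h]
    exact fun p hp => hp w hw
  · rw [← cone_subset_cone]
    intro w hw
    rw [mem_cone_of_isClosed hZ hw.1, h]
    exact fun p hp => hp w hw

/-- The ideal is homogeneous, so primality need only be tested on homogeneous elements. These define
closed hypersurfaces, to which irreducibility applies. -/
theorem vanI_isPrime [Infinite k] {Z : Set (ℙ k W)} (hZ : IsIrreducible Z) :
    (vanI Z).IsPrime := by
  classical
  let := MvPolynomial.gradedAlgebra (σ := Dual k W) (R := k)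
  have hhom : (vanI Z).IsHomogeneous (MvPolynomial.homogeneousSubmodule (Dual k W) k) := by
    intro i p hp
    have := homogeneousComponent_mem_vanI hp i
    rwa [← MvPolynomial.decomposition.decompose'_apply] at this
  refine hhom.isPrime_of_homogeneous_mem_or_mem ?_ ?_
  · intro h
    obtain ⟨x, hx⟩ := hZ.nonempty
    have h1 : (1 : MvPolynomial (Dual k W) k) ∈ vanI Z := by rw [h]; trivial
    simpa using h1 _ (rep_mem_cone.2 hx)
  · rintro p q ⟨d, hp⟩ ⟨e, hq⟩ hpq
    have hcl : ∀ (r : MvPolynomial (Dual k W) k) (d : ℕ), r.IsHomogeneous d →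
        IsClosed (projHypersurface r) := by
      intro r d hr
      rw [← isOpen_compl_iff]
      exact TopologicalSpace.isOpen_generateFrom_of_mem ⟨d, r, hr, rfl⟩
    have hmem : ∀ (r : MvPolynomial (Dual k W) k) (d : ℕ), r.IsHomogeneous d →
        Z ⊆ projHypersurface r → r ∈ vanI Z := by
      intro r d hr h w hw
      obtain ⟨c, hc, hrep⟩ := exists_smul_rep_mk (k := k) hw.1
      have := h hw.2
      rw [projHypersurface, Set.mem_ofPred_eq, hrep, polyEval_smul_of_isHomogeneous hr] at this
      exact (mul_eq_zero.1 this).resolve_left (pow_ne_zero _ hc)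
    have := isPreirreducible_iff_isClosed_union_isClosed.1 hZ.isPreirreducible _ _
      (hcl p d hp) (hcl q e hq) (fun x hx => by
        have := hpq _ (rep_mem_cone.2 hx)
        rw [polyEval_mul, mul_eq_zero] at this
        exact this)
    exact this.imp (hmem p d hp) (hmem q e hq)

theorem isIrreducible_of_vanI [Infinite k] {Z : Set (ℙ k W)} (hne : Z.Nonempty)
    (h : ∀ p q, p * q ∈ vanI Z → p ∈ vanI Z ∨ q ∈ vanI Z) : IsIrreducible Z := by
  refine ⟨hne, isPreirreducible_iff_isClosed_union_isClosed.2 fun Z₁ Z₂ h1 h2 h12 => ?_⟩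
  by_contra! hcon
  obtain ⟨hn1, hn2⟩ := hcon
  obtain ⟨x, hx, hx1⟩ := Set.not_subset.1 hn1
  obtain ⟨y, hy, hy2⟩ := Set.not_subset.1 hn2
  obtain ⟨p, hp, hpx⟩ := exists_vanI_of_notMem h1 x.rep_nonzero (fun h => hx1 (rep_mem_cone.1 h))
  obtain ⟨q, hq, hqy⟩ := exists_vanI_of_notMem h2 y.rep_nonzero (fun h => hy2 (rep_mem_cone.1 h))
  have hpq : p * q ∈ vanI Z := by
    intro w hw
    rw [polyEval_mul, mul_eq_zero]
    exact (h12 hw.2).imp (fun h => hp w ⟨hw.1, h⟩) (fun h => hq w ⟨hw.1, h⟩)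
  exact (h p q hpq).elim (fun h => hpx (h _ (rep_mem_cone.2 hx)))
    (fun h => hqy (h _ (rep_mem_cone.2 hy)))

end VanishingIdeal

/-! ### Coordinates -/

section Coordinates

variable (k : Type*) [Field k] (W : Type*) [AddCommGroup W] [Module k W] [FiniteDimensional k W]

/-- Polynomials in the coordinates with respect to a basis, as polynomials in linear forms. -/
def fromCoord : MvPolynomial (Fin (finrank k W)) k →ₐ[k] MvPolynomial (Dual k W) k :=
  MvPolynomial.rename fun i => (finBasis k W).coord i

/-- Polynomials in linear forms, as polynomials in the coordinates with respect to a basis. -/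
def toCoord : MvPolynomial (Dual k W) k →ₐ[k] MvPolynomial (Fin (finrank k W)) k :=
  MvPolynomial.aeval fun f => ∑ i, MvPolynomial.C (f (finBasis k W i)) * MvPolynomial.X i

variable {k W}

theorem polyEval_fromCoord (q : MvPolynomial (Fin (finrank k W)) k) (w : W) :
    polyEval (fromCoord k W q) w = MvPolynomial.eval (fun i => (finBasis k W).repr w i) q := by
  unfold polyEval fromCoord
  rw [MvPolynomial.eval_rename]
  rfl

theorem eval_toCoord (p : MvPolynomial (Dual k W) k) (w : W) :
    MvPolynomial.eval (fun i => (finBasis k W).repr w i) (toCoord k W p) = polyEval p w := by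
  unfold polyEval toCoord
  induction p using MvPolynomial.induction_on with
  | C a => simp
  | add p q hp hq => simp only [map_add, hp, hq]
  | mul_X p f hp =>
    simp only [map_mul, hp, MvPolynomial.aeval_X, MvPolynomial.eval_X, map_sum,
      MvPolynomial.eval_C]
    congr 1
    conv_rhs => rw [← (finBasis k W).sum_repr w, map_sum]
    exact Finset.sum_congr rfl fun i _ => by rw [map_smul, smul_eq_mul, mul_comm]

/-- With all linear forms as variables the polynomial ring is in general not Noetherian. Modulo any
vanishing ideal it reduces to finitely many coordinates; all finiteness statements rest on this. -/
theorem sub_fromCoord_toCoord_mem (Z : Set (ℙ k W)) (p : MvPolynomial (Dual k W) k) :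
    p - fromCoord k W (toCoord k W p) ∈ vanI Z := by
  intro w _
  rw [polyEval_sub, polyEval_fromCoord, eval_toCoord, sub_self]

theorem isHomogeneous_toCoord {p : MvPolynomial (Dual k W) k} {d : ℕ} (hp : p.IsHomogeneous d) :
    (toCoord k W p).IsHomogeneous d := by
  have := hp.aeval (n := 1) (fun f : Dual k W => ∑ i, MvPolynomial.C (f (finBasis k W i)) *
    (MvPolynomial.X i : MvPolynomial (Fin (finrank k W)) k)) (fun f =>
      MvPolynomial.IsHomogeneous.sum _ _ _ fun i _ => MvPolynomial.isHomogeneous_C_mul_X _ _)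
  rwa [one_mul] at this

/-- The Zariski topology is Noetherian. -/
instance noetherianSpace_projectivization [Infinite k] :
    TopologicalSpace.NoetherianSpace (ℙ k W) := by
  rw [show TopologicalSpace.NoetherianSpace (ℙ k W) ↔ _ from
    (TopologicalSpace.noetherianSpace_TFAE (ℙ k W)).out 0 1]
  let F : TopologicalSpace.Closeds (ℙ k W) → (Ideal (MvPolynomial (Fin (finrank k W)) k))ᵒᵈ :=
    fun Z => OrderDual.toDual ((vanI (Z : Set (ℙ k W))).comap (fromCoord k W))
  have hF : StrictMono F := by
    intro Z Y hZY
    refine lt_of_le_of_ne (Ideal.comap_mono (vanI_anti hZY.le)) fun h => hZY.ne ?_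
    have h' : (vanI (Z : Set (ℙ k W))).comap (fromCoord k W)
      = (vanI (Y : Set (ℙ k W))).comap (fromCoord k W) := h
    have key : ∀ (A : Set (ℙ k W)) p, p ∈ vanI A ↔
        toCoord k W p ∈ (vanI A).comap (fromCoord k W) := by
      intro A p
      rw [Ideal.mem_comap]
      have h1 := sub_fromCoord_toCoord_mem A p
      exact ⟨fun h => by simpa using Ideal.sub_mem _ h h1,
        fun h => by simpa using Ideal.add_mem _ h1 h⟩
    exact TopologicalSpace.Closeds.ext (eq_of_vanI_eq Z.isClosed Y.isClosed
      (Ideal.ext fun p => by rw [key, h', ← key]))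
  exact hF.wellFoundedLT

end Coordinates

end

noncomputable section

/-! ### Transcendence degrees -/

section TranscendenceDegree

variable {k : Type*} [Field k] {A : Type*} [CommRing A] [IsDomain A] [Algebra k A]
  {B : Type*} [CommRing B] [IsDomain B] [Algebra k B]

variable (k A) in
/-- The transcendence degree as a natural number. -/
def tdeg : ℕ := Cardinal.toNat (Algebra.trdeg k A)

theorem tdeg_eq_of_isTranscendenceBasis {s : Set A}
    (hs : IsTranscendenceBasis k ((↑) : s → A)) : tdeg k A = s.ncard := by
  rw [tdeg, ← hs.cardinalMk_eq_trdeg]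
  rfl

variable (k A) in
theorem exists_finite_isTranscendenceBasis [Algebra.FiniteType k A] :
    ∃ s : Set A, s.Finite ∧ IsTranscendenceBasis k ((↑) : s → A) ∧ s.ncard = tdeg k A := by
  obtain ⟨s, hs⟩ := exists_isTranscendenceBasis k A
  have hfin : s.Finite := by
    have := trdeg_lt_aleph0_of_finiteType (R := k) (S := A)
    rw [← hs.cardinalMk_eq_trdeg] at this
    exact Cardinal.lt_aleph0_iff_set_finite.1 this
  exact ⟨s, hfin, hs, (tdeg_eq_of_isTranscendenceBasis hs).symm⟩

theorem tdeg_le_ncard {s : Set A} (hfin : s.Finite) {G : Set A} (hG : Algebra.adjoin k G = ⊤)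
    (h : ∀ g ∈ G, IsAlgebraic (Algebra.adjoin k s) g) : tdeg k A ≤ s.ncard := by
  have : Algebra.IsAlgebraic (Algebra.adjoin k s) A := by
    refine ⟨fun a => ?_⟩
    have h1 : (⊤ : Subalgebra k A) ≤
        (Subalgebra.algebraicClosure (Algebra.adjoin k s) A).restrictScalars k := by
      rw [← hG]
      exact Algebra.adjoin_le h
    exact h1 (x := a) trivial
  have h2 := Algebra.IsAlgebraic.trdeg_le_cardinalMk k s
  have : Cardinal.toNat (Algebra.trdeg k A) ≤ Cardinal.toNat (Cardinal.mk s) :=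
    Cardinal.toNat_le_toNat h2 (Cardinal.lt_aleph0_iff_set_finite.2 hfin)
  exact this

/-- If a domain is generated by elements that are algebraic over the subalgebra generated by the
image of another domain and a finite set, its transcendence degree is bounded accordingly. -/
theorem tdeg_le_add [Algebra.FiniteType k B] (φ : B →ₐ[k] A) (hφ : Function.Injective φ)
    {s : Set A} (hfin : s.Finite) {G : Set A} (hG : Algebra.adjoin k G = ⊤)
    (h : ∀ g ∈ G, IsAlgebraic (Algebra.adjoin k (Set.range φ ∪ s)) g) :
    tdeg k A ≤ tdeg k B + s.ncard := by
  obtain ⟨t, htfin, ht, htcard⟩ := exists_finite_isTranscendenceBasis k B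
  have hb : ∀ b : B, IsAlgebraic (Algebra.adjoin k (φ '' t)) (φ b) := by
    intro b
    have h1 : IsAlgebraic (Algebra.adjoin k t) b := by
      have := ht.isAlgebraic.isAlgebraic b
      rwa [Subtype.range_val] at this
    have hle : ∀ x : Algebra.adjoin k t, φ x ∈ Algebra.adjoin k (φ '' t) := by
      intro x
      rw [← AlgHom.map_adjoin]
      exact ⟨x, x.2, rfl⟩
    let f : Algebra.adjoin k t →+* Algebra.adjoin k (φ '' t) :=
      ((φ.toRingHom.comp (Algebra.adjoin k t).val.toRingHom)).codRestrict
        (Algebra.adjoin k (φ '' t)) hle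
    refine h1.ringHom_of_comp_eq f φ (fun x y hxy => Subtype.ext (hφ ?_)) rfl
    exact congrArg Subtype.val hxy
  refine (tdeg_le_ncard (s := φ '' t ∪ s) ((htfin.image φ).union hfin) hG
    fun g hg => ?_).trans ?_
  · refine (h g hg).adjoin_of_forall_isAlgebraic fun x hx => ?_
    rcases hx.1 with ⟨b, rfl⟩ | hxs
    · exact (hb b).tower_top_of_subalgebra_le (Algebra.adjoin_mono Set.subset_union_left)
    · exact (hx.2 (Or.inr hxs)).elim
  · rw [← htcard]
    refine (Set.ncard_union_le _ _).trans ?_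
    exact Nat.add_le_add_right (Set.ncard_image_le htfin) _

omit [IsDomain A] in
theorem isAlgebraic_of_mul_mem {C : Subalgebra k A} {g c b : A} (hc : c ∈ C) (hc0 : c ≠ 0)
    (hb : b ∈ C) (h : c * g = b) : IsAlgebraic C g := by
  refine ⟨Polynomial.C (⟨c, hc⟩ : C) * Polynomial.X - Polynomial.C ⟨b, hb⟩, fun h0 => ?_, ?_⟩
  · have := congrArg (fun p => Polynomial.coeff p 1) h0
    simp [Polynomial.coeff_C] at this
    exact hc0 (congrArg Subtype.val this)
  · simp only [map_sub, map_mul, Polynomial.aeval_C, Polynomial.aeval_X]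
    exact sub_eq_zero.2 h

/-- A proper quotient domain has smaller transcendence degree. -/
theorem tdeg_lt_of_surjective [Algebra.FiniteType k A] [Algebra.FiniteType k B] (π : A →ₐ[k] B)
    (hπ : Function.Surjective π) (hker : ∃ a, a ≠ 0 ∧ π a = 0) : tdeg k B < tdeg k A := by
  obtain ⟨t, htfin, ht, htcard⟩ := exists_finite_isTranscendenceBasis k B
  have := htfin.to_subtype
  choose g hg using hπ
  let z : t → A := fun x => g x
  have hπz : ∀ p : MvPolynomial t k, π (MvPolynomial.aeval z p) =
      MvPolynomial.aeval ((↑) : t → B) p := by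
    intro p
    rw [← AlgHom.comp_apply, MvPolynomial.comp_aeval]
    congr 2
    funext x
    exact hg x
  have hz : AlgebraicIndependent k z := by
    rw [algebraicIndependent_iff]
    intro p hp
    exact ht.1.eq_zero_of_aeval_eq_zero p (by rw [← hπz, hp, map_zero])
  by_contra hlt
  rw [not_lt] at hlt
  have hA : (tdeg k A : Cardinal) = Algebra.trdeg k A :=
    Cardinal.cast_toNat_of_lt_aleph0 trdeg_lt_aleph0_of_finiteType
  -- Lifts of a transcendence basis of `B` are algebraically independent. If the degree did not
  -- drop, they would be a transcendence basis of `A`.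
  have hzb : IsTranscendenceBasis k z := by
    refine hz.isTranscendenceBasis_of_lift_trdeg_le_of_finite ?_
    rw [← hA, ← Set.cast_ncard htfin, Cardinal.lift_natCast, Cardinal.lift_natCast, htcard]
    exact_mod_cast hlt
  obtain ⟨a, ha0, ha⟩ := hker
  -- An algebraic nonzero element `a` divides a nonzero polynomial in the lifts. Since `π a = 0`,
  -- this becomes a relation between the basis elements of `B`.
  obtain ⟨c, hc0, hc⟩ := (hzb.isAlgebraic.isAlgebraic a).exists_nonzero_dvd
    (mem_nonZeroDivisors_of_ne_zero ha0)
  obtain ⟨c, hcm⟩ := c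
  rw [Algebra.adjoin_range_eq_range_aeval] at hcm
  obtain ⟨p, rfl⟩ := hcm
  obtain ⟨b, hb⟩ := hc
  have h1 : π (MvPolynomial.aeval z p) = 0 := by
    have : MvPolynomial.aeval z p = a * b := hb
    rw [this, map_mul, ha, zero_mul]
  rw [hπz] at h1
  have := ht.1.eq_zero_of_aeval_eq_zero p h1
  subst this
  exact hc0 (Subtype.ext (map_zero _))

end TranscendenceDegree

end

noncomputable section

/-! ### The projective Nullstellensatz for sections by linear subspaces -/

section Nullstellensatz

variable {k : Type*} [Field k] {W : Type*} [AddCommGroup W] [Module k W]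

theorem degree_eq_of_mem_support {σ : Type*} {p : MvPolynomial σ k} {d : ℕ}
    (hp : p.IsHomogeneous d) {m : σ →₀ ℕ} (hm : m ∈ p.support) : Finsupp.degree m = d := by
  by_contra h
  exact MvPolynomial.mem_support_iff.1 hm (hp.coeff_eq_zero h)

theorem homogeneousComponent_mul_X {σ : Type*} (p : MvPolynomial σ k) (i : σ) (d : ℕ) :
    MvPolynomial.homogeneousComponent (d + 1) (p * MvPolynomial.X i) =
      MvPolynomial.homogeneousComponent d p * MvPolynomial.X i := by
  classical
  conv_lhs => rw [← MvPolynomial.sum_homogeneousComponent p, Finset.sum_mul, map_sum]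
  have h : ∀ j, MvPolynomial.homogeneousComponent (d + 1)
      (MvPolynomial.homogeneousComponent j p * MvPolynomial.X i) =
      if j = d then MvPolynomial.homogeneousComponent d p * MvPolynomial.X i else 0 := by
    intro j
    have h1 : (MvPolynomial.homogeneousComponent j p * MvPolynomial.X i).IsHomogeneous (j + 1) :=
      (MvPolynomial.homogeneousComponent_isHomogeneous j p).mul (MvPolynomial.isHomogeneous_X k i)
    rw [MvPolynomial.homogeneousComponent_of_mem h1]
    by_cases hj : j = d
    · subst hj; simp
    · rw [if_neg hj, if_neg (by omega)]
  rw [Finset.sum_congr rfl fun j _ => h j, Finset.sum_ite_eq']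
  split_ifs with hd
  · rfl
  · rw [MvPolynomial.homogeneousComponent_eq_zero _ _
      (by simpa [Nat.lt_succ_iff] using hd), zero_mul]

/-- In positive degree, a homogeneous element of the ideal generated by the vanishing ideal and by
linear forms is, modulo the vanishing ideal, a combination of multiples of these forms by
homogeneous polynomials. -/
theorem exists_sub_mem_vanI [Infinite k] {Z : Set (ℙ k W)} {ι : Type*} (l : ι → Dual k W) {d : ℕ}
    {p : MvPolynomial (Dual k W) k} (hp : p.IsHomogeneous (d + 1))
    (h : p ∈ vanI Z ⊔ Ideal.span (Set.range fun i => MvPolynomial.X (l i))) :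
    ∃ q ∈ Submodule.span k {q | ∃ (i : ι) (c : MvPolynomial (Dual k W) k), c.IsHomogeneous d ∧
      q = c * MvPolynomial.X (l i)}, p - q ∈ vanI Z := by
  obtain ⟨u, hu, v, hv, huv⟩ := Submodule.mem_sup.1 h
  refine ⟨MvPolynomial.homogeneousComponent (d + 1) v, ?_, ?_⟩
  · obtain ⟨c, rfl⟩ := Finsupp.mem_ideal_span_range_iff_exists_finsupp.1 hv
    rw [Finsupp.sum, map_sum]
    refine Submodule.sum_mem _ fun i _ => Submodule.subset_span ?_
    exact ⟨i, _, MvPolynomial.homogeneousComponent_isHomogeneous d (c i),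
      homogeneousComponent_mul_X _ _ _⟩
  · have := homogeneousComponent_mem_vanI hu (d + 1)
    rw [← MvPolynomial.homogeneousComponent_eq_self hp, ← huv, map_add, add_sub_cancel_right]
    exact this

/-- In coordinates, the ideal generated by the equations of `Z` and the forms `l i` has no zero
other than possibly the origin. By the Nullstellensatz it contains a power of the irrelevant ideal.
-/
theorem exists_degree_mem_sup [IsAlgClosed k] [FiniteDimensional k W] {Z : Set (ℙ k W)}
    (hZ : IsClosed Z) {ι : Type*} (l : ι → Dual k W) (h : ∀ w ∈ cone Z, ∃ i, l i w ≠ 0) :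
    ∃ D, ∀ d ≥ D, ∀ p : MvPolynomial (Dual k W) k, p.IsHomogeneous d →
      p ∈ vanI Z ⊔ Ideal.span (Set.range fun i => MvPolynomial.X (l i)) := by
  set I := vanI Z ⊔ Ideal.span (Set.range fun i => MvPolynomial.X (l i)) with hI
  let I' := I.comap (fromCoord k W)
  have hto : ∀ p, p ∈ I → toCoord k W p ∈ I' := by
    intro p hp
    have h1 : p - fromCoord k W (toCoord k W p) ∈ I :=
      Ideal.mem_sup_left (sub_fromCoord_toCoord_mem Z p)
    have := Ideal.sub_mem _ hp h1
    rwa [sub_sub_cancel] at this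
  have hzero : ∀ x ∈ MvPolynomial.zeroLocus k I', x = 0 := by
    intro x hx
    let w : W := (finBasis k W).equivFun.symm x
    have hwx : (fun i => (finBasis k W).repr w i) = x := (finBasis k W).equivFun.apply_symm_apply x
    have hev : ∀ p ∈ I, polyEval p w = 0 := by
      intro p hp
      have := hx _ (hto p hp)
      rwa [← hwx, MvPolynomial.aeval_eq_eval, eval_toCoord] at this
    by_contra hx0
    have hw0 : w ≠ 0 := fun hw => hx0 ((finBasis k W).equivFun.symm.map_eq_zero_iff.1 hw)
    have hwZ : w ∈ cone Z := (mem_cone_of_isClosed hZ hw0).2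
      fun p hp => hev p (Ideal.mem_sup_left hp)
    obtain ⟨i, hi⟩ := h w hwZ
    refine hi ?_
    have := hev (MvPolynomial.X (l i))
      (Ideal.mem_sup_right (Ideal.subset_span ⟨i, rfl⟩))
    rwa [polyEval_X] at this
  have hrad : MvPolynomial.idealOfVars (Fin (finrank k W)) k ≤ I'.radical := by
    rw [← MvPolynomial.vanishingIdeal_zeroLocus_eq_radical (K := k), MvPolynomial.idealOfVars,
      Ideal.span_le]
    rintro _ ⟨i, rfl⟩ x hx
    rw [hzero x hx]
    simp
  obtain ⟨D, hD⟩ := Ideal.exists_pow_le_of_le_radical_of_fg hrad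
    (MvPolynomial.idealOfVars_fg _ _)
  refine ⟨D, fun d hd p hp => ?_⟩
  have h1 : toCoord k W p ∈ I' := by
    refine hD ((MvPolynomial.mem_pow_idealOfVars_iff _ _).2 fun m hm => ?_)
    have := degree_eq_of_mem_support (isHomogeneous_toCoord hp) hm
    omega
  have h2 : p - fromCoord k W (toCoord k W p) ∈ I :=
    Ideal.mem_sup_left (sub_fromCoord_toCoord_mem Z p)
  have := Ideal.add_mem _ h2 h1
  rwa [sub_add_cancel] at this

end Nullstellensatz

/-! ### The dimension of the cone over an irreducible set -/

section ConeDim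

variable {k : Type*} [Field k] {W : Type*} [AddCommGroup W] [Module k W]

/-- The homogeneous coordinate ring of a set of lines. -/
abbrev coordRing (Z : Set (ℙ k W)) : Type _ := MvPolynomial (Dual k W) k ⧸ vanI Z

/-- The class of a polynomial in the homogeneous coordinate ring. -/
abbrev toRing (Z : Set (ℙ k W)) : MvPolynomial (Dual k W) k →ₐ[k] coordRing Z :=
  Ideal.Quotient.mkₐ k (vanI Z)

/-- The class of a linear form in the homogeneous coordinate ring. -/
def formClass (Z : Set (ℙ k W)) (f : Dual k W) : coordRing Z :=
  toRing Z (MvPolynomial.X f)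

/-- The transcendence degree of the homogeneous coordinate ring; for an irreducible closed set this
is the dimension of its cone. -/
def coneDim (Z : Set (ℙ k W)) : ℕ := tdeg k (coordRing Z)

theorem toRing_eq_zero {Z : Set (ℙ k W)} {p : MvPolynomial (Dual k W) k} :
    toRing Z p = 0 ↔ ∀ w ∈ cone Z, polyEval p w = 0 :=
  Ideal.Quotient.eq_zero_iff_mem

theorem formClass_eq_zero {Z : Set (ℙ k W)} {f : Dual k W} :
    formClass Z f = 0 ↔ ∀ w ∈ cone Z, f w = 0 := by
  rw [formClass, toRing_eq_zero]
  simp only [polyEval_X]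

theorem adjoin_formClass (Z : Set (ℙ k W)) :
    Algebra.adjoin k (Set.range (formClass Z)) = ⊤ := by
  rw [eq_top_iff]
  rintro x -
  obtain ⟨p, rfl⟩ := Ideal.Quotient.mkₐ_surjective k (vanI Z) x
  have h1 : p ∈ Algebra.adjoin k (Set.range (MvPolynomial.X (R := k) (σ := Dual k W))) := by
    rw [MvPolynomial.adjoin_range_X]; trivial
  have h2 : Ideal.Quotient.mkₐ k (vanI Z) p ∈ (Algebra.adjoin k
      (Set.range (MvPolynomial.X (R := k) (σ := Dual k W)))).map (toRing Z) := ⟨p, h1, rfl⟩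
  rw [AlgHom.map_adjoin, ← Set.range_comp] at h2
  exact h2

theorem formClass_mul_eq {Z : Set (ℙ k W)} {f g f' g' : Dual k W}
    (h : ∀ w ∈ cone Z, f w * g w = f' w * g' w) :
    formClass Z f * formClass Z g = formClass Z f' * formClass Z g' := by
  rw [← sub_eq_zero]
  simp only [formClass, ← map_mul, ← map_sub]
  rw [toRing_eq_zero]
  intro w hw
  simp [h w hw]

theorem formClass_add (Z : Set (ℙ k W)) (f g : Dual k W) :
    formClass Z (f + g) = formClass Z f + formClass Z g := by
  rw [← sub_eq_zero]
  simp only [formClass, ← map_add, ← map_sub]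
  rw [toRing_eq_zero]
  intro w hw
  simp

theorem formClass_smul (Z : Set (ℙ k W)) (c : k) (f : Dual k W) :
    formClass Z (c • f) = c • formClass Z f := by
  rw [← sub_eq_zero]
  simp only [formClass, ← map_smul, ← map_sub]
  rw [toRing_eq_zero]
  intro w hw
  simp [MvPolynomial.smul_eq_C_mul]

theorem isDomain_coordRing [Infinite k] {Z : Set (ℙ k W)} (hZ : IsIrreducible Z) :
    IsDomain (coordRing Z) :=
  have := vanI_isPrime hZ
  Ideal.Quotient.isDomain (vanI Z)

instance finiteType_coordRing [FiniteDimensional k W] (Z : Set (ℙ k W)) :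
    Algebra.FiniteType k (coordRing Z) := by
  refine Algebra.FiniteType.of_surjective ((toRing Z).comp (fromCoord k W)) fun x => ?_
  obtain ⟨p, rfl⟩ := Ideal.Quotient.mkₐ_surjective k (vanI Z) x
  refine ⟨toCoord k W p, ?_⟩
  exact (Ideal.Quotient.eq.2 (sub_fromCoord_toCoord_mem Z p)).symm

/-- Restriction of functions from `X` to `Z` is surjective on coordinate rings, and its kernel is
nonzero because closed sets are determined by their vanishing ideals. -/
theorem coneDim_lt [Infinite k] [FiniteDimensional k W] {Z X : Set (ℙ k W)} (hZ : IsIrreducible Z)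
    (hX : IsIrreducible X) (hZc : IsClosed Z) (hXc : IsClosed X) (h : Z ⊂ X) :
    coneDim Z < coneDim X := by
  have := isDomain_coordRing hZ
  have := isDomain_coordRing hX
  refine tdeg_lt_of_surjective (Ideal.Quotient.factorₐ k (vanI_anti h.subset))
    (Ideal.Quotient.factor_surjective (vanI_anti h.subset)) ?_
  have hne : ¬ vanI Z ≤ vanI X := fun hle =>
    h.ne (eq_of_vanI_eq hZc hXc (le_antisymm hle (vanI_anti h.subset)))
  obtain ⟨p, hp, hpX⟩ := SetLike.not_le_iff_exists.1 hne
  exact ⟨toRing X p, fun h0 => hpX (Ideal.Quotient.eq_zero_iff_mem.1 h0),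
    Ideal.Quotient.eq_zero_iff_mem.2 hp⟩

theorem coneDim_mono [Infinite k] [FiniteDimensional k W] {Z X : Set (ℙ k W)}
    (hZ : IsIrreducible Z) (hX : IsIrreducible X) (hZc : IsClosed Z) (hXc : IsClosed X)
    (h : Z ⊆ X) : coneDim Z ≤ coneDim X := by
  rcases h.eq_or_ssubset with rfl | h
  · exact le_rfl
  · exact (coneDim_lt hZ hX hZc hXc h).le

/-- If the degree were zero, the coordinate ring would be `k` itself, so every linear form would be
constant on the cone. Scaling by some `t ≠ 0, 1` contradicts this where a form is nonzero. -/
theorem coneDim_pos [IsAlgClosed k] [FiniteDimensional k W] {Z : Set (ℙ k W)}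
    (hZ : IsIrreducible Z) : 0 < coneDim Z := by
  have := isDomain_coordRing hZ
  rw [Nat.pos_iff_ne_zero]
  intro h0
  have htr : Algebra.trdeg k (coordRing Z) = 0 := by
    rcases Cardinal.toNat_eq_zero.1 h0 with h | h
    · exact h
    · exact absurd (trdeg_lt_aleph0_of_finiteType (R := k) (S := coordRing Z)) (not_lt.2 h)
  have halg : Algebra.IsAlgebraic k (coordRing Z) := trdeg_eq_zero_iff.1 htr
  have hbij := IsAlgClosed.algebraMap_bijective_of_isIntegral (k := k) (K := coordRing Z)
  obtain ⟨x, hx⟩ := hZ.nonempty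
  have hxc := rep_mem_cone.2 hx
  obtain ⟨f, hf⟩ : ∃ f : Dual k W, f x.rep ≠ 0 := by
    by_contra! hcon
    exact x.rep_nonzero ((Module.forall_dual_apply_eq_zero_iff k _).1 hcon)
  obtain ⟨c, hc⟩ := hbij.2 (formClass Z f)
  have hval : ∀ w ∈ cone Z, f w = c := by
    intro w hw
    have h1 : toRing Z (MvPolynomial.X f - MvPolynomial.C c) = 0 := by
      rw [map_sub, sub_eq_zero]
      exact hc.symm
    have := toRing_eq_zero.1 h1 w hw
    simpa [sub_eq_zero] using this
  obtain ⟨t, ht⟩ := Set.Infinite.nonempty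
    (Set.Finite.infinite_compl (Set.toFinite ({0, 1} : Set k)))
  simp only [Set.mem_compl_iff, Set.mem_insert_iff, Set.mem_singleton_iff, not_or] at ht
  have h1 := hval _ (smul_mem_cone hxc ht.1)
  rw [map_smul, smul_eq_mul, ← hval _ hxc] at h1
  exact ht.2 (mul_right_cancel₀ hf (h1.trans (one_mul _).symm))

/-- If `r` linear forms have no common zero on an irreducible closed set, then its cone has
dimension at most `r`. -/
theorem coneDim_le_of_forms [IsAlgClosed k] [FiniteDimensional k W] {Z : Set (ℙ k W)}
    (hZ : IsIrreducible Z) (hZc : IsClosed Z) {r : ℕ} (l : Fin r → Dual k W)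
    (h : ∀ w ∈ cone Z, ∃ i, l i w ≠ 0) : coneDim Z ≤ r := by
  have := isDomain_coordRing hZ
  obtain ⟨D, hD⟩ := exists_degree_mem_sup hZc l h
  let s : Set (coordRing Z) := Set.range fun i => formClass Z (l i)
  let B := Algebra.adjoin k s
  -- Beyond degree `D` every form is a combination of multiples of the `l i`, so the monomials of
  -- degree at most `D` generate the coordinate ring as a module over the subalgebra of the `l i`.
  -- Finiteness makes this extension integral.
  let F : Set (coordRing Z) := (fun m : Fin (finrank k W) →₀ ℕ =>
    toRing Z (fromCoord k W (MvPolynomial.monomial m 1))) '' {m | Finsupp.degree m < D + 1}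
  have hF : F.Finite := (Finsupp.finite_of_degree_lt _).image _
  let M : Submodule B (coordRing Z) := Submodule.span B F
  have key : ∀ d, ∀ p : MvPolynomial (Dual k W) k, p.IsHomogeneous d → toRing Z p ∈ M := by
    intro d
    induction d using Nat.strong_induction_on with
    | _ d ih =>
    intro p hp
    by_cases hd : d < D + 1
    · have h1 : toRing Z p = toRing Z (fromCoord k W (toCoord k W p)) :=
        Ideal.Quotient.eq.2 (sub_fromCoord_toCoord_mem Z p)
      rw [h1, (toCoord k W p).as_sum, map_sum, map_sum]
      refine Submodule.sum_mem _ fun m hm => ?_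
      have hdeg := degree_eq_of_mem_support (isHomogeneous_toCoord hp) hm
      have h2 : MvPolynomial.monomial m (MvPolynomial.coeff m (toCoord k W p)) =
          MvPolynomial.coeff m (toCoord k W p) • MvPolynomial.monomial m 1 := by
        rw [MvPolynomial.smul_monomial, smul_eq_mul, mul_one]
      rw [h2, map_smul, map_smul]
      exact M.smul_of_tower_mem _ (Submodule.subset_span ⟨m, by simp only [Set.mem_ofPred_eq]; omega, rfl⟩)
    · obtain ⟨e, rfl⟩ : ∃ e, d = e + 1 := ⟨d - 1, by omega⟩
      obtain ⟨q, hq, hpq⟩ := exists_sub_mem_vanI l hp (hD (e + 1) (by omega) p hp)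
      rw [show toRing Z p = toRing Z q from Ideal.Quotient.eq.2 hpq]
      clear hpq
      induction hq using Submodule.span_induction with
      | mem q hq =>
        obtain ⟨i, c, hc, rfl⟩ := hq
        rw [map_mul, mul_comm]
        exact M.smul_mem ⟨formClass Z (l i), Algebra.subset_adjoin ⟨i, rfl⟩⟩
          (ih e (Nat.lt_succ_self e) c hc)
      | zero => rw [map_zero]; exact M.zero_mem
      | add x y _ _ hx hy => rw [map_add]; exact M.add_mem hx hy
      | smul c x _ hx => rw [map_smul]; exact M.smul_of_tower_mem _ hx
  have hM : M = ⊤ := by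
    rw [eq_top_iff]
    rintro x -
    obtain ⟨p, rfl⟩ := Ideal.Quotient.mkₐ_surjective k (vanI Z) x
    rw [← MvPolynomial.sum_homogeneousComponent p, map_sum]
    exact Submodule.sum_mem _ fun i _ =>
      key i _ (MvPolynomial.homogeneousComponent_isHomogeneous i p)
  have hfin : Module.Finite B (coordRing Z) := ⟨⟨hF.toFinset, by rw [hF.coe_toFinset]; exact hM⟩⟩
  have hint : Algebra.IsIntegral B (coordRing Z) := Algebra.IsIntegral.of_finite B (coordRing Z)
  refine (tdeg_le_ncard (Set.finite_range _) (adjoin_formClass Z)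
    (fun g _ => (hint.isIntegral g).isAlgebraic)).trans ?_
  rw [← Set.image_univ]
  refine (Set.ncard_image_le Set.finite_univ).trans ?_
  simp

end ConeDim

end

noncomputable section

/-! ### Linear subspaces and hyperplane sections -/

section Linear

variable {k : Type*} [Field k] {W : Type*} [AddCommGroup W] [Module k W]

/-- The projective space of a linear subspace. -/
def linSet (K : Submodule k W) : Set (ℙ k W) := {x | x.rep ∈ K}

theorem mem_cone_linSet {K : Submodule k W} {w : W} : w ∈ cone (linSet K) ↔ w ≠ 0 ∧ w ∈ K := by
  constructor
  · rintro ⟨hw, h⟩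
    obtain ⟨c, hc, hrep⟩ := exists_smul_rep_mk (k := k) hw
    refine ⟨hw, ?_⟩
    have h' : (Projectivization.mk k w hw).rep ∈ K := h
    rwa [hrep, K.smul_mem_iff hc] at h'
  · rintro ⟨hw, h⟩
    refine ⟨hw, ?_⟩
    obtain ⟨c, hc, hrep⟩ := exists_smul_rep_mk (k := k) hw
    show (Projectivization.mk k w hw).rep ∈ K
    rw [hrep]
    exact K.smul_mem c h

theorem isClosed_linSet [FiniteDimensional k W] (K : Submodule k W) : IsClosed (linSet K) := by
  refine isClosed_of_polys {p | ∃ f ∈ K.dualAnnihilator, p = MvPolynomial.X f} ?_ fun x => ?_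
  · rintro _ ⟨f, -, rfl⟩
    exact ⟨1, MvPolynomial.isHomogeneous_X k f⟩
  · constructor
    · rintro hx _ ⟨f, hf, rfl⟩
      rw [polyEval_X]
      exact (Submodule.mem_dualAnnihilator f).1 hf _ hx
    · intro h
      have : x.rep ∈ K.dualAnnihilator.dualCoannihilator := by
        rw [Submodule.mem_dualCoannihilator]
        intro f hf
        simpa using h _ ⟨f, hf, rfl⟩
      rwa [Subspace.dualAnnihilator_dualCoannihilator_eq] at this

theorem exists_dual_ne_zero {w : W} (hw : w ≠ 0) : ∃ f : Dual k W, f w ≠ 0 := by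
  by_contra! hcon
  exact hw ((Module.forall_dual_apply_eq_zero_iff k _).1 hcon)

variable [IsAlgClosed k] [FiniteDimensional k W]

/-- Finitely many irreducible closed sets whose cones have dimension at most `m` are avoided by a
common linear subspace of codimension `m`. -/
theorem exists_forms_forall_ne_zero (m : ℕ) : ∀ 𝒵 : Set (Set (ℙ k W)), 𝒵.Finite →
    (∀ Z ∈ 𝒵, IsIrreducible Z ∧ IsClosed Z ∧ coneDim Z ≤ m) →
    ∃ l : Fin m → Dual k W, ∀ Z ∈ 𝒵, ∀ w ∈ cone Z, ∃ i, l i w ≠ 0 := by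
  induction m with
  | zero =>
    intro 𝒵 _ h
    refine ⟨Fin.elim0, fun Z hZ => ?_⟩
    obtain ⟨h1, -, h3⟩ := h Z hZ
    exact absurd (coneDim_pos h1) (by omega)
  | succ m ih =>
    intro 𝒵 hfin h
    have := hfin.to_subtype
    choose x hx using fun Z : 𝒵 => (h Z Z.2).1.nonempty
    -- One form nonzero at a chosen point of each set cuts all of them properly, so the components
    -- of the sections have smaller dimension and the induction applies to them.
    obtain ⟨f, hf⟩ := Module.exists_dual_forall_apply_ne_zero (K := k)
      (fun Z : 𝒵 => (x Z).rep) fun Z => (x Z).rep_nonzero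
    have hcl : ∀ Z : 𝒵, IsClosed ((Z : Set (ℙ k W)) ∩ linSet (LinearMap.ker f)) :=
      fun Z => (h Z Z.2).2.1.inter (isClosed_linSet _)
    choose C hCfin hCcl hCirr hCeq using fun Z : 𝒵 =>
      TopologicalSpace.NoetherianSpace.exists_finite_set_isClosed_irreducible (hcl Z)
    obtain ⟨l, hl⟩ := ih (⋃ Z : 𝒵, C Z) (Set.finite_iUnion hCfin) (by
      intro Y hY
      obtain ⟨Z, hYZ⟩ := Set.mem_iUnion.1 hY
      refine ⟨hCirr Z Y hYZ, hCcl Z Y hYZ, ?_⟩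
      have hsub : Y ⊆ (Z : Set (ℙ k W)) ∩ linSet (LinearMap.ker f) := by
        rw [hCeq Z]; exact Set.subset_sUnion_of_mem hYZ
      have hss : Y ⊂ Z := by
        refine ⟨hsub.trans Set.inter_subset_left, fun hZY => ?_⟩
        exact hf Z (hsub (hZY (hx Z))).2
      obtain ⟨h1, h2, h3⟩ := h Z Z.2
      have := coneDim_lt (hCirr Z Y hYZ) h1 (hCcl Z Y hYZ) h2 hss
      omega)
    refine ⟨Fin.cons f l, fun Z hZ w hw => ?_⟩
    by_cases hfw : f w = 0
    · have hmem : Projectivization.mk k w hw.1 ∈ ⋃₀ C ⟨Z, hZ⟩ := by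
        rw [← hCeq]
        exact ⟨hw.2, (mem_cone_linSet.2 ⟨hw.1, hfw⟩).2⟩
      obtain ⟨Y, hY, hmem⟩ := hmem
      obtain ⟨i, hi⟩ := hl Y (Set.mem_iUnion.2 ⟨_, hY⟩) w ⟨hw.1, hmem⟩
      exact ⟨i.succ, by simpa using hi⟩
    · exact ⟨0, by simpa using hfw⟩

/-- An irreducible closed set of positive dimension contains one of dimension one less. -/
theorem exists_coneDim_succ_eq {X : Set (ℙ k W)} (hX : IsIrreducible X) (hXc : IsClosed X)
    (h : 2 ≤ coneDim X) : ∃ Z, IsIrreducible Z ∧ IsClosed Z ∧ Z ⊂ X ∧ coneDim Z + 1 = coneDim X := by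
  obtain ⟨x, hx⟩ := hX.nonempty
  obtain ⟨f, hf⟩ := exists_dual_ne_zero (k := k) x.rep_nonzero
  obtain ⟨C, hCfin, hCcl, hCirr, hCeq⟩ :=
    TopologicalSpace.NoetherianSpace.exists_finite_set_isClosed_irreducible
      (hXc.inter (isClosed_linSet (LinearMap.ker f)))
  have hss : ∀ Z ∈ C, Z ⊂ X := by
    intro Z hZ
    have hsub : Z ⊆ X ∩ linSet (LinearMap.ker f) := by
      rw [hCeq]; exact Set.subset_sUnion_of_mem hZ
    exact ⟨hsub.trans Set.inter_subset_left, fun hZY => hf (hsub (hZY hx)).2⟩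
  by_contra! hcon
  -- If every component of the hyperplane section had lost at least two dimensions, `coneDim X - 2`
  -- forms would avoid them all. Together with `f` these are too few forms without a common zero on
  -- `X`.
  obtain ⟨l, hl⟩ := exists_forms_forall_ne_zero (coneDim X - 2) C hCfin fun Z hZ => by
    refine ⟨hCirr Z hZ, hCcl Z hZ, ?_⟩
    have h1 := coneDim_lt (hCirr Z hZ) hX (hCcl Z hZ) hXc (hss Z hZ)
    have h2 := hcon Z (hCirr Z hZ) (hCcl Z hZ) (hss Z hZ)
    omega
  have := coneDim_le_of_forms hX hXc (Fin.cons f l : Fin (coneDim X - 2 + 1) → Dual k W)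
    fun w hw => by
      by_cases hfw : f w = 0
      · have hmem : Projectivization.mk k w hw.1 ∈ ⋃₀ C := by
          rw [← hCeq]
          exact ⟨hw.2, (mem_cone_linSet.2 ⟨hw.1, hfw⟩).2⟩
        obtain ⟨Y, hY, hmem⟩ := hmem
        obtain ⟨i, hi⟩ := hl Y hY w ⟨hw.1, hmem⟩
        exact ⟨i.succ, by simpa using hi⟩
      · exact ⟨0, by simpa using hfw⟩
  omega

end Linear

/-! ### The Krull dimension of closed sets -/

section Dimension

variable {k : Type*} [Field k] {W : Type*} [AddCommGroup W] [Module k W]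

theorem zdim_mono {X : Type*} [TopologicalSpace X] {Z Y : Set X} (h : Z ⊆ Y) : zdim Z ≤ zdim Y :=
  (Topology.IsEmbedding.inclusion h).isInducing.topologicalKrullDim_le

/-- The irreducible closed subsets of `X` that are contained in the closed set `Y`, as irreducible
closed subsets of the subspace `Y`. -/
def irreducibleClosedsRestrict {X : Type*} [TopologicalSpace X] (Y : Set X)
    (Z : {Z : TopologicalSpace.IrreducibleCloseds X // (Z : Set X) ⊆ Y}) :
    TopologicalSpace.IrreducibleCloseds Y where
  carrier := Subtype.val ⁻¹' (Z : Set X)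
  isIrreducible' := by
    obtain ⟨⟨x, hx⟩, hpre⟩ := Z.1.isIrreducible
    refine ⟨⟨⟨x, Z.2 hx⟩, hx⟩, ?_⟩
    rintro _ _ ⟨u, hu, rfl⟩ ⟨v, hv, rfl⟩ ⟨y, hyZ, hyu⟩ ⟨z, hzZ, hzv⟩
    obtain ⟨t, htZ, htu, htv⟩ := hpre u v hu hv ⟨y, hyZ, hyu⟩ ⟨z, hzZ, hzv⟩
    exact ⟨⟨t, Z.2 htZ⟩, htZ, htu, htv⟩
  isClosed' := Z.1.isClosed.preimage continuous_subtype_val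

theorem irreducibleClosedsRestrict_strictMono {X : Type*} [TopologicalSpace X] (Y : Set X) :
    StrictMono (irreducibleClosedsRestrict Y) := by
  intro A B hAB
  refine lt_of_le_of_ne (fun x hx => hAB.le hx) fun h => hAB.ne ?_
  refine Subtype.ext (TopologicalSpace.IrreducibleCloseds.ext ?_)
  refine Set.Subset.antisymm hAB.le fun x hx => ?_
  have h' : (irreducibleClosedsRestrict Y A : Set Y) = irreducibleClosedsRestrict Y B := by rw [h]
  have : (⟨x, B.2 hx⟩ : Y) ∈ (irreducibleClosedsRestrict Y A : Set Y) := by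
    rw [h']; exact hx
  exact this

variable [IsAlgClosed k] [FiniteDimensional k W]

/-- Along a strict chain of irreducible closed sets `coneDim` strictly increases, starting from at
least `1`; hence the shift by one. -/
theorem zdim_le {Y : Set (ℙ k W)} (hY : IsClosed Y) {m : ℕ}
    (h : ∀ Z ⊆ Y, IsIrreducible Z → IsClosed Z → coneDim Z ≤ m + 1) : zdim Y ≤ m := by
  refine iSup_le fun p => ?_
  let f : TopologicalSpace.IrreducibleCloseds Y → ℕ := fun Z =>
    coneDim (Subtype.val '' (Z : Set Y))
  have hirr : ∀ Z : TopologicalSpace.IrreducibleCloseds Y,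
      IsIrreducible (Subtype.val '' (Z : Set Y)) := fun Z =>
    Z.isIrreducible.image _ continuous_subtype_val.continuousOn
  have hcl : ∀ Z : TopologicalSpace.IrreducibleCloseds Y,
      IsClosed (Subtype.val '' (Z : Set Y)) := fun Z =>
    hY.isClosedEmbedding_subtypeVal.isClosedMap _ Z.isClosed
  have hf : StrictMono f := by
    intro A B hAB
    refine coneDim_lt (hirr A) (hirr B) (hcl A) (hcl B) ?_
    have hAB' : (A : Set Y) ⊂ B := hAB
    refine ⟨Set.image_mono hAB'.subset, fun hBA => hAB'.not_subset ?_⟩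
    exact (Set.image_subset_image_iff Subtype.val_injective).1 hBA
  have h1 := LTSeries.head_add_length_le_nat (p.map f hf)
  have h2 : 0 < f p.head := coneDim_pos (hirr _)
  have h3 : f p.last ≤ m + 1 := h _ (by rintro _ ⟨y, -, rfl⟩; exact y.2) (hirr _) (hcl _)
  simp only [LTSeries.head_map, LTSeries.last_map, LTSeries.map_length] at h1
  have : p.length ≤ m := by omega
  exact_mod_cast this

/-- A chain of length `m` ending in `X` is built downwards by hyperplane sections, each lowering
`coneDim` by exactly one. -/
theorem le_zdim {Y X : Set (ℙ k W)} (hX : IsIrreducible X) (hXc : IsClosed X) (hXY : X ⊆ Y)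
    {m : ℕ} (h : m + 1 ≤ coneDim X) : (m : WithBot ℕ∞) ≤ zdim Y := by
  have key : ∀ (m : ℕ) (X : Set (ℙ k W)) (hX : IsIrreducible X) (hXc : IsClosed X) (hXY : X ⊆ Y),
      m + 1 ≤ coneDim X → ∃ l : LTSeries {Z : TopologicalSpace.IrreducibleCloseds (ℙ k W) //
        (Z : Set (ℙ k W)) ⊆ Y}, l.length = m ∧ l.last = ⟨⟨X, hX, hXc⟩, hXY⟩ := by
    intro m
    induction m with
    | zero =>
      intro X hX hXc hXY _
      exact ⟨RelSeries.singleton _ ⟨⟨X, hX, hXc⟩, hXY⟩, rfl, rfl⟩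
    | succ m ih =>
      intro X hX hXc hXY h
      obtain ⟨Z, hZ, hZc, hZX, hdim⟩ := exists_coneDim_succ_eq hX hXc (by omega)
      obtain ⟨l, hl, hlast⟩ := ih Z hZ hZc (hZX.subset.trans hXY) (by omega)
      have hrel : l.last < ⟨⟨X, hX, hXc⟩, hXY⟩ := by
        rw [hlast]
        exact hZX
      exact ⟨l.snoc ⟨⟨X, hX, hXc⟩, hXY⟩ hrel, by simp [hl], by simp⟩
  obtain ⟨l, hl, -⟩ := key m X hX hXc hXY h
  have := Order.LTSeries.length_le_krullDim
    (l.map _ (irreducibleClosedsRestrict_strictMono Y))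
  rw [LTSeries.map_length, hl] at this
  exact this

theorem zdim_eq {X : Set (ℙ k W)} (hX : IsIrreducible X) (hXc : IsClosed X) {m : ℕ}
    (h : coneDim X = m + 1) : zdim X = m := by
  refine le_antisymm (zdim_le hXc fun Z hZ hZi hZc => ?_)
    (le_zdim hX hXc subset_rfl h.ge)
  exact (coneDim_mono hZi hX hZc hXc hZ).trans h.le

end Dimension

/-! ### Irreducibility of parametrized sets -/

section Parametrized

variable {k : Type*} [Field k] {W : Type*} [AddCommGroup W] [Module k W]

/-- The factor `N` discards parameters that do not give a point, such as those of the zero vector.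
It is cancelled at the end because the parameter ring is a domain. -/
theorem isIrreducible_of_parametrization [Infinite k] {Z : Set (ℙ k W)} (hne : Z.Nonempty)
    {σ : Type*} (Φ : MvPolynomial (Dual k W) k →+* MvPolynomial σ k) (N : MvPolynomial σ k)
    (hN : N ≠ 0)
    (h1 : ∀ p ∈ vanI Z, ∀ x : σ → k, MvPolynomial.eval x N ≠ 0 → MvPolynomial.eval x (Φ p) = 0)
    (h2 : ∀ p, Φ p = 0 → p ∈ vanI Z) : IsIrreducible Z := by
  refine isIrreducible_of_vanI hne fun p q hpq => ?_
  have : Φ p * Φ q * N = 0 := by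
    refine MvPolynomial.funext fun x => ?_
    by_cases hx : MvPolynomial.eval x N = 0
    · simp [hx]
    · have := h1 _ hpq x hx
      rw [map_mul] at this
      simp [this]
  rcases mul_eq_zero.1 this with h | h
  · exact (mul_eq_zero.1 h).imp (h2 p) (h2 q)
  · exact absurd h hN

variable {W' : Type*} [AddCommGroup W'] [Module k W']

/-- The composition of a polynomial function with a linear map. -/
def pullback (L : W →ₗ[k] W') : MvPolynomial (Dual k W') k →ₐ[k] MvPolynomial (Dual k W) k :=
  MvPolynomial.rename fun f => f ∘ₗ L

@[simp] theorem polyEval_pullback (L : W →ₗ[k] W') (p : MvPolynomial (Dual k W') k) (w : W) :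
    polyEval (pullback L p) w = polyEval p (L w) := by
  unfold polyEval pullback
  rw [MvPolynomial.eval_rename]
  rfl

theorem linSet_nonempty {K : Submodule k W} (hK : K ≠ ⊥) : (linSet K).Nonempty := by
  obtain ⟨w, hw, hw0⟩ := Submodule.exists_mem_ne_zero_of_ne_bot hK
  exact ⟨_, (mem_cone_linSet.2 ⟨hw0, hw⟩).2⟩

theorem isIrreducible_linSet [Infinite k] [FiniteDimensional k W] {K : Submodule k W}
    (hK : K ≠ ⊥) : IsIrreducible (linSet K) := by
  have hpos : 0 < finrank k K := by
    rw [Nat.pos_iff_ne_zero, ne_eq, Submodule.finrank_eq_zero]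
    exact hK
  -- The parameters are coordinates on `K`; nonvanishing of the first coordinate guarantees a
  -- nonzero vector.
  refine isIrreducible_of_parametrization (linSet_nonempty hK)
    ((toCoord k K).comp (pullback K.subtype)).toRingHom (MvPolynomial.X ⟨0, hpos⟩)
    (MvPolynomial.X_ne_zero _) ?_ ?_
  · intro p hp x hx
    let v : K := (finBasis k K).equivFun.symm x
    have hvx : (fun i => (finBasis k K).repr v i) = x := (finBasis k K).equivFun.apply_symm_apply x
    have hv0 : v ≠ 0 := by
      intro hv
      rw [MvPolynomial.eval_X, ← hvx, hv] at hx
      simp at hx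
    show MvPolynomial.eval x (toCoord k K (pullback K.subtype p)) = 0
    rw [← hvx, eval_toCoord, polyEval_pullback]
    exact hp _ (mem_cone_linSet.2 ⟨by simpa using hv0, v.2⟩)
  · intro p hp w hw
    obtain ⟨hw0, hwK⟩ := mem_cone_linSet.1 hw
    have hp' : toCoord k K (pullback K.subtype p) = 0 := hp
    have := eval_toCoord (pullback K.subtype p) (⟨w, hwK⟩ : K)
    rw [hp', map_zero, polyEval_pullback] at this
    exact this.symm

theorem exists_le_finrank_add_one_eq [FiniteDimensional k W] {K : Submodule k W} (hK : K ≠ ⊥) :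
    ∃ K' < K, finrank k K' + 1 = finrank k K := by
  have hpos : 0 < finrank k K := by
    rw [Nat.pos_iff_ne_zero, ne_eq, Submodule.finrank_eq_zero]
    exact hK
  obtain ⟨w, hw, hw0⟩ := Submodule.exists_mem_ne_zero_of_ne_bot hK
  obtain ⟨f, hf⟩ := exists_dual_ne_zero (k := k) hw0
  let g : Dual k K := f ∘ₗ K.subtype
  have hg : g ≠ 0 := fun h => hf (LinearMap.congr_fun h ⟨w, hw⟩)
  refine ⟨(LinearMap.ker g).map K.subtype, lt_of_le_of_ne ?_ ?_, ?_⟩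
  · exact Submodule.map_subtype_le _ _
  · intro h
    rw [← h] at hw
    obtain ⟨v, hv, rfl⟩ := hw
    exact hf hv
  · rw [Submodule.finrank_map_subtype_eq]
    exact Module.Dual.finrank_ker_add_one_of_ne_zero hg

theorem linSet_ssubset {K K' : Submodule k W} (h : K < K') : linSet K ⊂ linSet K' := by
  refine ⟨fun x hx => h.le hx, fun hcon => ?_⟩
  obtain ⟨w, hw, hwK⟩ := SetLike.exists_of_lt h
  have hw0 : w ≠ 0 := fun h0 => hwK (h0 ▸ K.zero_mem)
  exact hwK (mem_cone_linSet.1 (cone_mono hcon (mem_cone_linSet.2 ⟨hw0, hw⟩))).2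

/-- The upper bound comes from coordinate forms, extended to `W` by a projection onto `K`; the lower
bound comes from a complete flag in `K`. -/
theorem coneDim_linSet [IsAlgClosed k] [FiniteDimensional k W] {K : Submodule k W}
    (hK : K ≠ ⊥) : coneDim (linSet K) = finrank k K := by
  refine le_antisymm ?_ ?_
  · obtain ⟨K', hK'⟩ := Submodule.exists_isCompl K
    let b := finBasis k K
    let pr := K.projectionOnto K' hK'
    refine coneDim_le_of_forms (isIrreducible_linSet hK) (isClosed_linSet K)
      (fun i => b.coord i ∘ₗ pr) fun w hw => ?_
    obtain ⟨hw0, hwK⟩ := mem_cone_linSet.1 hw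
    by_contra! hcon
    have h1 : pr w = 0 := by
      refine b.ext_elem fun i => ?_
      rw [map_zero]
      exact hcon i
    have h2 : pr w = ⟨w, hwK⟩ := Submodule.projectionOnto_apply_left hK' ⟨w, hwK⟩
    rw [h1] at h2
    exact hw0 (congrArg Subtype.val h2).symm
  · have key : ∀ (n : ℕ) (K : Submodule k W), finrank k K = n → K ≠ ⊥ →
        n ≤ coneDim (linSet K) := by
      intro n
      induction n with
      | zero => intro K _ _; exact Nat.zero_le _
      | succ n ih =>
        intro K hn hK
        obtain ⟨K', hlt, hdim⟩ := exists_le_finrank_add_one_eq hK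
        by_cases hK' : K' = ⊥
        · subst hK'
          rw [finrank_bot] at hdim
          have := coneDim_pos (isIrreducible_linSet hK)
          omega
        · have h1 := ih K' (by omega) hK'
          have h2 := coneDim_lt (isIrreducible_linSet hK') (isIrreducible_linSet hK)
            (isClosed_linSet K') (isClosed_linSet K) (linSet_ssubset hlt)
          omega
    exact key _ K rfl hK

end Parametrized

end

noncomputable section

/-! ### Linear projections -/

section Projection

variable {k : Type*} [Field k] {W : Type*} [AddCommGroup W] [Module k W]
  {W' : Type*} [AddCommGroup W'] [Module k W']

theorem cone_projection {L : W →ₗ[k] W'} {X : Set (ℙ k W)} {v : W'} :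
    v ∈ cone {y | ∃ x ∈ X, ∃ hx : L x.rep ≠ 0, y = Projectivization.mk k (L x.rep) hx} ↔
      v ≠ 0 ∧ ∃ w ∈ cone X, L w = v := by
  constructor
  · rintro ⟨hv, x, hx, hLx, h⟩
    obtain ⟨c, hc⟩ := (Projectivization.mk_eq_mk_iff' k _ _ hv hLx).1 h
    have hc0 : c ≠ 0 := by
      rintro rfl
      exact hv (by rw [← hc, zero_smul])
    exact ⟨hv, c • x.rep, smul_mem_cone (rep_mem_cone.2 hx) hc0, by rw [map_smul, hc]⟩
  · rintro ⟨hv, w, hw, rfl⟩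
    obtain ⟨c, hc, hrep⟩ := exists_smul_rep_mk (k := k) hw.1
    have h0 : L (Projectivization.mk k w hw.1).rep ≠ 0 := by
      rw [hrep, map_smul]; exact smul_ne_zero hc hv
    refine ⟨hv, _, hw.2, h0, ?_⟩
    rw [Projectivization.mk_eq_mk_iff']
    refine ⟨c⁻¹, ?_⟩
    rw [hrep, map_smul, smul_smul, inv_mul_cancel₀ hc, one_smul]

theorem map_mem_cone_projImage {L : W →ₗ[k] W'} {X : Set (ℙ k W)} {w : W} (hw : w ∈ cone X)
    (h : L w ≠ 0) : L w ∈ cone (projImage L X) :=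
  cone_mono subset_closure (cone_projection.2 ⟨h, w, hw, rfl⟩)

theorem isClosed_projImage (L : W →ₗ[k] W') (X : Set (ℙ k W)) : IsClosed (projImage L X) :=
  isClosed_closure

theorem projImage_mono (L : W →ₗ[k] W') {X Y : Set (ℙ k W)} (h : X ⊆ Y) :
    projImage L X ⊆ projImage L Y :=
  closure_mono fun _ ⟨x, hx, h'⟩ => ⟨x, h hx, h'⟩

theorem projImage_subset {L : W →ₗ[k] W'} {X : Set (ℙ k W)} {Y : Set (ℙ k W')} (hY : IsClosed Y)
    (h : ∀ w ∈ cone X, L w ≠ 0 → L w ∈ cone Y) : projImage L X ⊆ Y := by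
  refine closure_minimal (cone_subset_cone.1 ?_) hY
  intro v hv
  obtain ⟨h0, w, hw, rfl⟩ := cone_projection.1 hv
  exact h w hw h0

variable [Infinite k]

theorem mem_vanI_projImage {L : W →ₗ[k] W'} {X : Set (ℙ k W)} {p : MvPolynomial (Dual k W') k} :
    p ∈ vanI (projImage L X) ↔ ∀ w ∈ cone X, L w ≠ 0 → polyEval p (L w) = 0 := by
  rw [projImage, vanI_closure]
  constructor
  · exact fun h w hw h0 => h _ (cone_projection.2 ⟨h0, w, hw, rfl⟩)
  · intro h v hv
    obtain ⟨h0, w, hw, rfl⟩ := cone_projection.1 hv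
    exact h w hw h0

/-- Vanishing on the image constrains the pullback only off the centre. Multiplying by a linear form
that vanishes on the centre but not on `X` gives an element of the prime ideal `vanI X`, and that
form can be cancelled. -/
theorem pullback_mem_vanI {L : W →ₗ[k] W'} {X : Set (ℙ k W)} (hX : IsIrreducible X)
    (hne : ∃ w ∈ cone X, L w ≠ 0) {p : MvPolynomial (Dual k W') k} :
    pullback L p ∈ vanI X ↔ p ∈ vanI (projImage L X) := by
  rw [mem_vanI_projImage]
  constructor
  · intro h w hw _
    rw [← polyEval_pullback]
    exact h w hw
  · intro h
    obtain ⟨w, hw, hLw⟩ := hne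
    obtain ⟨f, hf⟩ := exists_dual_ne_zero (k := k) hLw
    have h1 : pullback L p * MvPolynomial.X (f ∘ₗ L) ∈ vanI X := by
      intro v hv
      rw [polyEval_mul, polyEval_pullback, polyEval_X]
      by_cases h0 : L v = 0
      · simp [h0]
      · rw [h v hv h0, zero_mul]
    refine ((vanI_isPrime hX).mem_or_mem h1).resolve_right fun h2 => hf ?_
    simpa using h2 w hw

theorem isIrreducible_projImage {L : W →ₗ[k] W'} {X : Set (ℙ k W)} (hX : IsIrreducible X)
    (hne : ∃ w ∈ cone X, L w ≠ 0) : IsIrreducible (projImage L X) := by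
  refine isIrreducible_of_vanI ?_ fun p q hpq => ?_
  · obtain ⟨w, hw, hLw⟩ := hne
    exact ⟨_, (map_mem_cone_projImage hw hLw).2⟩
  · rw [← pullback_mem_vanI hX hne, map_mul] at hpq
    rw [← pullback_mem_vanI hX hne, ← pullback_mem_vanI hX hne]
    exact (vanI_isPrime hX).mem_or_mem hpq

/-- The map of homogeneous coordinate rings induced by a linear projection. -/
def projHom (L : W →ₗ[k] W') {X : Set (ℙ k W)} (hX : IsIrreducible X)
    (hne : ∃ w ∈ cone X, L w ≠ 0) : coordRing (projImage L X) →ₐ[k] coordRing X :=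
  Ideal.quotientMapₐ (vanI X) (pullback L) fun _ hp => (pullback_mem_vanI hX hne).2 hp

theorem projHom_injective (L : W →ₗ[k] W') {X : Set (ℙ k W)} (hX : IsIrreducible X)
    (hne : ∃ w ∈ cone X, L w ≠ 0) : Function.Injective (projHom L hX hne) := by
  have H : vanI (projImage L X) ≤ (vanI X).comap (pullback L) :=
    fun _ hp => (pullback_mem_vanI hX hne).2 hp
  exact Ideal.quotientMap_injective' (H := H) fun _ hp => (pullback_mem_vanI hX hne).1 hp

theorem projHom_formClass (L : W →ₗ[k] W') {X : Set (ℙ k W)} (hX : IsIrreducible X)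
    (hne : ∃ w ∈ cone X, L w ≠ 0) (f : Dual k W') :
    projHom L hX hne (formClass _ f) = formClass X (f ∘ₗ L) := by
  show Ideal.Quotient.mk _ (pullback L (MvPolynomial.X f)) = Ideal.Quotient.mk _ _
  rw [pullback, MvPolynomial.rename_X]

end Projection

/-! ### Points on lines -/

section Lines

variable {k : Type*} [Field k] [IsAlgClosed k] {W : Type*} [AddCommGroup W] [Module k W]
  [FiniteDimensional k W]

omit [IsAlgClosed k] [FiniteDimensional k W] in
theorem linSet_span_singleton (x : ℙ k W) : linSet (k ∙ x.rep) = {x} := by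
  ext y
  constructor
  · intro hy
    obtain ⟨c, hc⟩ := Submodule.mem_span_singleton.1 hy
    rw [Set.mem_singleton_iff, ← y.mk_rep, ← x.mk_rep, Projectivization.mk_eq_mk_iff']
    exact ⟨c, hc⟩
  · rintro rfl
    exact Submodule.mem_span_singleton_self _

theorem coneDim_singleton (x : ℙ k W) : coneDim {x} = 1 := by
  rw [← linSet_span_singleton, coneDim_linSet, finrank_span_singleton x.rep_nonzero]
  rw [ne_eq, Submodule.span_singleton_eq_bot]
  exact x.rep_nonzero

omit [IsAlgClosed k] in
theorem isClosed_singleton_projectivization (x : ℙ k W) : IsClosed ({x} : Set (ℙ k W)) := by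
  rw [← linSet_span_singleton]
  exact isClosed_linSet _

/-- A closed set that contains infinitely many points of a line contains the line. -/
theorem linSet_subset_of_infinite {K : Submodule k W} (hK : finrank k K = 2) {Y : Set (ℙ k W)}
    (hY : IsClosed Y) (hinf : (Y ∩ linSet K).Infinite) : linSet K ⊆ Y := by
  by_contra hcon
  have hK0 : K ≠ ⊥ := by
    rintro rfl
    simp at hK
  obtain ⟨C, hCfin, hCcl, hCirr, hCeq⟩ :=
    TopologicalSpace.NoetherianSpace.exists_finite_set_isClosed_irreducible
      (hY.inter (isClosed_linSet K))
  rw [hCeq] at hinf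
  refine hinf (hCfin.sUnion fun Z hZ => Set.Subsingleton.finite ?_)
  have hsub : Z ⊆ Y ∩ linSet K := by
    rw [hCeq]; exact Set.subset_sUnion_of_mem hZ
  have hss : Z ⊂ linSet K :=
    ⟨hsub.trans Set.inter_subset_right, fun h => hcon (h.trans (hsub.trans Set.inter_subset_left))⟩
  have h1 := coneDim_lt (hCirr Z hZ) (isIrreducible_linSet hK0) (hCcl Z hZ) (isClosed_linSet K) hss
  rw [coneDim_linSet hK0, hK] at h1
  intro x hx y hy
  by_contra hxy
  have h2 := coneDim_lt isIrreducible_singleton (hCirr Z hZ)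
    (isClosed_singleton_projectivization x) (hCcl Z hZ)
    ⟨Set.singleton_subset_iff.2 hx, fun h => hxy (h hy).symm⟩
  rw [coneDim_singleton] at h2
  omega

/-- A closed set that contains infinitely many points `[y + c x]` contains the line through `[x]`
and `[y]`. -/
theorem mem_cone_of_infinite_line {Y : Set (ℙ k W)} (hY : IsClosed Y) {x y : W}
    (hxy : LinearIndependent k ![x, y]) {M : Set k} (hM : M.Infinite)
    (h : ∀ c ∈ M, y + c • x ∈ cone Y) {w : W} (hw0 : w ≠ 0)
    (hw : w ∈ Submodule.span k {x, y}) : w ∈ cone Y := by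
  have hdim : finrank k (Submodule.span k ({x, y} : Set W)) = 2 := by
    have := finrank_span_eq_card hxy
    have hr : Set.range ![x, y] = {x, y} := by
      ext z
      simp [eq_comm, or_comm]
    rwa [hr, Fintype.card_fin] at this
  refine cone_mono (linSet_subset_of_infinite hdim hY ?_) (mem_cone_linSet.2 ⟨hw0, hw⟩)
  have hne : ∀ c : k, y + c • x ≠ 0 := by
    intro c hc
    have := (LinearIndependent.pair_iff.1 hxy c 1 (by rw [one_smul, add_comm]; exact hc)).2
    exact one_ne_zero this
  refine Set.Infinite.mono (s := (fun c => Projectivization.mk k (y + c • x) (hne c)) '' M) ?_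
    (hM.image ?_)
  · rintro _ ⟨c, hc, rfl⟩
    refine ⟨(h c hc).2, (mem_cone_linSet.2 ⟨hne c, ?_⟩).2⟩
    exact Submodule.add_mem _ (Submodule.subset_span (by simp))
      (Submodule.smul_mem _ _ (Submodule.subset_span (by simp)))
  · intro c _ d _ hcd
    obtain ⟨e, he⟩ := (Projectivization.mk_eq_mk_iff' k _ _ _ _).1 hcd
    have := LinearIndependent.pair_iff.1 hxy (e * d - c) (e - 1) (by
      rw [sub_smul, sub_smul, mul_smul, one_smul, ← sub_eq_zero.2 he]
      rw [smul_add]; abel)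
    have h1 : e = 1 := sub_eq_zero.1 this.2
    have h2 := this.1
    rw [h1, one_mul, sub_eq_zero] at h2
    exact h2.symm

end Lines

/-! ### Elimination -/

section Elimination

variable {k : Type*} [Field k] [IsAlgClosed k] {W : Type*} [AddCommGroup W] [Module k W]
  [FiniteDimensional k W] {W' : Type*} [AddCommGroup W'] [Module k W']

/-- The graded piece of the homogeneous coordinate ring. -/
def gradedPiece (X : Set (ℙ k W)) (d : ℕ) : Submodule k (coordRing X) :=
  (MvPolynomial.homogeneousSubmodule (Dual k W) k d).map (toRing X).toLinearMap

omit [IsAlgClosed k] in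
theorem finiteDimensional_gradedPiece (X : Set (ℙ k W)) (d : ℕ) :
    FiniteDimensional k (gradedPiece X d) := by
  have h : gradedPiece X d ≤ (MvPolynomial.homogeneousSubmodule (Fin (finrank k W)) k d).map
      ((toRing X).comp (fromCoord k W)).toLinearMap := by
    rintro _ ⟨p, hp, rfl⟩
    exact ⟨toCoord k W p, isHomogeneous_toCoord hp,
      (Ideal.Quotient.eq.2 (sub_fromCoord_toCoord_mem X p)).symm⟩
  have hfg := (MvPolynomial.homogeneousSubmodule_fg (R := k) (σ := Fin (finrank k W)) d).map
    ((toRing X).comp (fromCoord k W)).toLinearMap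
  have : FiniteDimensional k ((MvPolynomial.homogeneousSubmodule (Fin (finrank k W)) k d).map
      ((toRing X).comp (fromCoord k W)).toLinearMap) := Module.Finite.of_fg hfg
  exact Submodule.finiteDimensional_of_le h

/-- The value of an element of the coordinate ring at a vector of the cone. -/
def evalAt {X : Set (ℙ k W)} {w : W} (hw : w ∈ cone X) : coordRing X →ₐ[k] k :=
  Ideal.Quotient.liftₐ (vanI X) (MvPolynomial.aeval fun f : Dual k W => f w) fun _ hp => hp w hw

omit [IsAlgClosed k] [FiniteDimensional k W] in
theorem evalAt_toRing {X : Set (ℙ k W)} {w : W} (hw : w ∈ cone X)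
    (p : MvPolynomial (Dual k W) k) : evalAt hw (toRing X p) = polyEval p w := rfl

/-- The set of points `y` such that the closed set `X` meets the linear subspace defined by linear
forms that depend linearly on `y` is closed. -/
theorem isClosed_incidence {X : Set (ℙ k W)} (hX : IsClosed X) {ι : Type*}
    (β : ι → W →ₗ[k] W' →ₗ[k] k) :
    IsClosed {y : ℙ k W' | ∃ w ∈ cone X, ∀ i, β i w y.rep = 0} := by
  rw [← isOpen_compl_iff, isOpen_iff_forall_mem_open]
  intro y₀ hy₀
  have hy₀' : ∀ w ∈ cone X, ∃ i, (β i).flip y₀.rep w ≠ 0 := by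
    intro w hw
    by_contra! hcon
    exact hy₀ ⟨w, hw, hcon⟩
  -- Since the linear section attached to `y₀` misses `X`, multiples of its equations fill the
  -- graded piece of degree `D + 1`. That these multiples span is an open condition on `y`,
  -- expressed by a determinant.
  obtain ⟨D, hD⟩ := exists_degree_mem_sup hX (fun i => (β i).flip y₀.rep) hy₀'
  let Q := gradedPiece X (D + 1)
  have := finiteDimensional_gradedPiece X (D + 1)
  -- multiplication of a form of degree `D` with the forms attached to a point
  let J := ι × MvPolynomial.homogeneousSubmodule (Dual k W) k D
  have hmem : ∀ (j : J) (f : Dual k W), toRing X (j.2 : MvPolynomial (Dual k W) k) *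
      formClass X f ∈ Q := fun j f =>
    ⟨(j.2 : MvPolynomial (Dual k W) k) * MvPolynomial.X f,
      MvPolynomial.IsHomogeneous.mul j.2.2 (MvPolynomial.isHomogeneous_X k f), rfl⟩
  let Ψ : J → W' →ₗ[k] Q := fun j =>
    { toFun := fun y => ⟨_, hmem j ((β j.1).flip y)⟩
      map_add' := fun y z => Subtype.ext (by
        simp only [map_add, formClass_add, mul_add, Submodule.coe_add])
      map_smul' := fun c y => Subtype.ext (by
        simp only [map_smul, formClass_smul, mul_smul_comm, RingHom.id_apply,
          Submodule.coe_smul]) }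
  have hspan : Submodule.span k (Set.range fun j => Ψ j y₀.rep) = ⊤ := by
    rw [eq_top_iff]
    rintro ⟨_, p, hp, rfl⟩ -
    obtain ⟨q, hq, hpq⟩ := exists_sub_mem_vanI _ hp (hD (D + 1) (Nat.le_succ D) p hp)
    have h1 : toRing X p = toRing X q := Ideal.Quotient.eq.2 hpq
    have h2 : toRing X q ∈ (Submodule.span k (Set.range fun j => Ψ j y₀.rep)).map Q.subtype := by
      clear hpq h1
      induction hq using Submodule.span_induction with
      | mem q hq =>
        obtain ⟨i, c, hc, rfl⟩ := hq
        exact ⟨Ψ ⟨i, c, hc⟩ y₀.rep, Submodule.subset_span ⟨_, rfl⟩, rfl⟩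
      | zero => rw [map_zero]; exact Submodule.zero_mem _
      | add x y _ _ hx hy => rw [map_add]; exact Submodule.add_mem _ hx hy
      | smul c x _ hx => rw [map_smul]; exact Submodule.smul_mem _ _ hx
    obtain ⟨v, hv, hvq⟩ := h2
    rw [← h1] at hvq
    have : v = ⟨toRing X p, p, hp, rfl⟩ := Subtype.ext hvq
    exact this ▸ hv
  obtain ⟨κ, a, hainj, haspan, hali⟩ :=
    exists_linearIndependent' k (fun j => Ψ j y₀.rep)
  let b : Basis κ k Q := Basis.mk hali (by rw [haspan, hspan])
  have : Fintype κ := FiniteDimensional.fintypeBasisIndex b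
  classical
  -- The rows are the multiples forming a basis at `y₀`, written in that basis. The entries are
  -- linear in `y`, so the determinant is homogeneous, and it is `1` at `y₀`.
  let M : Matrix κ κ (MvPolynomial (Dual k W') k) :=
    Matrix.of fun j l => MvPolynomial.X (b.coord l ∘ₗ Ψ (a j))
  have hMdet : ∀ y, polyEval M.det y =
      Matrix.det (Matrix.of fun j l => b.coord l (Ψ (a j) y)) := by
    intro y
    unfold polyEval
    rw [RingHom.map_det]
    congr 1
    ext j l
    simp [M]
  have hhom : M.det.IsHomogeneous (Fintype.card κ) := by
    rw [Matrix.det_apply]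
    refine MvPolynomial.IsHomogeneous.sum _ _ _ fun σ _ => ?_
    have h1 : (∏ i, M (σ i) i).IsHomogeneous (∑ _i : κ, 1) :=
      MvPolynomial.IsHomogeneous.prod _ _ _ fun i _ => MvPolynomial.isHomogeneous_X _ _
    rw [Finset.sum_const, smul_eq_mul, mul_one, Finset.card_univ] at h1
    rcases Int.units_eq_one_or (Equiv.Perm.sign σ) with h | h
    · rw [h, one_smul]; exact h1
    · rw [h, Units.neg_smul, one_smul]; exact h1.neg
  refine ⟨(projHypersurface M.det)ᶜ, ?_, TopologicalSpace.isOpen_generateFrom_of_mem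
    ⟨_, _, hhom, rfl⟩, ?_⟩
  · rintro y hy ⟨w, hw, hβ⟩
    have hdet : Matrix.det (Matrix.of fun j l => b.coord l (Ψ (a j) y.rep)) ≠ 0 := by
      rw [← hMdet]; exact hy
    -- Evaluation at a common zero `w` kills every row, hence the whole graded piece when the
    -- determinant is nonzero. But some power `f ^ (D + 1)` of a linear form does not vanish at `w`.
    let e : Q →ₗ[k] k := (evalAt hw).toLinearMap ∘ₗ Q.subtype
    have he : ∀ j, e (Ψ j y.rep) = 0 := by
      intro j
      show evalAt hw (toRing X (j.2 : MvPolynomial (Dual k W) k) *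
        toRing X (MvPolynomial.X ((β j.1).flip y.rep))) = 0
      rw [map_mul, evalAt_toRing, evalAt_toRing, polyEval_X, LinearMap.flip_apply, hβ, mul_zero]
    have hmul : Matrix.mulVec (Matrix.of fun j l => b.coord l (Ψ (a j) y.rep))
        (fun l => e (b l)) = 0 := by
      funext j
      have h1 := he (a j)
      rw [← b.sum_repr (Ψ (a j) y.rep), map_sum] at h1
      simp only [map_smul, smul_eq_mul] at h1
      exact h1
    have hzero := Matrix.eq_zero_of_mulVec_eq_zero hdet hmul
    have he0 : e = 0 := b.ext fun l => congrFun hzero l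
    obtain ⟨f, hf⟩ := exists_dual_ne_zero (k := k) hw.1
    have hfQ : toRing X (MvPolynomial.X f ^ (D + 1)) ∈ Q :=
      ⟨_, MvPolynomial.isHomogeneous_X_pow f (D + 1), rfl⟩
    have h1 : e ⟨_, hfQ⟩ = 0 := by rw [he0]; rfl
    have h2 : e ⟨_, hfQ⟩ = polyEval (MvPolynomial.X f ^ (D + 1)) w := rfl
    rw [h2, polyEval_pow, polyEval_X] at h1
    exact pow_ne_zero _ hf h1
  · show polyEval M.det y₀.rep ≠ 0
    rw [hMdet]
    have : (Matrix.of fun j l => b.coord l (Ψ (a j) y₀.rep)) = 1 := by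
      ext j l
      have h1 : Ψ (a j) y₀.rep = b j := by simp [b]
      rw [Matrix.of_apply, h1, Basis.coord_apply, Basis.repr_self, Finsupp.single_apply, Matrix.one_apply]
    rw [this, Matrix.det_one]
    exact one_ne_zero

end Elimination

end

noncomputable section

/-! ### Spaces of bilinear forms and their elements of rank one -/

section RankOne

variable {k : Type*} [Field k] {U : Type*} [AddCommGroup U] [Module k U]
  {S : Type*} [AddCommGroup S] [Module k S] {V : Type*} [AddCommGroup V] [Module k V]

/-- An element of a space of bilinear forms is of rank at most one when it is a product of two
linear forms. -/
def IsRankOne (β : U →ₗ[k] S →ₗ[k] V →ₗ[k] k) (x : U) : Prop :=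
  ∃ (b : Dual k S) (g : Dual k V), ∀ s u, β x s u = b s * g u

/-- The set of lines of elements of rank one. -/
def rankOneSet (β : U →ₗ[k] S →ₗ[k] V →ₗ[k] k) : Set (ℙ k U) := {x | IsRankOne β x.rep}

/-- The linear form given by an entry of the bilinear forms in a space. -/
def entry (β : U →ₗ[k] S →ₗ[k] V →ₗ[k] k) (s : S) (u : V) : Dual k U :=
  (β.flip s).flip u

@[simp] theorem entry_apply (β : U →ₗ[k] S →ₗ[k] V →ₗ[k] k) (s : S) (u : V) (x : U) :
    entry β s u x = β x s u := rfl

theorem isRankOne_iff {β : U →ₗ[k] S →ₗ[k] V →ₗ[k] k} {x : U} :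
    IsRankOne β x ↔ ∀ s s' u u', β x s u * β x s' u' = β x s u' * β x s' u := by
  constructor
  · rintro ⟨b, g, h⟩ s s' u u'
    simp only [h]
    ring
  · intro h
    by_cases h0 : ∀ s u, β x s u = 0
    · exact ⟨0, 0, fun s u => by simp [h0]⟩
    · push Not at h0
      obtain ⟨s₀, u₀, h0⟩ := h0
      refine ⟨(β x).flip u₀, (β x s₀ u₀)⁻¹ • β x s₀, fun s u => ?_⟩
      rw [LinearMap.flip_apply, LinearMap.smul_apply, smul_eq_mul]
      field_simp
      rw [h s s₀ u u₀]

theorem IsRankOne.smul {β : U →ₗ[k] S →ₗ[k] V →ₗ[k] k} {x : U} (h : IsRankOne β x) (c : k) :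
    IsRankOne β (c • x) := by
  obtain ⟨b, g, hbg⟩ := h
  exact ⟨c • b, g, fun s u => by simp [hbg, mul_assoc]⟩

theorem mem_cone_rankOneSet {β : U →ₗ[k] S →ₗ[k] V →ₗ[k] k} {x : U} :
    x ∈ cone (rankOneSet β) ↔ x ≠ 0 ∧ IsRankOne β x := by
  constructor
  · rintro ⟨hx, h⟩
    obtain ⟨c, hc, hrep⟩ := exists_smul_rep_mk (k := k) hx
    refine ⟨hx, ?_⟩
    have h' : IsRankOne β (Projectivization.mk k x hx).rep := h
    rw [hrep] at h'
    have := h'.smul c⁻¹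
    rwa [smul_smul, inv_mul_cancel₀ hc, one_smul] at this
  · rintro ⟨hx, h⟩
    refine ⟨hx, ?_⟩
    obtain ⟨c, hc, hrep⟩ := exists_smul_rep_mk (k := k) hx
    show IsRankOne β _
    rw [hrep]
    exact h.smul c

theorem isClosed_rankOneSet (β : U →ₗ[k] S →ₗ[k] V →ₗ[k] k) : IsClosed (rankOneSet β) := by
  refine isClosed_of_polys {p | ∃ s s' u u', p =
    MvPolynomial.X (entry β s u) * MvPolynomial.X (entry β s' u') -
    MvPolynomial.X (entry β s u') * MvPolynomial.X (entry β s' u)} ?_ fun x => ?_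
  · rintro _ ⟨s, s', u, u', rfl⟩
    exact ⟨1 + 1, ((MvPolynomial.isHomogeneous_X _ _).mul (MvPolynomial.isHomogeneous_X _ _)).sub
      ((MvPolynomial.isHomogeneous_X _ _).mul (MvPolynomial.isHomogeneous_X _ _))⟩
  · show IsRankOne β x.rep ↔ _
    rw [isRankOne_iff]
    constructor
    · rintro h _ ⟨s, s', u, u', rfl⟩
      simp [h s s' u u']
    · intro h s s' u u'
      have := h _ ⟨s, s', u, u', rfl⟩
      simpa [sub_eq_zero] using this

/-- A space of bilinear forms without a common isotropic pair of nonzero vectors. -/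
structure IsSteinerForm (β : U →ₗ[k] S →ₗ[k] V →ₗ[k] k) : Prop where
  inj : ∀ x, (∀ s u, β x s u = 0) → x = 0
  nondeg : ∀ s u, s ≠ 0 → u ≠ 0 → ∃ x, β x s u ≠ 0

/-- Exchange of the two factors. -/
def swapForm (β : U →ₗ[k] S →ₗ[k] V →ₗ[k] k) : U →ₗ[k] V →ₗ[k] S →ₗ[k] k :=
  LinearMap.mk₂ k (fun x u => (β x).flip u)
    (fun _ _ _ => by ext; simp) (fun _ _ _ => by ext; simp) (fun _ _ _ => by ext; simp)
    (fun _ _ _ => by ext; simp)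

@[simp] theorem swapForm_apply (β : U →ₗ[k] S →ₗ[k] V →ₗ[k] k) (x : U) (u : V) (s : S) :
    swapForm β x u s = β x s u := rfl

theorem IsSteinerForm.swap {β : U →ₗ[k] S →ₗ[k] V →ₗ[k] k} (h : IsSteinerForm β) :
    IsSteinerForm (swapForm β) where
  inj x hx := h.inj x fun s u => hx u s
  nondeg u s hu hs := h.nondeg s u hs hu

theorem IsRankOne.swap {β : U →ₗ[k] S →ₗ[k] V →ₗ[k] k} {x : U} (h : IsRankOne β x) :
    IsRankOne (swapForm β) x := by
  obtain ⟨b, g, hbg⟩ := h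
  exact ⟨g, b, fun u s => by rw [swapForm_apply, hbg, mul_comm]⟩

theorem rankOneSet_swap (β : U →ₗ[k] S →ₗ[k] V →ₗ[k] k) :
    rankOneSet (swapForm β) = rankOneSet β :=
  Set.ext fun _ => ⟨fun h => h.swap, fun h => h.swap⟩

/-- The forms that vanish on the product of a hyperplane of `S` with `V`. -/
def firstKer (β : U →ₗ[k] S →ₗ[k] V →ₗ[k] k) (a : Dual k S) : Submodule k U where
  carrier := {x | ∀ s, a s = 0 → ∀ u, β x s u = 0}
  add_mem' hx hy s hs u := by simp [hx s hs u, hy s hs u]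
  zero_mem' s _ u := by simp
  smul_mem' c x hx s hs u := by simp [hx s hs u]

theorem exists_apply_eq_one {a : Dual k S} (ha : a ≠ 0) : ∃ s, a s = 1 := by
  obtain ⟨s, hs⟩ := DFunLike.ne_iff.1 ha
  exact ⟨(a s)⁻¹ • s, by rw [map_smul, smul_eq_mul, inv_mul_cancel₀ hs]⟩

theorem apply_eq_mul_of_mem_firstKer {β : U →ₗ[k] S →ₗ[k] V →ₗ[k] k} {a : Dual k S} {x : U}
    (hx : x ∈ firstKer β a) {s₀ : S} (hs₀ : a s₀ = 1) (s : S) (u : V) :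
    β x s u = a s * β x s₀ u := by
  have h := hx (s - a s • s₀) (by simp [hs₀]) u
  simp only [map_sub, map_smul, LinearMap.sub_apply, LinearMap.smul_apply, smul_eq_mul] at h
  exact sub_eq_zero.1 h

theorem mem_firstKer_iff {β : U →ₗ[k] S →ₗ[k] V →ₗ[k] k} {a : Dual k S} (ha : a ≠ 0) {x : U} :
    x ∈ firstKer β a ↔ ∃ g : Dual k V, ∀ s u, β x s u = a s * g u := by
  constructor
  · intro hx
    obtain ⟨s₀, hs₀⟩ := exists_apply_eq_one ha
    exact ⟨β x s₀, apply_eq_mul_of_mem_firstKer hx hs₀⟩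
  · rintro ⟨g, hg⟩ s hs u
    rw [hg, hs, zero_mul]

/-- The projection of a space of bilinear forms given by the restriction to a hyperplane of the
first factor. -/
structure IsFirstProjection (β : U →ₗ[k] S →ₗ[k] V →ₗ[k] k) (a : Dual k S)
    {U' : Type*} [AddCommGroup U'] [Module k U']
    (β' : U' →ₗ[k] LinearMap.ker a →ₗ[k] V →ₗ[k] k) (pr : U →ₗ[k] U') : Prop where
  surj : Function.Surjective pr
  compat : ∀ x s u, β' (pr x) s u = β x s u
  inj : ∀ y, (∀ s u, β' y s u = 0) → y = 0

section Projection

variable {β : U →ₗ[k] S →ₗ[k] V →ₗ[k] k} {a : Dual k S}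
  {U' : Type*} [AddCommGroup U'] [Module k U']
  {β' : U' →ₗ[k] LinearMap.ker a →ₗ[k] V →ₗ[k] k} {pr : U →ₗ[k] U'}

theorem IsFirstProjection.steiner (h : IsFirstProjection β a β' pr) (hβ : IsSteinerForm β) :
    IsSteinerForm β' where
  inj := h.inj
  nondeg s u hs hu := by
    obtain ⟨x, hx⟩ := hβ.nondeg s u (by simpa using hs) hu
    exact ⟨pr x, by rwa [h.compat]⟩

theorem IsFirstProjection.ker_eq (h : IsFirstProjection β a β' pr) :
    LinearMap.ker pr = firstKer β a := by
  ext x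
  rw [LinearMap.mem_ker]
  constructor
  · intro hx s hs u
    rw [← h.compat x ⟨s, hs⟩ u, hx]
    simp
  · intro hx
    refine h.inj _ fun s u => ?_
    rw [h.compat]
    exact hx s s.2 u

theorem IsFirstProjection.isRankOne (h : IsFirstProjection β a β' pr) {x : U}
    (hx : IsRankOne β x) : IsRankOne β' (pr x) := by
  obtain ⟨b, g, hbg⟩ := hx
  exact ⟨b ∘ₗ (LinearMap.ker a).subtype, g, fun s u => by rw [h.compat, hbg]; rfl⟩

theorem IsFirstProjection.finrank_add [FiniteDimensional k U] (h : IsFirstProjection β a β' pr) :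
    finrank k U' + finrank k (firstKer β a) = finrank k U := by
  rw [← h.ker_eq, ← LinearMap.finrank_range_add_finrank_ker pr,
    LinearMap.range_eq_top.2 h.surj, finrank_top]

end Projection

/-- The restriction of bilinear forms to a hyperplane of the first factor. -/
def restrictFirst (β : U →ₗ[k] S →ₗ[k] V →ₗ[k] k) (a : Dual k S) :
    U →ₗ[k] LinearMap.ker a →ₗ[k] V →ₗ[k] k :=
  (LinearMap.lcomp k (V →ₗ[k] k) (LinearMap.ker a).subtype) ∘ₗ β

theorem firstKer_le_ker_restrictFirst (β : U →ₗ[k] S →ₗ[k] V →ₗ[k] k) (a : Dual k S) :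
    firstKer β a ≤ LinearMap.ker (restrictFirst β a) := fun x hx => by
  rw [LinearMap.mem_ker]
  ext s u
  exact hx s s.2 u

/-- The bilinear forms obtained by restriction to a hyperplane of the first factor. -/
def restrictQuot (β : U →ₗ[k] S →ₗ[k] V →ₗ[k] k) (a : Dual k S) :
    (U ⧸ firstKer β a) →ₗ[k] LinearMap.ker a →ₗ[k] V →ₗ[k] k :=
  Submodule.liftQ (R := k) (R₂ := k) (M := U) (M₂ := LinearMap.ker a →ₗ[k] V →ₗ[k] k)
    (τ₁₂ := RingHom.id k) (firstKer β a) (restrictFirst β a) (firstKer_le_ker_restrictFirst β a)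

theorem isFirstProjection_mkQ (β : U →ₗ[k] S →ₗ[k] V →ₗ[k] k) (a : Dual k S) :
    IsFirstProjection β a (restrictQuot β a) (firstKer β a).mkQ where
  surj := Submodule.mkQ_surjective _
  compat _ _ _ := rfl
  inj y hy := by
    obtain ⟨x, rfl⟩ := Submodule.mkQ_surjective _ y
    exact (Submodule.Quotient.mk_eq_zero _).2 fun s hs u => hy ⟨s, hs⟩ u

end RankOne

/-! ### The dimension of a nondegenerate space of bilinear forms -/

section Hopf

variable {k : Type*} [Field k] {p q : ℕ}

variable (k p q) in
/-- The lines of matrices of rank one. -/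
def segreSet : Set (ℙ k (Fin p → Fin q → k)) :=
  {x | ∀ i i' j j', x.rep i j * x.rep i' j' = x.rep i j' * x.rep i' j}

theorem isClosed_segreSet : IsClosed (segreSet k p q) := by
  let e (i : Fin p) (j : Fin q) : Dual k (Fin p → Fin q → k) := LinearMap.proj j ∘ₗ LinearMap.proj i
  refine isClosed_of_polys {P | ∃ i i' j j', P =
    MvPolynomial.X (e i j) * MvPolynomial.X (e i' j') -
    MvPolynomial.X (e i j') * MvPolynomial.X (e i' j)} ?_ fun x => ?_
  · rintro _ ⟨s, s', u, u', rfl⟩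
    exact ⟨1 + 1, ((MvPolynomial.isHomogeneous_X _ _).mul (MvPolynomial.isHomogeneous_X _ _)).sub
      ((MvPolynomial.isHomogeneous_X _ _).mul (MvPolynomial.isHomogeneous_X _ _))⟩
  · constructor
    · rintro h _ ⟨s, s', u, u', rfl⟩
      simp [e, h s s' u u']
    · intro h s s' u u'
      have := h _ ⟨s, s', u, u', rfl⟩
      simpa [e, sub_eq_zero] using this

theorem mem_cone_segreSet {w : Fin p → Fin q → k} :
    w ∈ cone (segreSet k p q) ↔ w ≠ 0 ∧ ∃ (b : Fin p → k) (g : Fin q → k), ∀ i j, w i j = b i * g j := by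
  constructor
  · rintro ⟨hw, h⟩
    obtain ⟨c, hc, hrep⟩ := exists_smul_rep_mk (k := k) hw
    have h' : ∀ i i' j j', w i j * w i' j' = w i j' * w i' j := by
      intro i i' j j'
      have := h i i' j j'
      simp only [hrep, Pi.smul_apply, smul_eq_mul] at this
      have h2 : (c * c) * (w i j * w i' j') = (c * c) * (w i j' * w i' j) := by linear_combination this
      exact mul_left_cancel₀ (mul_ne_zero hc hc) h2
    refine ⟨hw, ?_⟩
    obtain ⟨i₀, hi₀⟩ := Function.ne_iff.1 hw
    obtain ⟨j₀, hj₀⟩ := Function.ne_iff.1 hi₀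
    have h0 : w i₀ j₀ ≠ 0 := hj₀
    refine ⟨fun i => w i j₀, fun j => (w i₀ j₀)⁻¹ * w i₀ j, fun i j => ?_⟩
    field_simp
    rw [h' i i₀ j j₀]
  · rintro ⟨hw, b, g, h⟩
    obtain ⟨c, hc, hrep⟩ := exists_smul_rep_mk (k := k) hw
    refine ⟨hw, fun i i' j j' => ?_⟩
    simp only [hrep, Pi.smul_apply, smul_eq_mul, h]
    ring

theorem eq_sum_single (w : Fin p → Fin q → k) :
    w = ∑ i, ∑ j, w i j • (Pi.single i (Pi.single j 1) : Fin p → Fin q → k) := by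
  ext i j
  simp [Finset.sum_apply, Pi.single_apply, apply_ite, ite_apply]

variable (k p q) in
/-- The homomorphism of polynomial rings given by the parametrization of matrices of rank one. -/
def segreHom : MvPolynomial (Dual k (Fin p → Fin q → k)) k →ₐ[k] MvPolynomial (Fin p ⊕ Fin q) k :=
  MvPolynomial.aeval fun f => ∑ i, ∑ j, MvPolynomial.C (f (Pi.single i (Pi.single j 1))) *
    (MvPolynomial.X (Sum.inl i) * MvPolynomial.X (Sum.inr j))

theorem eval_segreHom (P : MvPolynomial (Dual k (Fin p → Fin q → k)) k) (x : Fin p ⊕ Fin q → k) :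
    MvPolynomial.eval x (segreHom k p q P) =
      polyEval P fun i j => x (Sum.inl i) * x (Sum.inr j) := by
  have : (MvPolynomial.aeval x).comp (segreHom k p q) =
      MvPolynomial.aeval fun f : Dual k (Fin p → Fin q → k) =>
        f fun i j => x (Sum.inl i) * x (Sum.inr j) := by
    refine MvPolynomial.algHom_ext fun f => ?_
    rw [MvPolynomial.aeval_X]
    conv_rhs => rw [eq_sum_single (fun i j => x (Sum.inl i) * x (Sum.inr j))]
    simp [segreHom, mul_comm]
  exact DFunLike.congr_fun this P

variable [Infinite k]

theorem mem_vanI_segreSet (hp : 0 < p) (hq : 0 < q) {P : MvPolynomial (Dual k (Fin p → Fin q → k)) k} :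
    P ∈ vanI (segreSet k p q) ↔ segreHom k p q P = 0 := by
  constructor
  · intro hP
    -- The extra factor removes the parameters that may give the zero matrix.
    have : segreHom k p q P * (MvPolynomial.X (Sum.inl ⟨0, hp⟩) * MvPolynomial.X (Sum.inr ⟨0, hq⟩)) = 0 := by
      refine MvPolynomial.funext fun x => ?_
      rw [map_mul, eval_segreHom]
      by_cases h : x (Sum.inl ⟨0, hp⟩) * x (Sum.inr ⟨0, hq⟩) = 0
      · simp [h]
      · rw [hP _ (mem_cone_segreSet.2 ⟨fun h0 => h (congrFun (congrFun h0 _) _), _, _, fun _ _ => rfl⟩)]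
        simp
    exact (mul_eq_zero.1 this).resolve_right
      (mul_ne_zero (MvPolynomial.X_ne_zero _) (MvPolynomial.X_ne_zero _))
  · intro hP w hw
    obtain ⟨-, b, g, hbg⟩ := mem_cone_segreSet.1 hw
    have := eval_segreHom P (Sum.elim b g)
    rw [hP, map_zero] at this
    rw [show w = fun i j => b i * g j from funext fun i => funext fun j => hbg i j]
    exact this.symm

omit [Infinite k] in
theorem segreSet_nonempty (hp : 0 < p) (hq : 0 < q) : (segreSet k p q).Nonempty := by
  have hw : (fun _ _ => 1 : Fin p → Fin q → k) ≠ 0 := fun h => one_ne_zero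
    (congrFun (congrFun h ⟨0, hp⟩) ⟨0, hq⟩)
  obtain ⟨h, h'⟩ := mem_cone_segreSet.2 ⟨hw, (fun _ => 1), (fun _ => 1), fun _ _ => (mul_one _).symm⟩
  exact ⟨_, h'⟩

theorem isIrreducible_segreSet (hp : 0 < p) (hq : 0 < q) : IsIrreducible (segreSet k p q) := by
  refine isIrreducible_of_vanI (segreSet_nonempty hp hq) fun P Q h => ?_
  rw [mem_vanI_segreSet hp hq, map_mul, mul_eq_zero] at h
  rwa [mem_vanI_segreSet hp hq, mem_vanI_segreSet hp hq]

/-- The coordinate ring embeds in the polynomial ring in `p + q` variables by the products `x i * y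
j`. After adjoining the single variable `x i₀`, all other variables become algebraic. -/
theorem le_coneDim_segreSet (hp : 0 < p) (hq : 0 < q) : p + q ≤ coneDim (segreSet k p q) + 1 := by
  let φ : coordRing (segreSet k p q) →ₐ[k] MvPolynomial (Fin p ⊕ Fin q) k :=
    Ideal.Quotient.liftₐ (vanI (segreSet k p q)) (segreHom k p q)
      fun P hP => (mem_vanI_segreSet hp hq).1 hP
  have hφ : Function.Injective φ := by
    refine (injective_iff_map_eq_zero φ).2 fun x hx => ?_
    obtain ⟨P, rfl⟩ := Ideal.Quotient.mkₐ_surjective k _ x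
    exact Ideal.Quotient.eq_zero_iff_mem.2 ((mem_vanI_segreSet hp hq).2 hx)
  let A := MvPolynomial (Fin p ⊕ Fin q) k
  let x (i : Fin p) : A := MvPolynomial.X (Sum.inl i)
  let y (j : Fin q) : A := MvPolynomial.X (Sum.inr j)
  let i₀ : Fin p := ⟨0, hp⟩
  let j₀ : Fin q := ⟨0, hq⟩
  have hxy : ∀ i j, x i * y j ∈ Set.range φ := fun i j => by
    refine ⟨formClass _ (LinearMap.proj j ∘ₗ LinearMap.proj i), ?_⟩
    show segreHom k p q (MvPolynomial.X _) = _
    simp [segreHom, x, y, Pi.single_apply, apply_ite, ite_apply]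
  set C := Algebra.adjoin k (Set.range φ ∪ {x i₀}) with hC
  have hxyC : ∀ i j, x i * y j ∈ C := fun i j => Algebra.subset_adjoin (Or.inl (hxy i j))
  have hxC : x i₀ ∈ C := Algebra.subset_adjoin (Or.inr rfl)
  have hx0 : ∀ i, x i ≠ 0 := fun i => MvPolynomial.X_ne_zero _
  have hy0 : ∀ j, y j ≠ 0 := fun j => MvPolynomial.X_ne_zero _
  have := isDomain_coordRing (isIrreducible_segreSet (k := k) hp hq)
  have := tdeg_le_add φ hφ (Set.finite_singleton (x i₀)) (G := Set.range MvPolynomial.X)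
    MvPolynomial.adjoin_range_X ?_
  · rw [Set.ncard_singleton] at this
    refine le_trans (le_of_eq ?_) this
    rw [tdeg, MvPolynomial.trdeg_of_isDomain]
    simp
  · rintro _ ⟨i | j, rfl⟩
    · exact isAlgebraic_of_mul_mem (hxyC i₀ j₀) (mul_ne_zero (hx0 _) (hy0 _))
        (C.mul_mem hxC (hxyC i j₀)) (by simp only [x, y]; ring)
    · exact isAlgebraic_of_mul_mem hxC (hx0 _) (hxyC i₀ j) rfl

end Hopf

/-! ### Hopf's inequality and the size of the fibres over a first factor. -/

section Steiner

variable {k : Type*} [Field k] [IsAlgClosed k]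
  {U : Type*} [AddCommGroup U] [Module k U] [FiniteDimensional k U]
  {S : Type*} [AddCommGroup S] [Module k S] [FiniteDimensional k S]
  {V : Type*} [AddCommGroup V] [Module k V] [FiniteDimensional k V]
  {β : U →ₗ[k] S →ₗ[k] V →ₗ[k] k}

omit [FiniteDimensional k S] [FiniteDimensional k V] in
/-- Hopf's inequality. -/
theorem IsSteinerForm.add_le (hβ : IsSteinerForm β) (hp : 0 < finrank k S) (hq : 0 < finrank k V) :
    finrank k S + finrank k V ≤ finrank k U + 1 := by
  have : FiniteDimensional k S := .of_finrank_pos hp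
  have : FiniteDimensional k V := .of_finrank_pos hq
  let bS := finBasis k S
  let bV := finBasis k V
  let bU := finBasis k U
  have h1 := le_coneDim_segreSet (k := k) hp hq
  -- A basis of `U` gives `finrank k U` linear forms on matrices. A common zero of rank one would be
  -- a pair of nonzero vectors isotropic for all forms.
  have h2 := coneDim_le_of_forms (isIrreducible_segreSet (k := k) hp hq) isClosed_segreSet
    (fun r => ∑ i, ∑ j, (β (bU r) (bS i) (bV j)) •
      (LinearMap.proj j ∘ₗ LinearMap.proj i : Dual k (Fin (finrank k S) → Fin (finrank k V) → k)))
    fun w hw => ?_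
  · omega
  · obtain ⟨hw0, b, g, hbg⟩ := mem_cone_segreSet.1 hw
    by_contra! hcon
    have key : ∀ x, β x (∑ i, b i • bS i) (∑ j, g j • bV j) = 0 := by
      have : ((β.flip (∑ i, b i • bS i)).flip (∑ j, g j • bV j)) = 0 := by
        refine bU.ext fun r => ?_
        have := hcon r
        simp only [LinearMap.coe_sum, Finset.sum_apply, LinearMap.smul_apply, LinearMap.comp_apply,
          LinearMap.proj_apply, smul_eq_mul, hbg] at this
        simp only [LinearMap.flip_apply, map_sum, map_smul, LinearMap.coe_sum, Finset.sum_apply,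
          LinearMap.smul_apply, smul_eq_mul, LinearMap.zero_apply]
        rw [← this, Finset.sum_comm]
        refine Finset.sum_congr rfl fun j _ => ?_
        rw [Finset.mul_sum]
        refine Finset.sum_congr rfl fun i _ => ?_
        ring
      intro x
      exact DFunLike.congr_fun this x
    have hb : (∑ i, b i • bS i) ≠ 0 := by
      intro h0
      have := Fintype.linearIndependent_iff.1 bS.linearIndependent b h0
      exact hw0 (funext fun i => funext fun j => by simp [hbg, this])
    have hg : (∑ j, g j • bV j) ≠ 0 := by
      intro h0
      have := Fintype.linearIndependent_iff.1 bV.linearIndependent g h0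
      exact hw0 (funext fun i => funext fun j => by simp [hbg, this])
    obtain ⟨x, hx⟩ := hβ.nondeg _ _ hb hg
    exact hx (key x)

omit [IsAlgClosed k] in
theorem finrank_ker_add_one {a : Dual k S} (ha : a ≠ 0) :
    finrank k (LinearMap.ker a) + 1 = finrank k S := by
  have h := LinearMap.finrank_range_add_finrank_ker a
  rw [LinearMap.range_eq_top.2 (LinearMap.surjective ha), finrank_top, finrank_self] at h
  omega

omit [FiniteDimensional k V] in
-- This is Hopf's inequality for the restricted forms `U ⧸ firstKer β a` on `ker a × V`.
theorem IsSteinerForm.finrank_firstKer_le (hβ : IsSteinerForm β) {a : Dual k S} (ha : a ≠ 0)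
    (hp : 2 ≤ finrank k S) (hq : 1 ≤ finrank k V) :
    finrank k (firstKer β a) + finrank k S + finrank k V ≤ finrank k U + 2 := by
  have h := isFirstProjection_mkQ β a
  have h1 := h.finrank_add
  have h2 := finrank_ker_add_one ha
  have h3 := (h.steiner hβ).add_le (by omega) hq
  omega

end Steiner

end

noncomputable section

/-! ### Dimension under the projection from the elements with a given first factor -/

section ProjectionDim

variable {k : Type*} [Field k] {U : Type*} [AddCommGroup U] [Module k U] [FiniteDimensional k U]
  {S : Type*} [AddCommGroup S] [Module k S] {V : Type*} [AddCommGroup V] [Module k V]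
  {β : U →ₗ[k] S →ₗ[k] V →ₗ[k] k}

theorem span_entry (hβ : IsSteinerForm β) :
    Submodule.span k (Set.range fun x : S × V => entry β x.1 x.2) = ⊤ := by
  rw [← Subspace.dualCoannihilator_dualAnnihilator_eq
    (W := Submodule.span k (Set.range fun x : S × V => entry β x.1 x.2))]
  have : (Submodule.span k (Set.range fun x : S × V => entry β x.1 x.2)).dualCoannihilator = ⊥ := by
    rw [eq_bot_iff]
    intro x hx
    refine hβ.inj x fun s u => ?_
    exact (Submodule.mem_dualCoannihilator _).1 hx (entry β s u) (Submodule.subset_span ⟨(s, u), rfl⟩)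
  rw [this, Submodule.dualAnnihilator_bot]

omit [FiniteDimensional k U] in
variable (β) in
/-- The class of an entry in a homogeneous coordinate ring. -/
def entryClass (Z : Set (ℙ k U)) (s : S) (u : V) : coordRing Z := formClass Z (entry β s u)

theorem adjoin_entryClass (hβ : IsSteinerForm β) (Z : Set (ℙ k U)) :
    Algebra.adjoin k (Set.range fun x : S × V => entryClass β Z x.1 x.2) = ⊤ := by
  rw [eq_top_iff, ← adjoin_formClass Z]
  refine Algebra.adjoin_le ?_
  rintro _ ⟨f, rfl⟩
  have hf : f ∈ Submodule.span k (Set.range fun x : S × V => entry β x.1 x.2) := by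
    rw [span_entry hβ]; trivial
  induction hf using Submodule.span_induction with
  | mem f hf =>
    obtain ⟨x, rfl⟩ := hf
    exact Algebra.subset_adjoin ⟨x, rfl⟩
  | zero =>
    rw [← zero_smul k (0 : Dual k U), formClass_smul, zero_smul]
    exact Subalgebra.zero_mem _
  | add f g _ _ hf hg =>
    rw [formClass_add]
    exact Subalgebra.add_mem _ hf hg
  | smul c f _ hf =>
    rw [formClass_smul]
    exact Subalgebra.smul_mem _ hf c

variable [IsAlgClosed k] {a : Dual k S}
  {U' : Type*} [AddCommGroup U'] [Module k U'] [FiniteDimensional k U']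
  {β' : U' →ₗ[k] LinearMap.ker a →ₗ[k] V →ₗ[k] k} {pr : U →ₗ[k] U'}

/-- Entries with first argument in `ker a` come from the image. On forms of rank one the minor
relation `β(s₁,u₁) β(s,u) = β(s,u₁) β(s₁,u)` makes every other entry algebraic over these and
`β(s₀,u₁)`. So the set `t` only has to provide the entry at `(s₀, u₁)`. -/
theorem coneDim_le_add_ncard (hβ : IsSteinerForm β) (h : IsFirstProjection β a β' pr)
    {Z : Set (ℙ k U)} (hZ : IsIrreducible Z) (hZβ : Z ⊆ rankOneSet β)
    (hne : ∃ w ∈ cone Z, pr w ≠ 0) {s₀ : S} (hs₀ : a s₀ = 1) {s₁ : S} (hs₁ : a s₁ = 0) {u₁ : V}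
    (h1 : entryClass β Z s₁ u₁ ≠ 0) {t : Set (coordRing Z)} (ht : t.Finite)
    (hmem : entryClass β Z s₀ u₁ ∈ Algebra.adjoin k (Set.range (projHom pr hZ hne) ∪ t)) :
    coneDim Z ≤ coneDim (projImage pr Z) + t.ncard := by
  have := isDomain_coordRing hZ
  have := isDomain_coordRing (isIrreducible_projImage hZ hne)
  refine tdeg_le_add (projHom pr hZ hne) (projHom_injective pr hZ hne) ht
    (adjoin_entryClass hβ Z) ?_
  set C := Algebra.adjoin k (Set.range (projHom pr hZ hne) ∪ t)
  have hker : ∀ s u, a s = 0 → entryClass β Z s u ∈ C := fun s u hs =>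
    Algebra.subset_adjoin (Or.inl ⟨formClass _ (entry β' ⟨s, hs⟩ u), by
      rw [projHom_formClass]
      exact congrArg _ (LinearMap.ext fun x => h.compat x ⟨s, hs⟩ u)⟩)
  rintro _ ⟨⟨s, u⟩, rfl⟩
  have hs : entryClass β Z s u₁ ∈ C := by
    have : entryClass β Z s u₁ = entryClass β Z (s - a s • s₀) u₁ + a s • entryClass β Z s₀ u₁ := by
      rw [entryClass, entryClass, entryClass, ← formClass_smul, ← formClass_add]
      congr 1
      ext x
      simp
    rw [this]
    exact C.add_mem (hker _ _ (by simp [hs₀])) (C.smul_mem hmem _)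
  refine isAlgebraic_of_mul_mem (hker s₁ u₁ hs₁) h1 (C.mul_mem hs (hker s₁ u hs₁)) ?_
  refine formClass_mul_eq fun w hw => ?_
  have := isRankOne_iff.1 (mem_cone_rankOneSet.1 (cone_mono hZβ hw)).2 s₁ s u₁ u
  simp only [entry_apply]
  rw [this, mul_comm]

omit [FiniteDimensional k U] [FiniteDimensional k U'] [IsAlgClosed k] in
theorem IsFirstProjection.exists_ne_zero (h : IsFirstProjection β a β' pr) {w : U} (hw : pr w ≠ 0) :
    ∃ s u, a s = 0 ∧ β w s u ≠ 0 := by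
  by_contra! hcon
  exact hw (h.inj _ fun s u => by rw [h.compat]; exact hcon s u s.2)

/-- The missing entry `β(s₀,u₁)` is simply adjoined, which costs one dimension. -/
theorem IsFirstProjection.coneDim_le_add_one (h : IsFirstProjection β a β' pr)
    (hβ : IsSteinerForm β) (ha : a ≠ 0) {Z : Set (ℙ k U)} (hZ : IsIrreducible Z)
    (hZβ : Z ⊆ rankOneSet β) (hne : ∃ w ∈ cone Z, pr w ≠ 0) :
    coneDim Z ≤ coneDim (projImage pr Z) + 1 := by
  obtain ⟨s₀, hs₀⟩ := exists_apply_eq_one ha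
  obtain ⟨w, hw, hpr⟩ := id hne
  obtain ⟨s₁, u₁, hs₁, h1⟩ := h.exists_ne_zero hpr
  have := coneDim_le_add_ncard hβ h hZ hZβ hne hs₀ hs₁ (u₁ := u₁)
    (fun h0 => h1 (formClass_eq_zero.1 h0 w hw)) (Set.finite_singleton (entryClass β Z s₀ u₁))
    (Algebra.subset_adjoin (Or.inr rfl))
  rwa [Set.ncard_singleton] at this

/-- If a vector `u₁` kills the centre but not the family, the entry at `(s₀, u₁)` vanishes on the
kernel of the projection, hence is pulled back from the target. Nothing needs to be adjoined. -/
theorem IsFirstProjection.coneDim_le_or (h : IsFirstProjection β a β' pr)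
    (hβ : IsSteinerForm β) (ha : a ≠ 0) {Z : Set (ℙ k U)} (hZ : IsIrreducible Z)
    (hZβ : Z ⊆ rankOneSet β) :
    coneDim Z ≤ coneDim (projImage pr Z) ∨
      ∀ u, (∀ x ∈ firstKer β a, ∀ s, β x s u = 0) → ∀ w ∈ cone Z, ∀ s, β w s u = 0 := by
  by_contra! hcon
  obtain ⟨hlt, u₁, hu₁, w, hw, s, hs⟩ := hcon
  refine hlt.not_ge ?_
  obtain ⟨s₀, hs₀⟩ := exists_apply_eq_one ha
  have hpr : pr w ≠ 0 := fun h0 => hs (hu₁ w (h.ker_eq ▸ h0) s)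
  have hne : ∃ w ∈ cone Z, pr w ≠ 0 := ⟨w, hw, hpr⟩
  obtain ⟨s₁, u, hs₁, h1⟩ := h.exists_ne_zero hpr
  have h2 : β w s₁ u₁ ≠ 0 := by
    obtain ⟨b, g, hbg⟩ := (mem_cone_rankOneSet.1 (cone_mono hZβ hw)).2
    rw [hbg] at hs h1 ⊢
    exact mul_ne_zero (left_ne_zero_of_mul h1) (right_ne_zero_of_mul hs)
  have h3 : entry β s₀ u₁ ∈ LinearMap.range pr.dualMap := by
    rw [LinearMap.range_dualMap_eq_dualAnnihilator_ker, h.ker_eq, Submodule.mem_dualAnnihilator]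
    exact fun x hx => hu₁ x hx s₀
  obtain ⟨f, hf⟩ := h3
  have := coneDim_le_add_ncard hβ h hZ hZβ hne hs₀ hs₁ (u₁ := u₁)
    (fun h0 => h2 (formClass_eq_zero.1 h0 w hw)) Set.finite_empty
    (Algebra.subset_adjoin (Or.inl ⟨formClass _ f, by
      rw [projHom_formClass, entryClass, ← hf]
      rfl⟩))
  simpa using this

omit [IsAlgClosed k] [FiniteDimensional k U] [FiniteDimensional k U'] in
theorem IsFirstProjection.projImage_subset_rankOneSet (h : IsFirstProjection β a β' pr)
    {Z : Set (ℙ k U)} (hZβ : Z ⊆ rankOneSet β) : projImage pr Z ⊆ rankOneSet β' :=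
  projImage_subset (isClosed_rankOneSet β') fun _ hw h0 =>
    mem_cone_rankOneSet.2 ⟨h0, h.isRankOne (mem_cone_rankOneSet.1 (cone_mono hZβ hw)).2⟩

end ProjectionDim

/-! ### The dimension of families of elements of rank one -/

section UpperBound

variable {k : Type*} [Field k] [IsAlgClosed k]

section Step

variable {U : Type*} [AddCommGroup U] [Module k U] [FiniteDimensional k U]
  {S : Type*} [AddCommGroup S] [Module k S] [FiniteDimensional k S]
  {V : Type*} [AddCommGroup V] [Module k V] [FiniteDimensional k V]
  {β : U →ₗ[k] S →ₗ[k] V →ₗ[k] k}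

omit [FiniteDimensional k S] [FiniteDimensional k V] [IsAlgClosed k] [FiniteDimensional k U] in
/-- A nonzero element of rank one is the product of nonzero forms. -/
theorem exists_factors (hβ : IsSteinerForm β) {w : U} (hw : w ≠ 0) (h : IsRankOne β w) :
    ∃ (b : Dual k S) (g : Dual k V), b ≠ 0 ∧ g ≠ 0 ∧ ∀ s u, β w s u = b s * g u := by
  obtain ⟨b, g, hbg⟩ := h
  refine ⟨b, g, ?_, ?_, hbg⟩
  · rintro rfl
    exact hw (hβ.inj w fun s u => by simp [hbg])
  · rintro rfl
    exact hw (hβ.inj w fun s u => by simp [hbg])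

theorem coneDim_le_finrank {K : Submodule k U} {Z : Set (ℙ k U)} (hZ : IsIrreducible Z)
    (hZc : IsClosed Z) (h : Z ⊆ linSet K) : coneDim Z ≤ finrank k K := by
  have hK : K ≠ ⊥ := by
    rintro rfl
    obtain ⟨x, hx⟩ := hZ.1
    exact x.rep_nonzero ((mem_cone_linSet.1 (rep_mem_cone.2 (h hx))).2)
  rw [← coneDim_linSet hK]
  exact coneDim_mono hZ (isIrreducible_linSet hK) hZc (isClosed_linSet K) h

/-- Pass to `ker a`, where `a` is a first factor in `Z` and `κ = dim firstKer β a ≥ 1`. If `κ ≥ 2`,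
the drop of `dim U` pays for the lost dimension. If `κ = 1`, either nothing is lost or all second
factors in `Z` are proportional to `g`; then `Z` lies in a linear space bounded by Hopf's
inequality. The same inequality settles the case where `Z` lies in the centre. -/
theorem coneDim_rankOne_step (hβ : IsSteinerForm β) (hp : 2 ≤ finrank k S) (hq : 2 ≤ finrank k V)
    (ih : ∀ a : Dual k S, a ≠ 0 → ∀ Z : Set (ℙ k (U ⧸ firstKer β a)), IsIrreducible Z →
      IsClosed Z → Z ⊆ rankOneSet (restrictQuot β a) →
      coneDim Z + finrank k (LinearMap.ker a) + finrank k V ≤ finrank k (U ⧸ firstKer β a) + 3)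
    {Z : Set (ℙ k U)} (hZ : IsIrreducible Z) (hZc : IsClosed Z) (hZβ : Z ⊆ rankOneSet β) :
    coneDim Z + finrank k S + finrank k V ≤ finrank k U + 3 := by
  obtain ⟨x, hx⟩ := hZ.1
  obtain ⟨a, g, ha, hg, hag⟩ := exists_factors hβ x.rep_nonzero (hZβ hx)
  have hK := hβ.finrank_firstKer_le ha hp (by omega)
  have hpr := isFirstProjection_mkQ β a
  by_cases hne : ∃ w ∈ cone Z, (firstKer β a).mkQ w ≠ 0
  · have hfin := hpr.finrank_add
    have hS := finrank_ker_add_one ha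
    have hZ' := ih a ha _ (isIrreducible_projImage hZ hne) (isClosed_projImage _ _)
      (hpr.projImage_subset_rankOneSet hZβ)
    have hxK : x.rep ∈ firstKer β a := (mem_firstKer_iff ha).2 ⟨g, hag⟩
    have hK1 : 1 ≤ finrank k (firstKer β a) :=
      Submodule.one_le_finrank_iff.2 fun h0 => x.rep_nonzero (by simpa [h0] using hxK)
    by_cases hK2 : 2 ≤ finrank k (firstKer β a)
    · have := hpr.coneDim_le_add_one hβ ha hZ hZβ hne
      omega
    · rcases hpr.coneDim_le_or hβ ha hZ hZβ with h | h
      · omega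
      · have h2 : Z ⊆ linSet (firstKer (swapForm β) g) := by
          refine cone_subset_cone.1 fun w hw => mem_cone_linSet.2 ⟨ne_zero_of_mem_cone hw, ?_⟩
          intro u hu s
          refine h u (fun y hy s => ?_) w hw s
          have hK3 : finrank k (firstKer β a) = 1 := by omega
          obtain ⟨c, hc⟩ := (finrank_eq_one_iff_of_nonzero' (⟨x.rep, hxK⟩ : firstKer β a)
            (fun h0 => x.rep_nonzero (congrArg Subtype.val h0))).1 hK3 ⟨y, hy⟩
          have hc' : c • x.rep = y := congrArg Subtype.val hc
          simp [← hc', hag, hu]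
        have h3 := coneDim_le_finrank hZ hZc h2
        have h4 := hβ.swap.finrank_firstKer_le hg hq (by omega)
        omega
  · push Not at hne
    have h2 : Z ⊆ linSet (firstKer β a) := by
      refine cone_subset_cone.1 fun w hw => mem_cone_linSet.2 ⟨ne_zero_of_mem_cone hw, ?_⟩
      rw [← hpr.ker_eq]
      exact hne w hw
    have := coneDim_le_finrank hZ hZc h2
    omega

end Step

/-- The induction runs on `dim S`. For `dim V = 2` it can start at `dim S = 1`, where the bound is
just `coneDim Z ≤ dim U`. -/
theorem coneDim_rankOne_le_of_two {V : Type*} [AddCommGroup V] [Module k V] [FiniteDimensional k V]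
    (hV : finrank k V = 2) (N : ℕ) :
    ∀ {U S : Type _} [AddCommGroup U] [Module k U] [FiniteDimensional k U]
      [AddCommGroup S] [Module k S] [FiniteDimensional k S] {β : U →ₗ[k] S →ₗ[k] V →ₗ[k] k}
      (_ : IsSteinerForm β) (_ : finrank k S = N + 1)
      {Z : Set (ℙ k U)} (_ : IsIrreducible Z) (_ : IsClosed Z) (_ : Z ⊆ rankOneSet β),
      coneDim Z + finrank k S + finrank k V ≤ finrank k U + 3 := by
  induction N with
  | zero =>
    intro U S _ _ _ _ _ _ β _ hS Z hZ hZc _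
    have := coneDim_le_finrank (K := ⊤) hZ hZc fun x _ =>
      (Submodule.mem_top : x.rep ∈ (⊤ : Submodule k U))
    rw [finrank_top] at this
    omega
  | succ N ih =>
    intro U S _ _ _ _ _ _ β hβ hS Z hZ hZc hZβ
    refine coneDim_rankOne_step hβ (by omega) hV.ge (fun a ha Z hZ hZc hZβ => ?_) hZ hZc hZβ
    have := finrank_ker_add_one ha
    exact ih ((isFirstProjection_mkQ β a).steiner hβ) (by omega) hZ hZc hZβ

/-- The induction runs on `dim V` through the exchanged forms and starts at `dim V = 2`. It keeps
`dim S ≥ 2` fixed: for `dim S = 1` all forms have rank one, and the bound can fail when `dim V ≥ 3`.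
-/
theorem coneDim_rankOne_le_of_le {S : Type*} [AddCommGroup S] [Module k S] [FiniteDimensional k S]
    (hS : 2 ≤ finrank k S) (N : ℕ) :
    ∀ {U V : Type _} [AddCommGroup U] [Module k U] [FiniteDimensional k U]
      [AddCommGroup V] [Module k V] [FiniteDimensional k V] {β : U →ₗ[k] S →ₗ[k] V →ₗ[k] k}
      (_ : IsSteinerForm β) (_ : finrank k V = N + 2)
      {Z : Set (ℙ k U)} (_ : IsIrreducible Z) (_ : IsClosed Z) (_ : Z ⊆ rankOneSet β),
      coneDim Z + finrank k S + finrank k V ≤ finrank k U + 3 := by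
  induction N with
  | zero =>
    intro U V _ _ _ _ _ _ β hβ hV Z hZ hZc hZβ
    obtain ⟨m, hm⟩ := Nat.exists_eq_add_of_le' hS
    exact coneDim_rankOne_le_of_two hV (m + 1) hβ hm hZ hZc hZβ
  | succ N ih =>
    intro U V _ _ _ _ _ _ β hβ hV Z hZ hZc hZβ
    have := coneDim_rankOne_step hβ.swap (by omega) hS (fun a ha Z hZ hZc hZβ => ?_) hZ hZc
      (by rwa [rankOneSet_swap])
    · omega
    · have h1 := finrank_ker_add_one ha
      have := ih ((isFirstProjection_mkQ (swapForm β) a).steiner hβ.swap).swap (by omega) hZ hZc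
        (by rwa [rankOneSet_swap])
      omega

theorem IsSteinerForm.coneDim_le {U : Type*} [AddCommGroup U] [Module k U] [FiniteDimensional k U]
    {S : Type*} [AddCommGroup S] [Module k S] [FiniteDimensional k S]
    {V : Type*} [AddCommGroup V] [Module k V] [FiniteDimensional k V]
    {β : U →ₗ[k] S →ₗ[k] V →ₗ[k] k} (hβ : IsSteinerForm β) (hp : 1 ≤ finrank k S)
    (hq : 2 ≤ finrank k V) (h : 2 ≤ finrank k S ∨ finrank k V = 2)
    {Z : Set (ℙ k U)} (hZ : IsIrreducible Z) (hZc : IsClosed Z) (hZβ : Z ⊆ rankOneSet β) :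
    coneDim Z + finrank k S + finrank k V ≤ finrank k U + 3 := by
  rcases h with h | h
  · obtain ⟨m, hm⟩ := Nat.exists_eq_add_of_le' hq
    exact coneDim_rankOne_le_of_le h m hβ hm hZ hZc hZβ
  · obtain ⟨m, hm⟩ := Nat.exists_eq_add_of_le' hp
    exact coneDim_rankOne_le_of_two h m hβ hm hZ hZc hZβ

end UpperBound

end

noncomputable section

/-! ### Factors of elements of rank one -/

section Factors

variable {k : Type*} [Field k] {U : Type*} [AddCommGroup U] [Module k U]
  {S : Type*} [AddCommGroup S] [Module k S] {V : Type*} [AddCommGroup V] [Module k V]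
  {β : U →ₗ[k] S →ₗ[k] V →ₗ[k] k}

theorem exists_eq_smul {W : Type*} [AddCommGroup W] [Module k W] {f f' : Dual k W} (hf : f ≠ 0)
    (h : ∀ s s', f s * f' s' = f s' * f' s) : ∃ c : k, f' = c • f := by
  obtain ⟨s, hs⟩ := exists_apply_eq_one hf
  refine ⟨f' s, LinearMap.ext fun s' => ?_⟩
  have := h s s'
  rw [hs, one_mul] at this
  rw [this, LinearMap.smul_apply, smul_eq_mul, mul_comm]

/-- `x` is the product of the linear forms `b` and `g`. -/
def IsProd (β : U →ₗ[k] S →ₗ[k] V →ₗ[k] k) (x : U) (b : Dual k S) (g : Dual k V) : Prop :=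
  ∀ s u, β x s u = b s * g u

namespace IsProd

variable {x x' : U} {b b' : Dual k S} {g g' : Dual k V}

theorem isRankOne (h : IsProd β x b g) : IsRankOne β x := ⟨b, g, h⟩

theorem swap (h : IsProd β x b g) : IsProd (swapForm β) x g b := fun u s => by
  rw [swapForm_apply, h, mul_comm]

theorem smul_left (h : IsProd β x b g) (c : k) : IsProd β (c • x) (c • b) g := fun s u => by
  simp [h s u, mul_assoc]

theorem add_left (h : IsProd β x b g) (h' : IsProd β x' b' g) : IsProd β (x + x') (b + b') g :=
  fun s u => by simp [h s u, h' s u, add_mul]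

theorem add_right (h : IsProd β x b g) (h' : IsProd β x' b g') : IsProd β (x + x') b (g + g') :=
  fun s u => by simp [h s u, h' s u, mul_add]

theorem smul_right (h : IsProd β x b g) (c : k) : IsProd β (c • x) b (c • g) := fun s u => by
  simp [h s u, mul_left_comm]

theorem eq (hβ : IsSteinerForm β) (h : IsProd β x b g) (h' : IsProd β x' b g) : x = x' := by
  rw [← sub_eq_zero]
  exact hβ.inj _ fun s u => by simp [h s u, h' s u]

theorem ne_zero (h : IsProd β x b g) (hb : b ≠ 0) (hg : g ≠ 0) : x ≠ 0 := by
  rintro rfl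
  obtain ⟨s, hs⟩ := exists_apply_eq_one hb
  obtain ⟨u, hu⟩ := exists_apply_eq_one hg
  simpa [hs, hu] using h s u

theorem left_ne_zero (hβ : IsSteinerForm β) (h : IsProd β x b g) (hx : x ≠ 0) : b ≠ 0 := by
  rintro rfl
  exact hx (hβ.inj x fun s u => by simp [h s u])

theorem right_ne_zero (hβ : IsSteinerForm β) (h : IsProd β x b g) (hx : x ≠ 0) : g ≠ 0 :=
  h.swap.left_ne_zero hβ.swap hx

theorem exists_left_eq_smul (h : IsProd β x b g) (h' : IsProd β x b' g') (hg' : g' ≠ 0) :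
    ∃ c : k, b' = c • b := by
  obtain ⟨u, hu⟩ := exists_apply_eq_one hg'
  refine ⟨g u, LinearMap.ext fun s => ?_⟩
  have := (h' s u).symm.trans (h s u)
  rw [hu, mul_one] at this
  rw [this, LinearMap.smul_apply, smul_eq_mul, mul_comm]

theorem exists_right_eq_smul (h : IsProd β x b g) (h' : IsProd β x b' g') (hb' : b' ≠ 0) :
    ∃ c : k, g' = c • g :=
  h.swap.exists_left_eq_smul h'.swap hb'

theorem mem_firstKer (h : IsProd β x b g) : x ∈ firstKer β b := fun s hs u => by
  rw [h, hs, zero_mul]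

/-- Change of the second factor to a proportional one. -/
theorem congr_right (hβ : IsSteinerForm β) (h : IsProd β x b g) (hx : x ≠ 0) {c : k}
    (hc : g = c • g') : c • b ≠ 0 ∧ IsProd β x (c • b) g' := by
  have : IsProd β x (c • b) g' := fun s u => by
    rw [h, hc]
    simp only [LinearMap.smul_apply, smul_eq_mul]
    ring
  exact ⟨this.left_ne_zero hβ hx, this⟩

end IsProd

theorem exists_isProd (hβ : IsSteinerForm β) {x : U} (hx : x ∈ cone (rankOneSet β)) :
    ∃ (b : Dual k S) (g : Dual k V), b ≠ 0 ∧ g ≠ 0 ∧ IsProd β x b g := by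
  obtain ⟨hx0, hx1⟩ := mem_cone_rankOneSet.1 hx
  exact exists_factors hβ hx0 hx1

theorem exists_isProd_of_mem_firstKer {a : Dual k S} (ha : a ≠ 0) {x : U} (hx : x ∈ firstKer β a) :
    ∃ g, IsProd β x a g := (mem_firstKer_iff ha).1 hx

theorem IsProd.mem_cone_rankOneSet {x : U} {b : Dual k S} {g : Dual k V} (h : IsProd β x b g)
    (hx : x ≠ 0) : x ∈ cone (rankOneSet β) := _root_.mem_cone_rankOneSet.2 ⟨hx, h.isRankOne⟩

theorem eq_add_smul_of_ker {a b b' : Dual k S} (h : ∀ s, a s = 0 → b s = b' s) :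
    ∃ c : k, b = b' + c • a := by
  by_cases ha : a = 0
  · exact ⟨0, LinearMap.ext fun s => by simp [h s (by simp [ha])]⟩
  obtain ⟨s₀, hs₀⟩ := exists_apply_eq_one ha
  refine ⟨b s₀ - b' s₀, LinearMap.ext fun s => ?_⟩
  have := h (s - a s • s₀) (by simp [hs₀])
  simp only [map_sub, map_smul, smul_eq_mul] at this
  simp only [LinearMap.add_apply, LinearMap.smul_apply, smul_eq_mul]
  linear_combination this

theorem IsFirstProjection.isProd {a : Dual k S} {U' : Type*} [AddCommGroup U'] [Module k U']
    {β' : U' →ₗ[k] LinearMap.ker a →ₗ[k] V →ₗ[k] k} {pr : U →ₗ[k] U'}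
    (h : IsFirstProjection β a β' pr) {x : U} {b : Dual k S} {g : Dual k V} (hx : IsProd β x b g) :
    IsProd β' (pr x) (b ∘ₗ (LinearMap.ker a).subtype) g := fun s u => by
  rw [h.compat, hx]
  rfl

end Factors

/-! ### Families of elements of rank one of maximal dimension -/

section MaximalDim

variable {k : Type*} [Field k] [IsAlgClosed k]
  {U : Type*} [AddCommGroup U] [Module k U] [FiniteDimensional k U]
  {S : Type*} [AddCommGroup S] [Module k S] [FiniteDimensional k S]
  {V : Type*} [AddCommGroup V] [Module k V] [FiniteDimensional k V]
  {β : U →ₗ[k] S →ₗ[k] V →ₗ[k] k}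

variable (β) in
/-- An irreducible closed set of elements of rank one of the maximal possible dimension. -/
structure IsMaxFamily (J : Set (ℙ k U)) : Prop where
  steiner : IsSteinerForm β
  irreducible : IsIrreducible J
  closed : IsClosed J
  subset : J ⊆ rankOneSet β
  two_le_left : 2 ≤ finrank k S
  two_le_right : 2 ≤ finrank k V
  le_dim : finrank k U + 3 ≤ coneDim J + finrank k S + finrank k V

variable {J : Set (ℙ k U)}

namespace IsMaxFamily

omit [IsAlgClosed k] [FiniteDimensional k U] [FiniteDimensional k S] [FiniteDimensional k V] in
theorem swap (hJ : IsMaxFamily β J) : IsMaxFamily (swapForm β) J where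
  steiner := hJ.steiner.swap
  irreducible := hJ.irreducible
  closed := hJ.closed
  subset := by rw [rankOneSet_swap]; exact hJ.subset
  two_le_left := hJ.two_le_right
  two_le_right := hJ.two_le_left
  le_dim := by have := hJ.le_dim; omega

theorem dim_eq (hJ : IsMaxFamily β J) :
    coneDim J + finrank k S + finrank k V = finrank k U + 3 :=
  le_antisymm (hJ.steiner.coneDim_le (by have := hJ.two_le_left; omega) hJ.two_le_right
    (Or.inl hJ.two_le_left) hJ.irreducible hJ.closed hJ.subset) hJ.le_dim

omit [FiniteDimensional k V] in
-- By Hopf's inequality the linear space of forms with first factor `a` has dimension smaller by at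
-- least one than a family of maximal dimension.
theorem not_subset_firstKer (hJ : IsMaxFamily β J) {a : Dual k S} (ha : a ≠ 0) :
    ¬ J ⊆ linSet (firstKer β a) := fun h => by
  have h1 := coneDim_le_finrank hJ.irreducible hJ.closed h
  have h2 := hJ.steiner.finrank_firstKer_le ha hJ.two_le_left
    (by have := hJ.two_le_right; omega)
  have := hJ.le_dim
  omega

omit [FiniteDimensional k S] in
theorem not_subset_secondKer (hJ : IsMaxFamily β J) {g : Dual k V} (hg : g ≠ 0) :
    ¬ J ⊆ linSet (firstKer (swapForm β) g) := hJ.swap.not_subset_firstKer hg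

variable {a : Dual k S} {U' : Type*} [AddCommGroup U'] [Module k U'] [FiniteDimensional k U']
  {β' : U' →ₗ[k] LinearMap.ker a →ₗ[k] V →ₗ[k] k} {pr : U →ₗ[k] U'}

omit [FiniteDimensional k V] [FiniteDimensional k U'] in
theorem exists_ne_zero (hJ : IsMaxFamily β J) (h : IsFirstProjection β a β' pr) (ha : a ≠ 0) :
    ∃ w ∈ cone J, pr w ≠ 0 := by
  by_contra! hcon
  refine hJ.not_subset_firstKer ha (cone_subset_cone.1 fun w hw => mem_cone_linSet.2
    ⟨ne_zero_of_mem_cone hw, ?_⟩)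
  rw [← h.ker_eq]
  exact hcon w hw

/-- This is the general bound for the target, expressed by `coneDim J` through `dim U' = dim U - κ`
and `dim ker a = dim S - 1`. -/
theorem coneDim_add_le (hJ : IsMaxFamily β J) (h : IsFirstProjection β a β' pr) (ha : a ≠ 0)
    (hpq : 3 ≤ finrank k S ∨ finrank k V = 2) {Z : Set (ℙ k U')} (hZ : IsIrreducible Z)
    (hZc : IsClosed Z) (hZβ : Z ⊆ rankOneSet β') :
    coneDim Z + finrank k (firstKer β a) ≤ coneDim J + 1 := by
  have h1 := finrank_ker_add_one ha
  have h2 := hJ.two_le_left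
  have h3 := (h.steiner hJ.steiner).coneDim_le (by omega) hJ.two_le_right
    (hpq.imp_left fun _ => by omega) hZ hZc hZβ
  have h4 := hJ.le_dim
  have h5 := h.finrank_add
  omega

omit [IsAlgClosed k] [FiniteDimensional k S] [FiniteDimensional k V] in
/-- If all second factors vanish where the elements with first factor `a` do, then the product of
`a` with any second factor is in the space. -/
theorem exists_isProd_of_forall (ha : a ≠ 0) {w : U} {b : Dual k S} {g : Dual k V} (hb : b ≠ 0)
    (hw : IsProd β w b g)
    (H : ∀ u, (∀ x ∈ firstKer β a, ∀ s, β x s u = 0) → ∀ s, β w s u = 0) :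
    ∃ x, IsProd β x a g := by
  obtain ⟨s₀, hs₀⟩ := exists_apply_eq_one ha
  -- `G` is the space of all second factors occurring with first factor `a`. By biduality, a form
  -- vanishing on the common zeros of `G` belongs to `G`.
  let G : Submodule k (Dual k V) := (firstKer β a).map (β.flip s₀)
  have hg : g ∈ G.dualCoannihilator.dualAnnihilator := by
    rw [Submodule.mem_dualAnnihilator]
    intro u hu
    have := H u fun x hx s => by
      rw [apply_eq_mul_of_mem_firstKer hx hs₀]
      have h0 : β x s₀ u = 0 :=
        (Submodule.mem_dualCoannihilator _).1 hu _ (Submodule.mem_map_of_mem hx)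
      rw [h0, mul_zero]
    obtain ⟨s, hs⟩ := exists_apply_eq_one hb
    have := this s
    rwa [hw, hs, one_mul] at this
  rw [Subspace.dualCoannihilator_dualAnnihilator_eq] at hg
  obtain ⟨x, hx, rfl⟩ := hg
  exact ⟨x, apply_eq_mul_of_mem_firstKer hx hs₀⟩

/-- The bound for the target gives loss at least `κ - 1`, while the loss is at most one. If nothing
is lost, then `κ = 1`. Otherwise all second factors vanish where those of the centre do; `κ = 1`
would make them all proportional to one form, against maximality, so `κ = 2`. -/
theorem dim_projImage (hJ : IsMaxFamily β J) (h : IsFirstProjection β a β' pr) (ha : a ≠ 0)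
    (hpq : 3 ≤ finrank k S ∨ finrank k V = 2) {x₀ : U} (hx₀ : x₀ ∈ cone J)
    (hx₀a : x₀ ∈ firstKer β a) :
    coneDim (projImage pr J) + finrank k (firstKer β a) = coneDim J + 1 ∧
      (finrank k (firstKer β a) = 1 ∨ finrank k (firstKer β a) = 2 ∧
        ∀ w ∈ cone J, ∀ b g, IsProd β w b g → ∃ x, IsProd β x a g) := by
  have hne := hJ.exists_ne_zero h ha
  have h1 := hJ.coneDim_add_le h ha hpq (isIrreducible_projImage hJ.irreducible hne)
    (isClosed_projImage _ _) (h.projImage_subset_rankOneSet hJ.subset)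
  have h2 := h.coneDim_le_add_one hJ.steiner ha hJ.irreducible hJ.subset hne
  have hx0 := ne_zero_of_mem_cone hx₀
  have hK1 : 1 ≤ finrank k (firstKer β a) :=
    Submodule.one_le_finrank_iff.2 fun h0 => hx0 (by simpa [h0] using hx₀a)
  rcases h.coneDim_le_or hJ.steiner ha hJ.irreducible hJ.subset with h3 | h3
  · exact ⟨by omega, Or.inl (by omega)⟩
  · have hK : finrank k (firstKer β a) ≠ 1 := by
      intro hK
      obtain ⟨g, hg⟩ := exists_isProd_of_mem_firstKer ha hx₀a
      refine hJ.not_subset_secondKer (hg.right_ne_zero hJ.steiner hx0) (cone_subset_cone.1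
        fun w hw => mem_cone_linSet.2 ⟨ne_zero_of_mem_cone hw, ?_⟩)
      intro u hu s
      refine h3 u (fun y hy s => ?_) w hw s
      obtain ⟨c, hc⟩ := (finrank_eq_one_iff_of_nonzero' (⟨x₀, hx₀a⟩ : firstKer β a)
        (fun h0 => hx0 (congrArg Subtype.val h0))).1 hK ⟨y, hy⟩
      have hc' : c • x₀ = y := congrArg Subtype.val hc
      simp [← hc', hg s u, hu]
    refine ⟨by omega, Or.inr ⟨by omega, fun w hw b g hbg => ?_⟩⟩
    exact exists_isProd_of_forall ha (hbg.left_ne_zero hJ.steiner (ne_zero_of_mem_cone hw)) hbg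
      fun u hu => h3 u hu w hw

/-- If the elements with first factor `a` form a line, and with every element the family contains
the one with the first factor replaced by `a`, then the family contains this line. -/
theorem linSet_firstKer_subset (hJ : IsMaxFamily β J) (ha : a ≠ 0)
    (hK : finrank k (firstKer β a) = 2)
    (H : ∀ w ∈ cone J, w ∉ firstKer β a → ∀ b g, IsProd β w b g → ∃ x ∈ cone J, IsProd β x a g) :
    linSet (firstKer β a) ⊆ J := by
  refine linSet_subset_of_infinite hK hJ.closed fun hfin => ?_
  choose! γ hγ using fun (x : ℙ k U) (hx : x ∈ J ∩ linSet (firstKer β a)) =>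
    exists_isProd_of_mem_firstKer ha hx.2
  -- If `J` met the line in finitely many points only, `J` would be covered by the line and by
  -- finitely many linear spaces of forms with a fixed second factor. By irreducibility one of them
  -- would contain `J`, which its dimension forbids.
  let C : Set (Set (ℙ k U)) := insert (linSet (firstKer β a))
    ((fun x => linSet (firstKer (swapForm β) (γ x))) '' (J ∩ linSet (firstKer β a)))
  have hC : C.Finite := (hfin.image _).insert _
  have hcov : J ⊆ ⋃₀ C := by
    intro y hy
    by_cases hya : y.rep ∈ firstKer β a
    · exact ⟨_, Set.mem_insert _ _, hya⟩
    obtain ⟨b, g, hb, hg, hbg⟩ := exists_isProd hJ.steiner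
      (cone_mono hJ.subset (rep_mem_cone.2 hy))
    obtain ⟨x, hx, hxa⟩ := H _ (rep_mem_cone.2 hy) hya b g hbg
    obtain ⟨hx0, hxJ⟩ := id hx
    have hxK : Projectivization.mk k x hx0 ∈ J ∩ linSet (firstKer β a) :=
      ⟨hxJ, (mem_cone_linSet.2 ⟨hx0, hxa.mem_firstKer⟩).2⟩
    refine ⟨_, Set.mem_insert_of_mem _ ⟨_, hxK, rfl⟩, ?_⟩
    obtain ⟨c, hc, hrep⟩ := exists_smul_rep_mk (k := k) hx0
    have h1 := hγ _ hxK
    rw [hrep] at h1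
    obtain ⟨d, hd⟩ := h1.exists_right_eq_smul (hxa.smul_right c) ha
    show y.rep ∈ firstKer (swapForm β) _
    intro u hu s
    have : c * g u = 0 := by
      have := DFunLike.congr_fun hd u
      simpa [hu] using this
    rw [swapForm_apply, hbg, (mul_eq_zero.1 this).resolve_left hc, mul_zero]
  obtain ⟨Z, hZ, hJZ⟩ := (isIrreducible_iff_sUnion_isClosed.1 hJ.irreducible) hC.toFinset
    (fun Z hZ => by
      rcases hC.mem_toFinset.1 hZ with rfl | ⟨x, -, rfl⟩
      · exact isClosed_linSet _
      · exact isClosed_linSet _) (by rwa [Set.Finite.coe_toFinset])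
  rcases hC.mem_toFinset.1 hZ with rfl | ⟨x, hx, rfl⟩
  · exact hJ.not_subset_firstKer ha hJZ
  · exact hJ.not_subset_secondKer ((hγ x hx).right_ne_zero hJ.steiner x.rep_nonzero) hJZ

end IsMaxFamily

end MaximalDim

end

noncomputable section

/-! ### The irreducible case -/

section Cone

variable {k : Type*} [Field k] {W : Type*} [AddCommGroup W] [Module k W]

theorem mem_cone_inter {A B : Set (ℙ k W)} {w : W} : w ∈ cone (A ∩ B) ↔ w ∈ cone A ∧ w ∈ cone B :=
  ⟨fun ⟨h, hA, hB⟩ => ⟨⟨h, hA⟩, ⟨h, hB⟩⟩, fun ⟨⟨h, hA⟩, ⟨_, hB⟩⟩ => ⟨h, hA, hB⟩⟩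

theorem mem_cone_incidence {W' : Type*} [AddCommGroup W'] [Module k W'] {X : Set (ℙ k W)}
    {ι : Type*} {β : ι → W →ₗ[k] W' →ₗ[k] k} {y : W'} :
    y ∈ cone {y : ℙ k W' | ∃ w ∈ cone X, ∀ i, β i w y.rep = 0} ↔
      y ≠ 0 ∧ ∃ w ∈ cone X, ∀ i, β i w y = 0 := by
  constructor
  · rintro ⟨hy, w, hw, h⟩
    obtain ⟨c, hc, hrep⟩ := exists_smul_rep_mk (k := k) hy
    refine ⟨hy, w, hw, fun i => ?_⟩
    have := h i
    rw [hrep, map_smul, smul_eq_mul] at this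
    exact (mul_eq_zero.1 this).resolve_left hc
  · rintro ⟨hy, w, hw, h⟩
    obtain ⟨c, hc, hrep⟩ := exists_smul_rep_mk (k := k) hy
    refine ⟨hy, w, hw, fun i => ?_⟩
    rw [hrep, map_smul, h i, smul_zero]

theorem mem_cone_of_smul {A : Set (ℙ k W)} {w : W} {c : k} (hc : c ≠ 0) (h : c • w ∈ cone A) :
    w ∈ cone A := by
  have := smul_mem_cone h (inv_ne_zero hc)
  rwa [smul_smul, inv_mul_cancel₀ hc, one_smul] at this

/-- A maximal irreducible subset is invariant under a one-parameter family of linear maps. -/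
theorem add_smul_mem_cone_of_maximal [Infinite k] {X J : Set (ℙ k W)} (hJ : IsIrreducible J)
    (hmax : ∀ A, IsIrreducible A → A ⊆ X → J ⊆ A → A ⊆ J) (hJX : J ⊆ X) (N : W →ₗ[k] W)
    (hN : ∀ w ∈ cone X, ∀ c : k, w + c • N w ∈ cone X) {w : W} (hw : w ∈ cone J) (c : k) :
    w + c • N w ∈ cone J := by
  -- The union of all translates of `J` is shown to be irreducible; by maximality it is then `J`.
  let A : Set (ℙ k W) := {x | ∃ w ∈ cone J, ∃ c : k, x.rep = w + c • N w}
  have hA : ∀ v, v ∈ cone A ↔ v ≠ 0 ∧ ∃ w ∈ cone J, ∃ c : k, v = w + c • N w := by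
    intro v
    constructor
    · rintro ⟨hv, w, hw, c, h⟩
      obtain ⟨d, hd, hrep⟩ := exists_smul_rep_mk (k := k) hv
      refine ⟨hv, d⁻¹ • w, smul_mem_cone hw (inv_ne_zero hd), c, ?_⟩
      rw [hrep] at h
      rw [map_smul, smul_comm c, ← smul_add, ← h, smul_smul, inv_mul_cancel₀ hd, one_smul]
    · rintro ⟨hv, w, hw, c, h⟩
      obtain ⟨d, hd, hrep⟩ := exists_smul_rep_mk (k := k) hv
      refine ⟨hv, d • w, smul_mem_cone hw hd, c, ?_⟩
      rw [hrep, h, smul_add, map_smul, smul_comm c]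
  have hJA : J ⊆ A := cone_subset_cone.1 fun w hw =>
    (hA w).2 ⟨ne_zero_of_mem_cone hw, w, hw, 0, by simp⟩
  have hAX : A ⊆ X := cone_subset_cone.1 fun v hv => by
    obtain ⟨-, w, hw, c, rfl⟩ := (hA v).1 hv
    exact hN w (cone_mono hJX hw) c
  have hAirr : IsIrreducible A := by
    refine isIrreducible_of_vanI (hJ.1.mono hJA) fun p q hpq => ?_
    have hpoly : ∀ p : MvPolynomial (Dual k W) k,
        {c : k | pullback (LinearMap.id + c • N) p ∈ vanI J}.Infinite → p ∈ vanI A := by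
      intro p hp v hv
      obtain ⟨-, w, hw, c, rfl⟩ := (hA v).1 hv
      let P : Polynomial k := MvPolynomial.aeval
        (fun f : Dual k W => Polynomial.C (f w) + Polynomial.C (f (N w)) * Polynomial.X) p
      have hP : ∀ c, P.eval c = polyEval p (w + c • N w) := by
        intro c
        have : (Polynomial.aeval c).comp (MvPolynomial.aeval
            (fun f : Dual k W => Polynomial.C (f w) + Polynomial.C (f (N w)) * Polynomial.X)) =
            MvPolynomial.aeval fun f : Dual k W => f (w + c • N w) := by
          refine MvPolynomial.algHom_ext fun f => ?_
          rw [AlgHom.comp_apply, MvPolynomial.aeval_X, MvPolynomial.aeval_X, map_add, map_mul, map_add,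
            map_smul, smul_eq_mul, Polynomial.aeval_C, Polynomial.aeval_C,
            Polynomial.aeval_X, mul_comm]
          rfl
        exact DFunLike.congr_fun this p
      have hP0 : P = 0 := by
        refine Polynomial.eq_zero_of_infinite_isRoot P (hp.mono fun c hc => ?_)
        have := hc w hw
        rw [polyEval_pullback] at this
        rw [Set.mem_ofPred_eq, Polynomial.IsRoot, hP]
        exact this
      rw [← hP, hP0, Polynomial.eval_zero]
    have hprime := vanI_isPrime hJ
    -- For each `c`, one of the two factors vanishes on the translate of `J` by `c`. One of them
    -- therefore does so for infinitely many `c`, and hence for all `c`.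
    have hunion : {c : k | pullback (LinearMap.id + c • N) p ∈ vanI J} ∪
        {c : k | pullback (LinearMap.id + c • N) q ∈ vanI J} = Set.univ := by
      refine Set.eq_univ_of_forall fun c => hprime.mem_or_mem ?_
      rw [← map_mul]
      intro w hw
      rw [polyEval_pullback]
      have h1 : w + c • N w ∈ cone A :=
        (hA _).2 ⟨ne_zero_of_mem_cone (hN w (cone_mono hJX hw) c), w, hw, c, rfl⟩
      simpa using hpq _ h1
    have hinf : (Set.univ : Set k).Infinite := Set.infinite_univ
    rw [← hunion, Set.infinite_union] at hinf
    exact hinf.imp (hpoly p) (hpoly q)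
  exact cone_mono (hmax A hAirr hAX hJA)
    ((hA _).2 ⟨ne_zero_of_mem_cone (hN w (cone_mono hJX hw) c), w, hw, c, rfl⟩)

end Cone

/-! ### Lifting points of the closed image by elimination. -/

section Irreducible

variable {k : Type*} [Field k] [IsAlgClosed k]
  {U : Type*} [AddCommGroup U] [Module k U] [FiniteDimensional k U]
  {S : Type*} [AddCommGroup S] [Module k S]
  {V : Type*} [AddCommGroup V] [Module k V]
  {β : U →ₗ[k] S →ₗ[k] V →ₗ[k] k} {J : Set (ℙ k U)}
  {a : Dual k S} {U' : Type*} [AddCommGroup U'] [Module k U']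
  {β' : U' →ₗ[k] LinearMap.ker a →ₗ[k] V →ₗ[k] k} {pr : U →ₗ[k] U'}

/-- Every point of the image has a preimage with the same second factor and a first factor that
restricts to a multiple of the given one. -/
theorem IsFirstProjection.exists_over (h : IsFirstProjection β a β' pr) (hβ : IsSteinerForm β)
    {Q : Set (ℙ k U)} (hQc : IsClosed Q) (hQβ : Q ⊆ rankOneSet β)
    (hQ : ∀ w ∈ cone J, pr w ≠ 0 → ∃ w' ∈ cone Q, pr w' = pr w) {y : U'}
    (hy : y ∈ cone (projImage pr J)) {b₁ : Dual k S} {g : Dual k V}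
    (hbg : IsProd β' y (b₁ ∘ₗ (LinearMap.ker a).subtype) g) :
    ∃ w ∈ cone Q, ∃ b, b ≠ 0 ∧ IsProd β w b g ∧ ∃ c e : k, b = c • b₁ + e • a := by
  -- The first family of equations says that `w` and `y` have proportional second factors; the
  -- second says that the first factor of `w`, restricted to `ker a`, is proportional to that of
  -- `y`. The restriction may vanish, so `w` may lie in the centre.
  let B : (S × LinearMap.ker a × V × V) ⊕ (LinearMap.ker a × LinearMap.ker a × V × V) →
      U →ₗ[k] U' →ₗ[k] k
    | .inl (s, s', u, u') => (entry β s u).smulRight (entry β' s' u') -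
        (entry β s u').smulRight (entry β' s' u)
    | .inr (s, s', u, u') => (entry β s u).smulRight (entry β' s' u') -
        (entry β s' u).smulRight (entry β' s u')
  have hsub : projImage pr J ⊆ {y : ℙ k U' | ∃ w ∈ cone Q, ∀ i, B i w y.rep = 0} := by
    refine projImage_subset (isClosed_incidence hQc B) fun w hw hpr => ?_
    obtain ⟨w', hw', hww'⟩ := hQ w hw hpr
    refine mem_cone_incidence.2 ⟨hpr, w', hw', ?_⟩
    obtain ⟨b, g, -, -, hbg⟩ := exists_isProd hβ (cone_mono hQβ hw')
    rw [← hww']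
    rintro (⟨s, s', u, u'⟩ | ⟨s, s', u, u'⟩)
    · simp [B, h.compat, hbg _ _]
      ring
    · simp [B, h.compat, hbg _ _]
      ring
  obtain ⟨hy0, w, hw, hB⟩ := mem_cone_incidence.1 (cone_mono hsub hy)
  obtain ⟨b₂, g₂, hb₂, hg₂, hbg₂⟩ := exists_isProd hβ (cone_mono hQβ hw)
  have hβ' := h.steiner hβ
  have hb' := hbg.left_ne_zero hβ' hy0
  have hg := hbg.right_ne_zero hβ' hy0
  obtain ⟨s, hs⟩ := exists_apply_eq_one hb₂
  obtain ⟨s', hs'⟩ := exists_apply_eq_one hb'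
  obtain ⟨c, hc⟩ := exists_eq_smul (f := g) (f' := g₂) hg fun u u' => by
    have := hB (.inl (s, s', u, u'))
    simp [B, hbg _ _, hbg₂ _ _, hs, hs'] at this
    linear_combination -this
  obtain ⟨hb, hprod⟩ := hbg₂.congr_right hβ (ne_zero_of_mem_cone hw) hc
  refine ⟨w, hw, _, hb, hprod, ?_⟩
  obtain ⟨u, hu⟩ := exists_apply_eq_one hg
  obtain ⟨d, hd⟩ := exists_eq_smul (f := b₁ ∘ₗ (LinearMap.ker a).subtype)
    (f' := (c • b₂) ∘ₗ (LinearMap.ker a).subtype) hb' fun s s' => by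
      have := hB (.inr (s, s', u, u))
      simp only [B, LinearMap.sub_apply, LinearMap.smulRight_apply, entry_apply, hprod _ _,
        hbg _ _, hu, LinearMap.smul_apply, smul_eq_mul, mul_one] at this
      simp only [LinearMap.comp_apply, Submodule.subtype_apply, LinearMap.smul_apply,
        smul_eq_mul] at this ⊢
      linear_combination -this
  obtain ⟨e, he⟩ := eq_add_smul_of_ker (a := a) (b := c • b₂) (b' := d • b₁) fun s hs =>
    DFunLike.congr_fun hd ⟨s, hs⟩
  exact ⟨d, e, he⟩

theorem IsFirstProjection.exists_over_self (h : IsFirstProjection β a β' pr) (hβ : IsSteinerForm β)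
    (hJβ : J ⊆ rankOneSet β) (hJc : IsClosed J) {y : U'}
    (hy : y ∈ cone (projImage pr J)) {b₁ : Dual k S} {g : Dual k V}
    (hbg : IsProd β' y (b₁ ∘ₗ (LinearMap.ker a).subtype) g) :
    ∃ w ∈ cone J, ∃ b, b ≠ 0 ∧ IsProd β w b g ∧ ∃ c e : k, b = c • b₁ + e • a :=
  h.exists_over hβ hJc hJβ (fun w hw _ => ⟨w, hw, rfl⟩) hy hbg

end Irreducible

end

noncomputable section

/-! ### Irreducibility is inherited from the projection -/

section Inherit

variable {k : Type*} [Field k] [IsAlgClosed k]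
  {U : Type*} [AddCommGroup U] [Module k U] [FiniteDimensional k U]
  {S : Type*} [AddCommGroup S] [Module k S] [FiniteDimensional k S]
  {V : Type*} [AddCommGroup V] [Module k V] [FiniteDimensional k V]
  {β : U →ₗ[k] S →ₗ[k] V →ₗ[k] k} {J : Set (ℙ k U)}
  {a : Dual k S} {U' : Type*} [AddCommGroup U'] [Module k U'] [FiniteDimensional k U']
  {β' : U' →ₗ[k] LinearMap.ker a →ₗ[k] V →ₗ[k] k} {pr : U →ₗ[k] U'}

omit [IsAlgClosed k] [FiniteDimensional k U] [FiniteDimensional k S] [FiniteDimensional k V] in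
theorem exists_smul_eq_of_mem {K : Submodule k U} (hK : finrank k K = 1) {x₀ : U}
    (hx₀ : x₀ ∈ K) (h0 : x₀ ≠ 0) {x : U} (hx : x ∈ K) : ∃ c : k, c • x₀ = x := by
  obtain ⟨c, hc⟩ := (finrank_eq_one_iff_of_nonzero' (⟨x₀, hx₀⟩ : K)
    (fun h => h0 (congrArg Subtype.val h))).1 hK ⟨x, hx⟩
  exact ⟨c, congrArg Subtype.val hc⟩

omit [FiniteDimensional k U] [FiniteDimensional k S] [FiniteDimensional k V] in
/-- A closed set that contains all points but one of a line through an element contains the line. -/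
theorem mem_cone_of_forall_add_smul_mem [FiniteDimensional k U] (hJ : IsClosed J) {K : Submodule k U}
    {x w : U} (hx : x ≠ 0) (hxK : x ∈ K) (hw : w ∉ K) (h : ∀ c : k, w + c • x ∈ cone J) :
    x ∈ cone J := by
  refine mem_cone_of_infinite_line hJ (x := x) (y := w) ?_ Set.infinite_univ (fun c _ => h c) hx
    (Submodule.subset_span (Set.mem_insert x _))
  rw [LinearIndependent.pair_iff' hx]
  rintro c rfl
  exact hw (K.smul_mem c hxK)

omit [IsAlgClosed k] in
-- For `dim S = 2` the hyperplane `ker a` is a line spanned by some `s`, so `firstKer β a` contains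
-- the kernel of a map `x ↦ β x s` into `V*`.
theorem finrank_le_finrank_firstKer_add (β : U →ₗ[k] S →ₗ[k] V →ₗ[k] k) (hS : finrank k S = 2)
    {a : Dual k S} (ha : a ≠ 0) : finrank k U ≤ finrank k (firstKer β a) + finrank k V := by
  have h1 : finrank k (LinearMap.ker a) = 1 := by
    have := finrank_ker_add_one ha
    omega
  obtain ⟨⟨s, hs⟩, -, hspan⟩ := finrank_eq_one_iff'.1 h1
  have h2 := LinearMap.finrank_range_add_finrank_ker (β.flip s)
  have h3 : finrank k (LinearMap.range (β.flip s)) ≤ finrank k V := by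
    refine (Submodule.finrank_le _).trans ?_
    rw [← Subspace.dual_finrank_eq (K := k) (V := V)]
  have h4 : LinearMap.ker (β.flip s) ≤ firstKer β a := by
    intro x hx s' hs' u
    obtain ⟨c, hc⟩ := hspan ⟨s', hs'⟩
    have hc' : c • s = s' := congrArg Subtype.val hc
    have hx' : β x s = 0 := hx
    rw [← hc', map_smul, hx', smul_zero, LinearMap.zero_apply]
  have := Submodule.finrank_mono h4
  omega

namespace IsMaxFamily

/-! ### The case where `a ⊗ η` spans all forms with first factor `a`. -/

section One

variable (hJ : IsMaxFamily β J) (h : IsFirstProjection β a β' pr) (ha : a ≠ 0)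
  (hYJ : projImage pr J = rankOneSet β') {x₀ : U} (hx₀ : x₀ ∈ cone J) {η : Dual k V}
  (hη : IsProd β x₀ a η) (hK : finrank k (firstKer β a) = 1)

include hJ h ha hYJ hx₀ hη hK

omit [FiniteDimensional k S] [FiniteDimensional k V] [FiniteDimensional k U'] in
-- For `w = b ⊗ g`, a lift of `pr w` to `J` has the form `(c • b + e • a) ⊗ g`, so `(e • a) ⊗ g`
-- lies in the space. As `κ = 1` and `g` is not proportional to `η`, this forces `e = 0`; the lift
-- is a multiple of `w`.
theorem mem_cone_of_ne_smul {w : U} (hw : w ≠ 0) {b : Dual k S} {g : Dual k V}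
    (hbg : IsProd β w b g) (hg : ∀ c : k, g ≠ c • η) : w ∈ cone J := by
  have hβ := hJ.steiner
  have hb := hbg.left_ne_zero hβ hw
  have hKη : ∀ x ∈ firstKer β a, ∀ b', b' ≠ 0 → ¬ IsProd β x b' g := by
    intro x hx b' hb' hprod
    obtain ⟨c, rfl⟩ := exists_smul_eq_of_mem hK hη.mem_firstKer
      (ne_zero_of_mem_cone hx₀) hx
    obtain ⟨d, hd⟩ := (hη.smul_right c).exists_right_eq_smul hprod hb'
    exact hg (d * c) (by rw [hd, smul_smul])
  have hpr : pr w ≠ 0 := fun h0 => hKη w (h.ker_eq ▸ h0) b hb hbg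
  have hy : pr w ∈ cone (projImage pr J) := by
    rw [hYJ]
    exact (h.isProd hbg).mem_cone_rankOneSet hpr
  obtain ⟨w', hw', b₂, hb₂, hprod, c, e, hce⟩ := h.exists_over_self hβ hJ.subset hJ.closed hy
    (h.isProd hbg)
  have hx : IsProd β (w' + (-c) • w) (e • a) g := by
    have := hprod.add_left (hbg.smul_left (-c))
    rwa [hce, add_right_comm, ← add_smul, add_neg_cancel, zero_smul, zero_add] at this
  by_cases he : e = 0
  · rw [he, zero_smul, add_zero] at hce
    have hc : c ≠ 0 := by
      rintro rfl
      exact hb₂ (by rw [hce, zero_smul])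
    rw [hce] at hprod
    rw [hprod.eq hβ (hbg.smul_left c)] at hw'
    exact mem_cone_of_smul hc hw'
  · refine absurd hx (hKη _ (fun s hs u => ?_) _ (smul_ne_zero he ha))
    rw [hx, LinearMap.smul_apply, hs, smul_zero, zero_mul]

omit [FiniteDimensional k U'] in
-- The roles of `S` and `V` are exchanged in `dim_projImage`, which is why `3 ≤ dim V` is needed. If
-- the forms with second factor `η` make up a line, each `b ⊗ η` arising from `b ⊗ g ∈ J` is a limit
-- of the points `b ⊗ (g + c • η)`, which lie in `J`.
theorem linSet_subset_of_three_le (hV : 3 ≤ finrank k V) :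
    linSet (firstKer (swapForm β) η) ⊆ J := by
  have hβ := hJ.steiner
  have hx0 := ne_zero_of_mem_cone hx₀
  have hη0 := hη.right_ne_zero hβ hx0
  obtain ⟨-, hK1 | ⟨hK2, hG⟩⟩ := hJ.swap.dim_projImage (isFirstProjection_mkQ (swapForm β) η) hη0
    (Or.inl hV) hx₀ hη.swap.mem_firstKer
  · refine cone_subset_cone.1 fun w hw => ?_
    obtain ⟨hw0, hwK⟩ := mem_cone_linSet.1 hw
    obtain ⟨c, rfl⟩ := exists_smul_eq_of_mem hK1 hη.swap.mem_firstKer hx0 hwK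
    exact smul_mem_cone hx₀ (left_ne_zero_of_smul hw0)
  · refine hJ.swap.linSet_firstKer_subset hη0 hK2 fun w hw hwK g b hgb => ?_
    have hw0 := ne_zero_of_mem_cone hw
    obtain ⟨x, hx⟩ := hG w hw g b hgb
    have hbg : IsProd β w b g := hgb.swap
    have hxb : IsProd β x b η := hx.swap
    have hb := hbg.left_ne_zero hβ hw0
    refine ⟨x, mem_cone_of_forall_add_smul_mem hJ.closed (hxb.ne_zero hb hη0) hx.mem_firstKer hwK
      fun c => ?_, hx⟩
    have hprod := hbg.add_right (hxb.smul_right c)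
    have hne : ∀ d : k, g + c • η ≠ d • η := fun d hd => hwK fun u hu s => by
      have hgd : g = (d - c) • η := (eq_sub_of_add_eq hd).trans (sub_smul d c η).symm
      rw [swapForm_apply, hbg, hgd, LinearMap.smul_apply, hu, smul_zero, mul_zero]
    exact hJ.mem_cone_of_ne_smul h ha hYJ hx₀ hη hK
      (hprod.ne_zero hb fun h0 => hne 0 (by rw [h0, zero_smul])) hprod hne

omit [FiniteDimensional k U'] in
-- A linear space `M` meeting the forms with second factor `η` only in the line of `w` is large
-- enough to meet the forms with any other second factor `g`. Those intersection points lie in `J`,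
-- and letting `g` tend to `η` gives `w`.
theorem linSet_subset_of_eq_two (hV : finrank k V = 2) :
    linSet (firstKer (swapForm β) η) ⊆ J := by
  have hβ := hJ.steiner
  have hx0 := ne_zero_of_mem_cone hx₀
  have hη0 := hη.right_ne_zero hβ hx0
  refine cone_subset_cone.1 fun w hw => ?_
  obtain ⟨hw0, hwK⟩ := mem_cone_linSet.1 hw
  set K := firstKer (swapForm β) η with hKdef
  obtain ⟨C, hC⟩ := K.exists_isCompl
  let M : Submodule k U := C ⊔ k ∙ w
  have hMK : ∀ x ∈ M, x ∈ K → ∃ c : k, c • w = x := by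
    intro x hxM hxK
    obtain ⟨y, hy, z, hz, rfl⟩ := Submodule.mem_sup.1 hxM
    obtain ⟨c, rfl⟩ := Submodule.mem_span_singleton.1 hz
    have hyK : y ∈ K := by simpa using K.sub_mem hxK (K.smul_mem c hwK)
    have : y = 0 := (Submodule.disjoint_def.1 hC.disjoint) y hyK hy
    exact ⟨c, by rw [this, zero_add]⟩
  have hMdim : finrank k S + 1 ≤ finrank k M := by
    have h1 : finrank k C < finrank k M := by
      refine Submodule.finrank_lt_finrank_of_lt (lt_of_le_of_ne le_sup_left fun h0 => hw0 ?_)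
      refine (Submodule.disjoint_def.1 hC.disjoint) w hwK ?_
      rw [h0]
      exact Submodule.mem_sup_right (Submodule.mem_span_singleton_self w)
    have h2 := Submodule.finrank_add_eq_of_isCompl hC
    have h3 := hβ.swap.finrank_firstKer_le hη0 hV.ge (by have := hJ.two_le_left; omega)
    rw [← hKdef] at h3
    omega
  let B : S × V × V → U →ₗ[k] Dual k V →ₗ[k] k := fun i =>
    (entry β i.1 i.2.1).smulRight (Dual.eval k V i.2.2) -
      (entry β i.1 i.2.2).smulRight (Dual.eval k V i.2.1)
  -- `D` consists of the second factors of elements of `J` lying in `M`. It is closed, so the line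
  -- through `[g]` and `[η]` lies in `D` once all its points but `[η]` do.
  let D : Set (ℙ k (Dual k V)) := {g | ∃ x ∈ cone (J ∩ linSet M), ∀ i, B i x g.rep = 0}
  have hD : IsClosed D := isClosed_incidence (hJ.closed.inter (isClosed_linSet M)) B
  have hmem : ∀ g : Dual k V, g ≠ 0 → (∀ c : k, g ≠ c • η) → g ∈ cone D := by
    intro g hg0 hg
    have hdim := finrank_le_finrank_firstKer_add (swapForm β) hV hg0
    -- Here `dim M ≥ dim S + 1`, while the forms with second factor `g` have codimension at most
    -- `dim S`.
    obtain ⟨x, hx, hxne⟩ := (Submodule.ne_bot_iff (M ⊓ firstKer (swapForm β) g)).1 fun h0 => by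
      have := Submodule.finrank_add_finrank_le_of_disjoint (disjoint_iff.2 h0)
      omega
    obtain ⟨b, hb⟩ := exists_isProd_of_mem_firstKer hg0 hx.2
    have hbg : IsProd β x b g := hb.swap
    refine mem_cone_incidence.2 ⟨hg0, x, mem_cone_inter.2 ⟨?_, mem_cone_linSet.2 ⟨hxne, hx.1⟩⟩, ?_⟩
    · exact hJ.mem_cone_of_ne_smul h ha hYJ hx₀ hη hK hxne hbg hg
    · intro i
      simp [B, hbg _ _]
      ring
  have hη' : η ∈ cone D := by
    obtain ⟨g, hg⟩ : ∃ g, g ∉ k ∙ η := by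
      by_contra! hcon
      have h1 : (k ∙ η : Submodule k (Dual k V)) = ⊤ := eq_top_iff.2 fun g _ => hcon g
      have h2 := finrank_span_singleton (K := k) hη0
      rw [h1, finrank_top, Subspace.dual_finrank_eq, hV] at h2
      omega
    refine mem_cone_of_forall_add_smul_mem hD hη0 (Submodule.mem_span_singleton_self η) hg
      fun c => ?_
    have hc : ∀ d : k, g + c • η ≠ d • η := fun d hd => hg <| by
      rw [(eq_sub_of_add_eq hd).trans (sub_smul d c η).symm]
      exact Submodule.smul_mem _ _ (Submodule.mem_span_singleton_self η)
    exact hmem _ (fun h0 => hc 0 (by rw [h0, zero_smul])) hc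
  obtain ⟨-, x, hx, hB⟩ := mem_cone_incidence.1 hη'
  obtain ⟨hxJ, hxM⟩ := mem_cone_inter.1 hx
  obtain ⟨u, hu⟩ := exists_apply_eq_one hη0
  obtain ⟨c, rfl⟩ := hMK x (mem_cone_linSet.1 hxM).2 fun v hv s => by
    have := hB (s, v, u)
    simpa [B, hu, hv] using this
  exact mem_cone_of_smul (left_ne_zero_of_smul (ne_zero_of_mem_cone hxJ)) hxJ

omit [FiniteDimensional k U'] in
theorem rankOneSet_subset_of_finrank_eq_one : rankOneSet β ⊆ J := by
  refine cone_subset_cone.1 fun w hw => ?_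
  obtain ⟨b, g, hb, hg, hbg⟩ := exists_isProd hJ.steiner hw
  by_cases hc : ∃ c : k, g = c • η
  · obtain ⟨c, rfl⟩ := hc
    have hwK : w ∈ cone (linSet (firstKer (swapForm β) η)) := mem_cone_linSet.2
      ⟨ne_zero_of_mem_cone hw, fun u hu s => by
        rw [swapForm_apply, hbg, LinearMap.smul_apply, hu, smul_zero, mul_zero]⟩
    refine cone_mono ?_ hwK
    rcases hJ.two_le_right.eq_or_lt with hV | hV
    · exact hJ.linSet_subset_of_eq_two h ha hYJ hx₀ hη hK hV.symm
    · exact hJ.linSet_subset_of_three_le h ha hYJ hx₀ hη hK hV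
  · push Not at hc
    exact hJ.mem_cone_of_ne_smul h ha hYJ hx₀ hη hK (ne_zero_of_mem_cone hw) hbg hc

end One

/-! ### The case where every second factor in the family also occurs with first factor `a`. -/

section Two

variable (hJ : IsMaxFamily β J) (h : IsFirstProjection β a β' pr) (ha : a ≠ 0)
  (hmax : ∀ A, IsIrreducible A → A ⊆ rankOneSet β → J ⊆ A → A ⊆ J)
  (hYJ : projImage pr J = rankOneSet β') (hK : finrank k (firstKer β a) = 2)
  (hG : ∀ w ∈ cone J, ∀ b g, IsProd β w b g → ∃ x, IsProd β x a g)

include hJ h ha hYJ hG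

omit [FiniteDimensional k S] [FiniteDimensional k V] [FiniteDimensional k U'] in
-- The hypothesis on second factors passes from `J` to all forms of rank one: off the centre,
-- lifting to `J` preserves the second factor, and in the centre the first factor is already `a`.
theorem exists_isProd_left {w : U} (hw : w ≠ 0) {b : Dual k S} {g : Dual k V}
    (hbg : IsProd β w b g) : ∃ x, IsProd β x a g := by
  by_cases hpr : pr w = 0
  · obtain ⟨g', hg'⟩ := exists_isProd_of_mem_firstKer ha
      (show w ∈ firstKer β a from h.ker_eq ▸ hpr)
    obtain ⟨c, hc⟩ := hg'.exists_right_eq_smul hbg (hbg.left_ne_zero hJ.steiner hw)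
    exact ⟨c • w, hc ▸ hg'.smul_right c⟩
  · have hy : pr w ∈ cone (projImage pr J) := by
      rw [hYJ]
      exact (h.isProd hbg).mem_cone_rankOneSet hpr
    obtain ⟨w', hw', b₂, -, hprod, -⟩ := h.exists_over_self hJ.steiner hJ.subset hJ.closed hy
      (h.isProd hbg)
    exact hG w' hw' b₂ g hprod

include hmax

omit [FiniteDimensional k S] [FiniteDimensional k V] [FiniteDimensional k U'] in
-- The substitution `b ↦ b + c b(s₁) a` preserves rank one, and stays in the space because every `a
-- ⊗ g` needed is available. A component is stable under such a one-parameter family.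
theorem add_smul_mem_cone {w : U} (hw : w ∈ cone J) (hpr : pr w ≠ 0) {b : Dual k S} {g : Dual k V}
    (hbg : IsProd β w b g) {x : U} (hx : IsProd β x a g) (c : k) : w + c • x ∈ cone J := by
  have hβ := hJ.steiner
  obtain ⟨s₁, u₁, hs₁, h1⟩ := h.exists_ne_zero hpr
  have hbs : b s₁ ≠ 0 := by
    rw [hbg] at h1
    exact left_ne_zero_of_mul h1
  have hker : LinearMap.ker β = ⊥ := LinearMap.ker_eq_bot'.2
    fun x hx => hβ.inj x fun s u => by rw [hx]; rfl
  -- The substitution need not preserve the whole of `U` inside the bilinear forms. A linear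
  -- retraction makes it an endomorphism of `U` with the right values on forms of rank one.
  obtain ⟨π, hπ⟩ := LinearMap.exists_leftInverse_of_injective (V := U)
    (V' := S →ₗ[k] V →ₗ[k] k) β hker
  let ψ : (S →ₗ[k] V →ₗ[k] k) →ₗ[k] (S →ₗ[k] V →ₗ[k] k) :=
    LinearMap.mk₂ k (fun φ s => a s • φ s₁) (fun _ _ _ => by simp) (fun _ _ _ => by
      simp [smul_smul, mul_comm]) (fun _ _ _ => by simp [add_smul]) (fun _ _ _ => by
      simp [mul_smul])
  have hN : ∀ {w b g x}, IsProd β w b g → IsProd β x a g → (π ∘ₗ ψ ∘ₗ β) w = b s₁ • x := by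
    intro w b g x hbg hx
    have : ψ (β w) = β (b s₁ • x) := LinearMap.ext fun s => LinearMap.ext fun u => by
      simp [ψ, hbg _ _, hx _ _]
      ring
    rw [LinearMap.comp_apply, LinearMap.comp_apply, this]
    exact DFunLike.congr_fun hπ (b s₁ • x)
  have := add_smul_mem_cone_of_maximal hJ.irreducible hmax hJ.subset (π ∘ₗ ψ ∘ₗ β)
    (fun v hv c => ?_) hw (c * (b s₁)⁻¹)
  · rwa [hN hbg hx, smul_smul, mul_assoc, inv_mul_cancel₀ hbs, mul_one] at this
  · have hv0 := ne_zero_of_mem_cone hv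
    obtain ⟨b, g, hb, hg, hbg⟩ := exists_isProd hβ hv
    obtain ⟨x, hx⟩ := hJ.exists_isProd_left h ha hYJ hG hv0 hbg
    rw [hN hbg hx, smul_smul]
    have hprod := hbg.add_left (hx.smul_left (c * b s₁))
    refine hprod.mem_cone_rankOneSet (hprod.ne_zero (fun h0 => ?_) hg)
    -- The new first factor is nonzero: it agrees with `b` at `s₁ ∈ ker a`, and if that value is
    -- zero it is `b` itself.
    have h2 : b s₁ = 0 := by
      have := DFunLike.congr_fun h0 s₁
      simpa [hs₁] using this
    rw [h2, mul_zero, zero_smul, add_zero] at h0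
    exact hb h0

include hK

omit [FiniteDimensional k U'] in
-- Translations along `a ⊗ g` let a lift of `pr w` be moved to `w`. Their limits are the points `a ⊗
-- g` themselves, which yields the centre.
theorem rankOneSet_subset_of_finrank_eq_two : rankOneSet β ⊆ J := by
  have hβ := hJ.steiner
  refine cone_subset_cone.1 fun w hw => ?_
  have hw0 := ne_zero_of_mem_cone hw
  have hkerpr : ∀ {x g}, IsProd β x a g → pr x = 0 := fun {x g} hx => by
    have := hx.mem_firstKer
    rwa [← h.ker_eq] at this
  by_cases hpr : pr w = 0
  · have hwK : w ∈ firstKer β a := h.ker_eq ▸ hpr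
    refine cone_mono (hJ.linSet_firstKer_subset ha hK fun v hv hvK b g hbg => ?_)
      (mem_cone_linSet.2 ⟨hw0, hwK⟩)
    have hv0 := ne_zero_of_mem_cone hv
    obtain ⟨x, hx⟩ := hG v hv b g hbg
    have hprv : pr v ≠ 0 := fun h0 => hvK (h.ker_eq ▸ h0)
    exact ⟨x, mem_cone_of_forall_add_smul_mem hJ.closed
      (hx.ne_zero ha (hbg.right_ne_zero hβ hv0)) hx.mem_firstKer hvK
      fun c => hJ.add_smul_mem_cone h ha hmax hYJ hG hv hprv hbg hx c, hx⟩
  · obtain ⟨b, g, hb, hg, hbg⟩ := exists_isProd hβ hw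
    obtain ⟨s₀, hs₀⟩ := exists_apply_eq_one ha
    -- Lifts are sought among forms whose first factor vanishes at `s₀`; every point of `J` off the
    -- centre has such a translate in `J`. As `a s₀ = 1`, this keeps the lift out of the centre, so
    -- `c ≠ 0` below.
    let M : Submodule k U := LinearMap.ker (β.flip s₀)
    have hy : pr w ∈ cone (projImage pr J) := by
      rw [hYJ]
      exact (h.isProd hbg).mem_cone_rankOneSet hpr
    have hQ : ∀ v ∈ cone J, pr v ≠ 0 → ∃ v' ∈ cone (J ∩ linSet M), pr v' = pr v := by
      intro v hv hprv
      obtain ⟨b, g, hb, hg, hbg⟩ := exists_isProd hβ (cone_mono hJ.subset hv)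
      obtain ⟨x, hx⟩ := hG v hv b g hbg
      have hpr' : pr (v + (-b s₀) • x) = pr v := by
        rw [map_add, map_smul, hkerpr hx, smul_zero, add_zero]
      refine ⟨v + (-b s₀) • x, mem_cone_inter.2
        ⟨hJ.add_smul_mem_cone h ha hmax hYJ hG hv hprv hbg hx _, mem_cone_linSet.2 ⟨?_, ?_⟩⟩, hpr'⟩
      · intro h0
        rw [h0, map_zero] at hpr'
        exact hprv hpr'.symm
      · refine LinearMap.mem_ker.2 (LinearMap.ext fun u => ?_)
        simp [hbg _ _, hx _ _, hs₀]
    obtain ⟨w', hw', b₂, hb₂, hprod, c, e, hce⟩ := h.exists_over hβ (Q := J ∩ linSet M)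
      (hJ.closed.inter (isClosed_linSet M)) (Set.inter_subset_left.trans hJ.subset)
      hQ hy (h.isProd hbg)
    obtain ⟨hw'J, hw'M⟩ := mem_cone_inter.1 hw'
    have hb₂s : b₂ s₀ = 0 := by
      obtain ⟨u, hu⟩ := exists_apply_eq_one hg
      have h1 := hprod s₀ u
      have h2 : β w' s₀ = 0 := (mem_cone_linSet.1 hw'M).2
      rw [h2, hu, mul_one] at h1
      exact h1.symm
    have hc : c ≠ 0 := by
      rintro rfl
      rw [zero_smul, zero_add] at hce
      rw [hce, LinearMap.smul_apply, hs₀, smul_eq_mul, mul_one] at hb₂s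
      exact hb₂ (by rw [hce, hb₂s, zero_smul])
    obtain ⟨x, hx⟩ := hJ.exists_isProd_left h ha hYJ hG hw0 hbg
    have hcw : w' = c • w + e • x := hprod.eq hβ <| by
      rw [hce]
      exact (hbg.smul_left c).add_left (hx.smul_left e)
    have hprw' : pr w' ≠ 0 := by
      rw [hcw, map_add, map_smul, map_smul, hkerpr hx, smul_zero, add_zero]
      exact smul_ne_zero hc hpr
    have := hJ.add_smul_mem_cone h ha hmax hYJ hG hw'J hprw' hprod hx (-e)
    rw [hcw, add_assoc, ← add_smul, add_neg_cancel, zero_smul, add_zero] at this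
    exact mem_cone_of_smul hc this

end Two

theorem rankOneSet_eq (hJ : IsMaxFamily β J) (h : IsFirstProjection β a β' pr) (ha : a ≠ 0)
    (hmax : ∀ A, IsIrreducible A → A ⊆ rankOneSet β → J ⊆ A → A ⊆ J)
    (hpq : 3 ≤ finrank k S ∨ finrank k V = 2)
    (hYJ : projImage pr J = rankOneSet β') {x₀ : U} (hx₀ : x₀ ∈ cone J) {η : Dual k V}
    (hη : IsProd β x₀ a η) : rankOneSet β = J := by
  refine Set.Subset.antisymm ?_ hJ.subset
  obtain ⟨-, hK | ⟨hK, hG⟩⟩ := hJ.dim_projImage h ha hpq hx₀ hη.mem_firstKer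
  · exact hJ.rankOneSet_subset_of_finrank_eq_one h ha hYJ hx₀ hη hK
  · exact hJ.rankOneSet_subset_of_finrank_eq_two h ha hmax hYJ hK hG

end IsMaxFamily

end Inherit

end

noncomputable section

/-! ### The sets of factors -/

section FactorSets

variable {k : Type*} [Field k] {U : Type*} [AddCommGroup U] [Module k U]
  {S : Type*} [AddCommGroup S] [Module k S] {V : Type*} [AddCommGroup V] [Module k V]
  {β : U →ₗ[k] S →ₗ[k] V →ₗ[k] k}

variable (β) in
/-- The lines of first factors of elements of rank one. -/
def firstFactors : Set (ℙ k (Dual k S)) := {b | ∃ x g, g ≠ 0 ∧ IsProd β x b.rep g}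

theorem mem_cone_firstFactors {b : Dual k S} :
    b ∈ cone (firstFactors β) ↔ b ≠ 0 ∧ ∃ x g, g ≠ 0 ∧ IsProd β x b g := by
  constructor
  · rintro ⟨hb, x, g, hg, h⟩
    obtain ⟨c, hc, hrep⟩ := exists_smul_rep_mk (k := k) hb
    refine ⟨hb, c⁻¹ • x, g, hg, ?_⟩
    have := h.smul_left c⁻¹
    rwa [hrep, smul_smul, inv_mul_cancel₀ hc, one_smul] at this
  · rintro ⟨hb, x, g, hg, h⟩
    obtain ⟨c, hc, hrep⟩ := exists_smul_rep_mk (k := k) hb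
    exact ⟨hb, c • x, g, hg, hrep ▸ h.smul_left c⟩

variable [IsAlgClosed k] [FiniteDimensional k U] [FiniteDimensional k S]

omit [FiniteDimensional k S] in
-- Being a first factor of some form of rank one is an incidence condition over a closed projective
-- set, so elimination applies.
theorem isClosed_firstFactors (hβ : IsSteinerForm β) : IsClosed (firstFactors β) := by
  let B : S × S × V → U →ₗ[k] Dual k S →ₗ[k] k := fun i =>
    (entry β i.1 i.2.2).smulRight (Dual.eval k S i.2.1) -
      (entry β i.2.1 i.2.2).smulRight (Dual.eval k S i.1)
  have : firstFactors β = {b : ℙ k (Dual k S) | ∃ x ∈ cone (rankOneSet β), ∀ i, B i x b.rep = 0} := by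
    ext b
    constructor
    · rintro ⟨x, g, hg, h⟩
      refine ⟨x, h.mem_cone_rankOneSet (h.ne_zero b.rep_nonzero hg), fun i => ?_⟩
      simp [B, h _ _]
      ring
    · rintro ⟨x, hx, hB⟩
      obtain ⟨b', g, hb', hg, h⟩ := exists_isProd hβ hx
      obtain ⟨u, hu⟩ := exists_apply_eq_one hg
      obtain ⟨c, hc⟩ := exists_eq_smul (f := b') (f' := b.rep) hb' fun s s' => by
        have := hB (s, s', u)
        simp [B, h _ _, hu] at this
        linear_combination this
      exact ⟨c • x, g, hg, hc ▸ h.smul_left c⟩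
  rw [this]
  exact isClosed_incidence (isClosed_rankOneSet β) B

variable {a : Dual k S} {U' : Type*} [AddCommGroup U'] [Module k U'] [FiniteDimensional k U']
  {β' : U' →ₗ[k] LinearMap.ker a →ₗ[k] V →ₗ[k] k} {pr : U →ₗ[k] U'}

omit [FiniteDimensional k U] in
-- That the first factor of `y` lies in the closed projection of `firstFactors β` is a closed
-- condition on `y`. It holds at projections of forms off the centre, hence on their closure, the
-- whole target.
theorem IsFirstProjection.firstFactors_eq (h : IsFirstProjection β a β' pr) (hβ : IsSteinerForm β)
    (hYJ : projImage pr (rankOneSet β) = rankOneSet β') :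
    firstFactors β' = projImage (LinearMap.ker a).subtype.dualMap (firstFactors β) := by
  have hβ' := h.steiner hβ
  refine Set.Subset.antisymm (cone_subset_cone.1 fun b' hb' => ?_)
    (projImage_subset (isClosed_firstFactors hβ') fun b hb hb0 => ?_)
  · let L := (LinearMap.ker a).subtype.dualMap
    let S' := LinearMap.ker a
    let B : S' × S' × V → Dual k S' →ₗ[k] U' →ₗ[k] k := fun i =>
      (Dual.eval k S' i.2.1).smulRight (entry β' i.1 i.2.2) -
        (Dual.eval k S' i.1).smulRight (entry β' i.2.1 i.2.2)
    have hsub : rankOneSet β' ⊆ {y : ℙ k U' | ∃ b ∈ cone (projImage L (firstFactors β)),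
        ∀ i, B i b y.rep = 0} := by
      rw [← hYJ]
      refine projImage_subset (isClosed_incidence (isClosed_projImage _ _) B) fun w hw hpr => ?_
      obtain ⟨b, g, hb, hg, hbg⟩ := exists_isProd hβ hw
      have hprod := h.isProd hbg
      refine mem_cone_incidence.2 ⟨hpr, L b, map_mem_cone_projImage
        (mem_cone_firstFactors.2 ⟨hb, w, g, hg, hbg⟩) (hprod.left_ne_zero hβ' hpr), fun i => ?_⟩
      simp [B, L, h.compat, hbg _ _]
      ring
    obtain ⟨hb0, y, g, hg, hbg⟩ := mem_cone_firstFactors.1 hb'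
    obtain ⟨-, b, hb, hB⟩ := mem_cone_incidence.1
      (cone_mono hsub (hbg.mem_cone_rankOneSet (hbg.ne_zero hb0 hg)))
    obtain ⟨u, hu⟩ := exists_apply_eq_one hg
    obtain ⟨c, hc⟩ := exists_eq_smul (f := b') (f' := b) hb0 fun s s' => by
      have := hB (s, s', u)
      simp only [B, LinearMap.sub_apply, LinearMap.smulRight_apply, Dual.eval_apply,
        LinearMap.smul_apply, smul_eq_mul, entry_apply, hbg _ _, hu, mul_one] at this
      linear_combination this
    have hc0 : c ≠ 0 := by
      rintro rfl
      exact ne_zero_of_mem_cone hb (by rw [hc, zero_smul])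
    exact mem_cone_of_smul hc0 (hc ▸ hb)
  · obtain ⟨-, x, g, hg, hbg⟩ := mem_cone_firstFactors.1 hb
    exact mem_cone_firstFactors.2 ⟨hb0, pr x, g, hg, h.isProd hbg⟩

omit [FiniteDimensional k S] in
-- A form off the centre shares its second factor with its projection. This is a closed condition,
-- and irreducibility extends it to the forms in the centre. Conversely, points of the target lift
-- with the same second factor.
theorem IsFirstProjection.secondFactors_eq (h : IsFirstProjection β a β' pr)
    (hβ : IsSteinerForm β) (hirr : IsIrreducible (rankOneSet β))
    (hne : ∃ w ∈ cone (rankOneSet β), pr w ≠ 0)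
    (hYJ : projImage pr (rankOneSet β) = rankOneSet β') :
    firstFactors (swapForm β) = firstFactors (swapForm β') := by
  have hβ' := h.steiner hβ
  refine Set.Subset.antisymm (cone_subset_cone.1 fun g hg => ?_)
    (cone_subset_cone.1 fun g hg => ?_)
  · let S' := LinearMap.ker a
    let B : S × S' × V × V → U' →ₗ[k] U →ₗ[k] k := fun i =>
      (entry β' i.2.1 i.2.2.1).smulRight (entry β i.1 i.2.2.2) -
        (entry β' i.2.1 i.2.2.2).smulRight (entry β i.1 i.2.2.1)
    let D : Set (ℙ k U) := {x | ∃ y ∈ cone (rankOneSet β'), ∀ i, B i y x.rep = 0}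
    have hD : IsClosed D := isClosed_incidence (isClosed_rankOneSet β') B
    have hcov : rankOneSet β ⊆ D ∪ linSet (LinearMap.ker pr) := by
      intro x hx
      by_cases hpr : pr x.rep = 0
      · exact Or.inr hpr
      · obtain ⟨b, g, hb, hg, hbg⟩ := exists_isProd hβ (rep_mem_cone.2 hx)
        refine Or.inl ⟨pr x.rep, (h.isProd hbg).mem_cone_rankOneSet hpr, fun i => ?_⟩
        simp [B, h.compat, hbg _ _]
        ring
    have hsub : rankOneSet β ⊆ D := by
      refine ((isPreirreducible_iff_isClosed_union_isClosed.1 hirr.2) D _ hD (isClosed_linSet _)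
        hcov).resolve_right fun hcon => ?_
      obtain ⟨w, hw, hpr⟩ := hne
      exact hpr (mem_cone_linSet.1 (cone_mono hcon hw)).2
    obtain ⟨hg0, x, b, hb, hgb⟩ := mem_cone_firstFactors.1 hg
    have hbg : IsProd β x b g := hgb.swap
    obtain ⟨-, y, hy, hB⟩ := mem_cone_incidence.1
      (cone_mono hsub (hbg.mem_cone_rankOneSet (hbg.ne_zero hb hg0)))
    obtain ⟨b', g', hb', hg', hbg'⟩ := exists_isProd hβ' hy
    obtain ⟨s, hs⟩ := exists_apply_eq_one hb
    obtain ⟨s', hs'⟩ := exists_apply_eq_one hb'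
    obtain ⟨c, hc⟩ := exists_eq_smul (f := g) (f' := g') hg0 fun u u' => by
      have := hB (s, s', u, u')
      simp only [B, LinearMap.sub_apply, LinearMap.smulRight_apply, LinearMap.smul_apply,
        smul_eq_mul, entry_apply, hbg _ _, hbg' _ _, hs, hs', one_mul] at this
      linear_combination -this
    obtain ⟨hb₂, hprod⟩ := hbg'.congr_right hβ' (ne_zero_of_mem_cone hy) hc
    exact mem_cone_firstFactors.2 ⟨hg0, y, _, hb₂, hprod.swap⟩
  · obtain ⟨hg0, y, b', hb', hgb⟩ := mem_cone_firstFactors.1 hg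
    have hbg : IsProd β' y b' g := hgb.swap
    obtain ⟨b₁, hb₁⟩ := LinearMap.exists_extend b'
    obtain ⟨w, -, b, hb, hprod, -⟩ := h.exists_over_self hβ subset_rfl (isClosed_rankOneSet β)
      (hYJ ▸ hbg.mem_cone_rankOneSet (hbg.ne_zero hb' hg0)) (hb₁ ▸ hbg : IsProd β' y (b₁ ∘ₗ _) g)
    exact mem_cone_firstFactors.2 ⟨hg0, w, b, hb, hprod.swap⟩

end FactorSets

/-! ### Steiner bundles as spaces of bilinear forms -/

namespace SteinerBundle

variable {k S T V : Type*} [Field k] [AddCommGroup S] [Module k S]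
  [AddCommGroup T] [Module k T] [AddCommGroup V] [Module k V]

/-- The elements of `T₀*` as bilinear forms on `S × V`. -/
def form (F : SteinerBundle k S T V) : F.imPhi →ₗ[k] S →ₗ[k] V →ₗ[k] k :=
  (TensorProduct.lcurry (RingHom.id k) S V k) ∘ₗ F.imPhi.subtype

@[simp] theorem form_apply (F : SteinerBundle k S T V) (x : F.imPhi) (s : S) (u : V) :
    F.form x s u = x.1 (s ⊗ₜ[k] u) := rfl

theorem isSteinerForm_form (F : SteinerBundle k S T V) : IsSteinerForm (U := F.imPhi) F.form where
  inj x hx := Subtype.ext (TensorProduct.ext' fun s u => hx s u)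
  nondeg s u hs hu := by
    have h : F.mul s u ≠ 0 := fun h0 => hs (F.fibre_injective u hu (by simp [h0]))
    obtain ⟨τ, hτ⟩ := exists_dual_ne_zero (k := k) h
    exact ⟨⟨F.phi τ, τ, rfl⟩, hτ⟩

theorem isProd_form_iff {F : SteinerBundle k S T V} {x : F.imPhi} {b : Dual k S} {g : Dual k V} :
    IsProd (U := F.imPhi) F.form x b g ↔ x.1 = pureTensor b g :=
  ⟨fun h => TensorProduct.ext' fun s u => (h s u).trans (pureTensor_tmul b g s u).symm,
    fun h s u => by rw [form_apply, h, pureTensor_tmul]⟩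

theorem mk_mem_jumpingPairs {F : SteinerBundle k S T V} {b : Dual k S} {g : Dual k V} (hb : b ≠ 0)
    (hg : g ≠ 0) : (Projectivization.mk k b hb, Projectivization.mk k g hg) ∈ F.jumpingPairs ↔
      ∃ x, IsProd (U := F.imPhi) F.form x b g := by
  constructor
  · intro h
    have := h b (by simp [Projectivization.submodule_mk, Submodule.mem_span_singleton_self]) g
      (by simp [Projectivization.submodule_mk, Submodule.mem_span_singleton_self])
    have hmem : pureTensor b g ∈ F.imPhi := (Submodule.Quotient.mk_eq_zero _).1 this
    exact ⟨⟨_, hmem⟩, isProd_form_iff.2 rfl⟩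
  · rintro ⟨x, hx⟩ b' hb' g' hg'
    rw [Projectivization.submodule_mk, Submodule.mem_span_singleton] at hb' hg'
    obtain ⟨c, rfl⟩ := hb'
    obtain ⟨d, rfl⟩ := hg'
    have := isProd_form_iff.1 ((hx.smul_left c).smul_right d)
    refine (Submodule.Quotient.mk_eq_zero _).2 ?_
    rw [← this]
    exact Subtype.property _

theorem mem_inPT0 {F : SteinerBundle k S T V} {P : Set (ℙ k (Dual k S) × ℙ k (Dual k V))}
    {x : ℙ k F.imPhi} : x ∈ F.inPT0 P ↔ ∃ b g, ∃ (hb : b ≠ 0) (hg : g ≠ 0),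
      IsProd (U := F.imPhi) F.form x.rep b g ∧ (Projectivization.mk k b hb, Projectivization.mk k g hg) ∈ P := by
  have hmap : Projectivization.map F.imPhi.subtype F.imPhi.injective_subtype x =
      Projectivization.mk k x.rep.1 (fun h => x.rep_nonzero (Subtype.ext h)) := by
    conv_lhs => rw [← x.mk_rep]
    rfl
  show _ ∈ segre '' P ↔ _
  rw [hmap]
  constructor
  · rintro ⟨⟨α, H⟩, hP, hseg⟩
    obtain ⟨c, hc⟩ := (Projectivization.mk_eq_mk_iff' k _ _ _ _).1 hseg.symm
    have hc0 : c ≠ 0 := by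
      rintro rfl
      rw [zero_smul] at hc
      exact x.rep_nonzero (Subtype.ext hc.symm)
    refine ⟨c • α.rep, H.rep, smul_ne_zero hc0 α.rep_nonzero, H.rep_nonzero,
      isProd_form_iff.2 ?_, ?_⟩
    · rw [← hc]
      ext s u
      simp [mul_assoc]
    · have h1 : Projectivization.mk k (c • α.rep) (smul_ne_zero hc0 α.rep_nonzero) = α := by
        conv_rhs => rw [← α.mk_rep]
        exact (Projectivization.mk_eq_mk_iff' k _ _ _ _).2 ⟨c, rfl⟩
      rwa [h1, H.mk_rep]
  · rintro ⟨b, g, hb, hg, hprod, hP⟩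
    refine ⟨_, hP, (Projectivization.mk_eq_mk_iff' k _ _ _ _).2 ?_⟩
    obtain ⟨c, hc, hb'⟩ := exists_smul_rep_mk (k := k) hb
    obtain ⟨d, hd, hg'⟩ := exists_smul_rep_mk (k := k) hg
    refine ⟨c * d, ?_⟩
    rw [isProd_form_iff.1 hprod]
    ext s u
    simp [hb', hg']
    ring

theorem jumpingVariety_eq (F : SteinerBundle k S T V) : F.jumpingVariety = rankOneSet (U := F.imPhi) F.form := by
  ext x
  rw [jumpingVariety, mem_inPT0]
  constructor
  · rintro ⟨b, g, -, -, h, -⟩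
    exact h.isRankOne
  · intro h
    obtain ⟨b, g, hb, hg, hbg⟩ := exists_isProd F.isSteinerForm_form (rep_mem_cone.2 h)
    exact ⟨b, g, hb, hg, hbg, (mk_mem_jumpingPairs hb hg).2 ⟨_, hbg⟩⟩

theorem firstFibre_eq (F : SteinerBundle k S T V) {a : Dual k S} (ha : a ≠ 0) :
    F.firstFibre (Projectivization.mk k a ha) = linSet (firstKer (U := F.imPhi) F.form a) := by
  ext x
  rw [firstFibre, mem_inPT0]
  constructor
  · rintro ⟨b, g, hb, hg, h, -, hba⟩
    obtain ⟨c, hc⟩ := (Projectivization.mk_eq_mk_iff' k _ _ _ _).1 hba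
    show x.rep ∈ firstKer (U := F.imPhi) F.form a
    intro s hs u
    rw [h, ← hc, LinearMap.smul_apply, hs, smul_zero, zero_mul]
  · intro h
    obtain ⟨g, hg⟩ := exists_isProd_of_mem_firstKer ha (show x.rep ∈ firstKer (U := F.imPhi) F.form a from h)
    have hg0 := hg.right_ne_zero F.isSteinerForm_form x.rep_nonzero
    exact ⟨a, g, ha, hg0, hg, (mk_mem_jumpingPairs ha hg0).2 ⟨_, hg⟩, rfl⟩

theorem sigmaSet_eq (F : SteinerBundle k S T V) : F.sigmaSet = firstFactors (U := F.imPhi) F.form := by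
  ext b
  constructor
  · rintro ⟨⟨α, H⟩, h, rfl⟩
    rw [← α.mk_rep, ← H.mk_rep, mk_mem_jumpingPairs] at h
    obtain ⟨x, hx⟩ := h
    exact ⟨x, H.rep, H.rep_nonzero, hx⟩
  · rintro ⟨x, g, hg, h⟩
    refine ⟨(b, Projectivization.mk k g hg), ?_, rfl⟩
    have := (mk_mem_jumpingPairs b.rep_nonzero hg).2 ⟨x, h⟩
    rwa [b.mk_rep] at this

theorem jumpingHyperplanes_eq (F : SteinerBundle k S T V) :
    F.jumpingHyperplanes = firstFactors (U := F.imPhi) (swapForm (U := F.imPhi) F.form) := by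
  ext g
  constructor
  · rintro ⟨⟨α, H⟩, h, rfl⟩
    rw [← α.mk_rep, ← H.mk_rep, mk_mem_jumpingPairs] at h
    obtain ⟨x, hx⟩ := h
    exact ⟨x, α.rep, α.rep_nonzero, hx.swap⟩
  · rintro ⟨x, b, hb, h⟩
    refine ⟨(Projectivization.mk k b hb, g), ?_, rfl⟩
    have := (mk_mem_jumpingPairs hb g.rep_nonzero).2 ⟨x, h.swap⟩
    rwa [g.mk_rep] at this

theorem restrictForm_surjective (F : SteinerBundle k S T V) {a : Dual k S} {h : Dual k V}
    {τ : Dual k T} (hτ : F.phi τ = pureTensor a h) : Function.Surjective (F.restrictForm hτ) :=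
  (LinearMap.dualMap_surjective_of_injective (Submodule.injective_subtype _)).comp
    (LinearMap.dualMap_surjective_of_injective (Submodule.injective_subtype _))

theorem isFirstProjection_prMap (F : SteinerBundle k S T V) {a : Dual k S} {h : Dual k V}
    {τ : Dual k T} (hτ : F.phi τ = pureTensor a h) :
    IsFirstProjection (U := F.imPhi) F.form a (U' := (F.reducedTransform hτ).imPhi)
      (F.reducedTransform hτ).form (F.prMap hτ) where
  surj := by
    rintro ⟨_, σ, rfl⟩
    obtain ⟨ρ, rfl⟩ := F.restrictForm_surjective hτ σ
    exact ⟨⟨F.phi ρ, ρ, rfl⟩, Subtype.ext (F.restrictTensor_phi hτ ρ)⟩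
  compat _ _ _ := rfl
  inj := (F.reducedTransform hτ).isSteinerForm_form.inj

theorem finrank_imPhi_le [FiniteDimensional k T] (F : SteinerBundle k S T V) :
    finrank k F.imPhi ≤ finrank k T := by
  have := LinearMap.finrank_range_le F.phi
  rwa [Subspace.dual_finrank_eq] at this

/-- For the reduced summand the multiplication map is surjective, so its dual is injective. -/
theorem finrank_imPhi_reducedSummand [FiniteDimensional k T] (F : SteinerBundle k S T V) :
    finrank k F.reducedSummand.imPhi = finrank k F.T0 := by
  have hsurj : Function.Surjective F.reducedSummand.mulMap := by
    rintro ⟨_, z, rfl⟩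
    refine ⟨z, Subtype.ext ?_⟩
    show (F.T0.subtype ∘ₗ F.reducedSummand.mulMap) z = F.mulMap z
    congr 1
    exact TensorProduct.ext' fun s u => rfl
  have hinj : Function.Injective F.reducedSummand.phi :=
    LinearMap.dualMap_injective_of_surjective hsurj
  rw [LinearMap.finrank_range_of_inj hinj, Subspace.dual_finrank_eq]

end SteinerBundle

end

noncomputable section

/-! ### Components, Krull dimension and the statements for maximal families. -/

section Components

variable {X : Type*} [TopologicalSpace X]

theorem IsIrredComponent.isClosed {Z Y : Set X} (hY : IsClosed Y) (h : IsIrredComponent Z Y) :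
    IsClosed Z := by
  have := h.2 (y := closure Z) ⟨h.1.1.closure, closure_minimal h.1.2 hY⟩ subset_closure
  exact closure_subset_iff_isClosed.1 this

end Components

section Dimension

variable {k : Type*} [Field k] [IsAlgClosed k] {W : Type*} [AddCommGroup W] [Module k W]
  [FiniteDimensional k W]

theorem exists_coneDim_eq_succ {Z : Set (ℙ k W)} (hZ : IsIrreducible Z) (hZc : IsClosed Z) :
    ∃ m : ℕ, coneDim Z = m + 1 ∧ zdim Z = m := by
  obtain ⟨m, hm⟩ := Nat.exists_eq_add_of_le' (coneDim_pos hZ)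
  exact ⟨m, hm, zdim_eq hZ hZc hm⟩

theorem zdim_linSet {K : Submodule k W} (hK : 1 ≤ finrank k K) :
    ∃ c : ℕ, finrank k K = c + 1 ∧ zdim (linSet K) = c := by
  have hK0 : K ≠ ⊥ := Submodule.one_le_finrank_iff.1 hK
  obtain ⟨c, hc⟩ := Nat.exists_eq_add_of_le' hK
  exact ⟨c, hc, zdim_eq (isIrreducible_linSet hK0) (isClosed_linSet K)
    ((coneDim_linSet hK0).trans hc)⟩

end Dimension

namespace IsMaxFamily

variable {k : Type*} [Field k] [IsAlgClosed k]
  {U : Type*} [AddCommGroup U] [Module k U] [FiniteDimensional k U]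
  {S : Type*} [AddCommGroup S] [Module k S] [FiniteDimensional k S]
  {V : Type*} [AddCommGroup V] [Module k V] [FiniteDimensional k V]
  {β : U →ₗ[k] S →ₗ[k] V →ₗ[k] k} {J : Set (ℙ k U)}
  {a : Dual k S} {U' : Type*} [AddCommGroup U'] [Module k U'] [FiniteDimensional k U']
  {β' : U' →ₗ[k] LinearMap.ker a →ₗ[k] V →ₗ[k] k} {pr : U →ₗ[k] U'}

/-- The dimensions of the images under the projection and of its target. -/
theorem exists_zdim_eq (hJ : IsMaxFamily β J) (h : IsFirstProjection β a β' pr) (ha : a ≠ 0)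
    (hpq : 3 ≤ finrank k S ∨ finrank k V = 2) {x₀ : U} (hx₀ : x₀ ∈ cone J) {η : Dual k V}
    (hη : IsProd β x₀ a η) : ∃ r c : ℕ, r + c + 1 = coneDim J ∧
      zdim (linSet (firstKer β a)) = c ∧ finrank k U' + c + 1 = finrank k U ∧
      zdim (projImage pr J) = r ∧ zdim (projImage pr (rankOneSet β)) = r ∧
      zdim (rankOneSet β') = r := by
  obtain ⟨hdim, -⟩ := hJ.dim_projImage h ha hpq hx₀ hη.mem_firstKer
  have hZirr := isIrreducible_projImage hJ.irreducible (hJ.exists_ne_zero h ha)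
  obtain ⟨r, hr, hrz⟩ := exists_coneDim_eq_succ hZirr (isClosed_projImage pr J)
  obtain ⟨c, hc, hcz⟩ := zdim_linSet (K := firstKer β a) <| Submodule.one_le_finrank_iff.2
    fun h0 => ne_zero_of_mem_cone hx₀ (by simpa [h0] using hη.mem_firstKer)
  have hfin := h.finrank_add
  have hXY : projImage pr (rankOneSet β) ⊆ rankOneSet β' :=
    h.projImage_subset_rankOneSet subset_rfl
  have hZX : projImage pr J ⊆ projImage pr (rankOneSet β) := projImage_mono _ hJ.subset
  -- The image of `J` already attains the bound for every irreducible closed subset of the target,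
  -- so the intermediate image of all forms of rank one has the same dimension.
  have hY : zdim (rankOneSet β') ≤ r := by
    refine zdim_le (isClosed_rankOneSet β') fun Z hZY hZ hZc => ?_
    have := hJ.coneDim_add_le h ha hpq hZ hZc hZY
    omega
  exact ⟨r, c, by omega, hcz, by omega, hrz,
    le_antisymm ((zdim_mono hXY).trans hY) (hrz ▸ zdim_mono hZX),
    le_antisymm hY (hrz ▸ zdim_mono (hZX.trans hXY))⟩

/-- If the target of the projection is irreducible, then it is the image of the family, which
consists of all elements of rank one. -/
theorem eq_of_isIrreducible (hJ : IsMaxFamily β J) (h : IsFirstProjection β a β' pr) (ha : a ≠ 0)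
    (hmax : ∀ A, IsIrreducible A → A ⊆ rankOneSet β → J ⊆ A → A ⊆ J)
    (hpq : 3 ≤ finrank k S ∨ finrank k V = 2) {x₀ : U} (hx₀ : x₀ ∈ cone J) {η : Dual k V}
    (hη : IsProd β x₀ a η) (hirr : IsIrreducible (rankOneSet β')) :
    rankOneSet β = J ∧ projImage pr J = rankOneSet β' := by
  have hZY : projImage pr J ⊆ rankOneSet β' := h.projImage_subset_rankOneSet hJ.subset
  have hYJ : projImage pr J = rankOneSet β' := by
    by_contra hcon
    -- A proper closed subset of the irreducible target would have smaller dimension, but the image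
    -- of `J` has the maximal one.
    have h1 := coneDim_lt (isIrreducible_projImage hJ.irreducible (hJ.exists_ne_zero h ha)) hirr
      (isClosed_projImage _ _) (isClosed_rankOneSet β') (hZY.ssubset_of_ne hcon)
    have h2 := hJ.coneDim_add_le h ha hpq hirr (isClosed_rankOneSet β') subset_rfl
    have h3 := (hJ.dim_projImage h ha hpq hx₀ hη.mem_firstKer).1
    omega
  exact ⟨hJ.rankOneSet_eq h ha hmax hpq hYJ hx₀ hη, hYJ⟩

theorem inheritance (hJ : IsMaxFamily β J) (h : IsFirstProjection β a β' pr) (ha : a ≠ 0)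
    (hmax : ∀ A, IsIrreducible A → A ⊆ rankOneSet β → J ⊆ A → A ⊆ J)
    (hpq : 3 ≤ finrank k S ∨ finrank k V = 2) {x₀ : U} (hx₀ : x₀ ∈ cone J) {η : Dual k V}
    (hη : IsProd β x₀ a η) (hirr : IsIrreducible (rankOneSet β')) :
    rankOneSet β' = projImage pr (rankOneSet β) ∧ IsIrreducible (rankOneSet β) ∧
      firstFactors (swapForm β) = firstFactors (swapForm β') ∧
      firstFactors β' = projImage (LinearMap.ker a).subtype.dualMap (firstFactors β) := by
  obtain ⟨hXJ, hYJ⟩ := hJ.eq_of_isIrreducible h ha hmax hpq hx₀ hη hirr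
  have hYX : projImage pr (rankOneSet β) = rankOneSet β' := by rw [hXJ, hYJ]
  have hX : IsIrreducible (rankOneSet β) := hXJ ▸ hJ.irreducible
  exact ⟨hYX.symm, hX, h.secondFactors_eq hJ.steiner hX
    (by rw [hXJ]; exact hJ.exists_ne_zero h ha) hYX, h.firstFactors_eq hJ.steiner hYX⟩

end IsMaxFamily

end

/-! ### Translation back to Steiner bundles. -/

theorem mainTheorem6 {k : Type*} [Field k] [IsAlgClosed k]
    {S T V : Type*} [AddCommGroup S] [Module k S] [FiniteDimensional k S]
    [AddCommGroup T] [Module k T] [FiniteDimensional k T]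
    [AddCommGroup V] [Module k V] [FiniteDimensional k V]
    (n s t : ℕ) (hn : 1 ≤ n) (hs : 2 ≤ s) (hsn : 3 ≤ s ∨ n = 1)
    (hS : Module.finrank k S = s) (hT : Module.finrank k T = t)
    (hV : Module.finrank k V = n + 1)
    (F : SteinerBundle k S T V)
    -- the set of jumping pairs has dimension `t - n - s + 1`
    (hF : zdim F.jumpingVariety + n + s = t + 1)
    -- a component of maximal dimension
    (J₀ : Set (ℙ k F.imPhi)) (hJ₀ : IsIrredComponent J₀ F.jumpingVariety)
    (hJ₀dim : zdim J₀ = zdim F.jumpingVariety)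
    -- a point `(α, H)` of this component, with `α = [a]`, `H = [h]`, and the point `[τ]` of `ℙ(T)`
    (a : Module.Dual k S) (h : Module.Dual k V) (ha : a ≠ 0) (hh : h ≠ 0)
    (hJ₀mem : (J₀ ∩ F.inPT0 {(Projectivization.mk k a ha, Projectivization.mk k h hh)}).Nonempty)
    (τ : Module.Dual k T) (hτ : F.phi τ = pureTensor a h) :
    -- `F'` is an `(s-1, t-1)`-Steiner bundle
    (Module.finrank k (LinearMap.ker a) + 1 = s ∧ Module.finrank k (LinearMap.ker τ) + 1 = t) ∧
    -- `pr_{(α,H)}` is the linear projection with centre `π₁⁻¹(α)`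
    (Function.Surjective (F.prMap hτ) ∧
      {x : ℙ k F.imPhi | F.prMap hτ x.rep = 0} = F.firstFibre (Projectivization.mk k a ha)) ∧
    -- dimensions of the images of `J₀` and of `J̃(F)`
    (zdim (F.prImage hτ J₀) + zdim (F.firstFibre (Projectivization.mk k a ha)) + n + s
        = t + 1 ∧
      zdim (F.prImage hτ F.jumpingVariety)
        + zdim (F.firstFibre (Projectivization.mk k a ha)) + n + s = t + 1) ∧
    -- dimension of `J̃(F'₀)`; it is the maximal one, `dim T'₀ - n - (s - 1) + 1`
    (zdim (F.reducedTransform hτ).jumpingVariety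
        + zdim (F.firstFibre (Projectivization.mk k a ha)) + n + s = t + 1 ∧
      zdim (F.reducedTransform hτ).jumpingVariety + n + s
        = Module.finrank k (F.elementaryTransform hτ).T0 + 2) ∧
    -- the irreducible case
    (IsIrreducible (F.reducedTransform hτ).jumpingVariety →
      (F.reducedTransform hτ).jumpingVariety = F.prImage hτ F.jumpingVariety ∧
      IsIrreducible F.jumpingVariety ∧
      F.jumpingHyperplanes = (F.reducedTransform hτ).jumpingHyperplanes ∧
      (F.reducedTransform hτ).sigmaSet
        = projImage (SteinerBundle.prAlpha a) F.sigmaSet) := by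
  have hX : F.jumpingVariety = rankOneSet (U := F.imPhi) F.form := F.jumpingVariety_eq
  have hpr := F.isFirstProjection_prMap hτ
  have hY := (F.reducedTransform hτ).jumpingVariety_eq
  have hL := F.firstFibre_eq ha
  have hXc : IsClosed F.jumpingVariety := by
    rw [hX]
    exact isClosed_rankOneSet _
  have hJc : IsClosed J₀ := hJ₀.isClosed hXc
  have hJX : J₀ ⊆ rankOneSet (U := F.imPhi) F.form := hX ▸ hJ₀.1.2
  have hmax : ∀ A, IsIrreducible A → A ⊆ rankOneSet (U := F.imPhi) F.form → J₀ ⊆ A → A ⊆ J₀ :=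
    fun A hA hAX hJA => hJ₀.2 ⟨hA, hX ▸ hAX⟩ hJA
  obtain ⟨m, hm, hmz⟩ := exists_coneDim_eq_succ hJ₀.1.1 hJc
  have hmt : m + n + s = t + 1 := by
    rw [← hJ₀dim, hmz] at hF
    exact_mod_cast hF
  have hu := F.finrank_imPhi_le
  have hJ : IsMaxFamily (U := F.imPhi) F.form J₀ :=
    ⟨F.isSteinerForm_form, hJ₀.1.1, hJc, hJX, by omega, by omega, by omega⟩
  -- With `dim T₀ ≤ t`, the assumed dimension makes `J₀` a maximal family. Equality in the bound
  -- then forces `dim T₀ = t`, so `F` is reduced.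
  have hdim := hJ.dim_eq
  have hpq : 3 ≤ finrank k S ∨ finrank k V = 2 := by omega
  obtain ⟨x₀, hx₀, η, hη⟩ : ∃ x₀ ∈ cone J₀, ∃ η, IsProd (U := F.imPhi) F.form x₀ a η := by
    obtain ⟨x, hxJ, hx⟩ := hJ₀mem
    obtain ⟨b, g, hb, hg, hbg, heq⟩ := SteinerBundle.mem_inPT0.1 hx
    -- Only the line of the first factor is prescribed; the scalar is moved to the second factor.
    obtain ⟨c, rfl⟩ := (Projectivization.mk_eq_mk_iff' k _ _ hb ha).1 (congrArg Prod.fst heq)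
    refine ⟨x.rep, rep_mem_cone.2 hxJ, c • g, fun s u => ?_⟩
    rw [hbg]
    simp only [LinearMap.smul_apply, smul_eq_mul]
    ring
  obtain ⟨r, c, hrc, hcz, hfin, hJz, hXz, hYz⟩ := hJ.exists_zdim_eq hpr ha hpq hx₀ hη
  have hU' := (F.elementaryTransform hτ).finrank_imPhi_reducedSummand
  have hsum : (r : WithBot ℕ∞) + c + n + s = t + 1 := by
    have : r + c + n + s = t + 1 := by omega
    exact_mod_cast this
  rw [SteinerBundle.prImage, SteinerBundle.prImage, hX, hY, hL, hJz, hXz, hYz, hcz, ← hU']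
  refine ⟨⟨?_, ?_⟩, ⟨hpr.surj, ?_⟩, ⟨hsum, hsum⟩, ⟨hsum, ?_⟩, fun hirr => ?_⟩
  · rw [finrank_ker_add_one ha, hS]
  · rw [finrank_ker_add_one, hT]
    rintro rfl
    rw [map_zero] at hτ
    exact pureTensor_ne_zero ha hh hτ.symm
  · rw [← hpr.ker_eq]
    rfl
  · have : r + n + s = finrank k (F.reducedTransform hτ).imPhi + 2 := by omega
    exact_mod_cast this
  · rw [SteinerBundle.jumpingHyperplanes_eq, SteinerBundle.jumpingHyperplanes_eq,
      SteinerBundle.sigmaSet_eq, SteinerBundle.sigmaSet_eq]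
    exact hJ.inheritance hpr ha hmax hpq hx₀ hη hirr
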